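/- **Setting.** Let $\mathbb X$ be a compact connected smooth Riemannian manifold without boundary, with geodesic distance $\rho$ and closed balls $B(x,t)$, and let $\mu$ be a Borel probability measure on $\mathbb X$. Write $\langle f,g\rangle=\int_{\mathbb X} fg\,d\mu$ and $\|\cdot\|_p$ for the norm of $L^p(\mu)$ (complex-valued functions). Let $\phi_0\equiv 1,\phi_1,\phi_2,\dots$ be continuous real functions, orthonormal in $L^2(\mu)$, and let $0=\ell_0\le\ell_1\le\cdots$ with $\ell_j\to\infty$. Let $\Pi_L$ be the linear span of $\{\phi_j:\ell_j\le L\}$, let $X^p$ be the closure of $\bigcup_L\Pi_L$ in $L^p(\mu)$, and let $$K_t(x,y)=\sum_{j=0}^\infty e^{-\ell_j^2t}\phi_j(x)\phi_j(y).$$ Assume that there are $\alpha>0$, $A\ge2$ and positive constants $c_1,\dots,c_6$ such that, for all $x,y\in\mathbb X$ and $t\in(0,1]$: * $\mu(B(x,s))\le c_1s^\alpha$ for all $s>0$; * the series for $K_t(x,y)$ converges, $\int_{\mathbb X} K_t(x,z)\,d\mu(z)=1$, and $|K_t(x,y)|\le c_2t^{-\alpha/2}e^{-c_3\rho(x,y)^2/t}$;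 * $K_t(x,\cdot)$ is differentiable and $|\nabla_yK_t(x,y)|\le c_4t^{-\alpha/2-1}e^{-c_5\rho(x,y)^2/t}$; * (product assumption) for every $\kappa>0$, $L^{\kappa}\sup_{\ell_j,\ell_k\le L}\ \inf_{P\in\Pi_{AL}}\|\phi_j\phi_k-P\|_\infty\to0$ as $L\to\infty$; * (lower bound) $K_t(x,x)\ge c_6t^{-\alpha/2}$. For $s\ge0$, $(\Delta^*)^sf$ denotes the integrable function $g$ with $\langle g,\phi_k\rangle=(1+\ell_k)^s\langle f,\phi_k\rangle$ for all $k\ge0$, if there is one, and $W^p_s$ is the set of all $f\in X^p$ such that $(\Delta^*)^sf$ exists and lies in $X^p$. Fix an integer $S>\alpha$ and $\beta\in\mathbb R$. Let $b:\mathbb R\to\mathbb R$ be a mask of type $\beta$: $b$ is even and $S$ times continuously differentiable, and $b(t)=(1+t)^{-\beta}F(\log t)$ for $t>0$, where $F:\mathbb R\to\mathbb R$ has bounded derivatives of orders $0,\dots,S$ and is bounded below by a positive constant. Let $G:\mathbb X\times\mathbb X\to\mathbb R$ have the formal expansion $\sum_jb(\ell_j)\phi_j(x)\phi_j(y)$,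 that is, for every $y\in\mathbb X$, $G(\cdot,y)$ is integrable and $\langle G(\cdot,y),\phi_k\rangle=b(\ell_k)\phi_k(y)$ for all $k$. For a finite set $\mathcal C\subset\mathbb X$ let $$\mathbb G(\mathcal C)=\Big\{\sum_{y\in\mathcal C}a_yG(\cdot,y):a_y\in\mathbb R\Big\},\qquad q(\mathcal C)=\min_{x\ne y\in\mathcal C}\rho(x,y),\qquad \delta(\mathcal C)=\sup_{x\in\mathbb X}\rho(x,\mathcal C).$$ **Theorem.** Let $1\le p\le\infty$, $1/p+1/p'=1$, $0<\gamma<\beta-\alpha/p'$, $\gamma\le r<\beta$, and let $\kappa_1,\kappa_2,c>0$. There is a constant $c'>0$, depending only on the objects fixed so far, such that the following holds. Let $\mathcal C_1\subseteq\mathcal C_2\subseteq\cdots$ be finite subsets of $\mathbb X$ with $\delta(\mathcal C_m)\le2q(\mathcal C_m)$ and with $\kappa_1/m\le q(\mathcal C_m)\le\kappa_2/m$ and $\kappa_1/m\le\delta(\mathcal C_m)\le\kappa_2/m$ for all $m\ge1$. Let $f\in W^p_r$. Then $f\in W^p_\gamma$, and for every $m\ge1$ and every $\Psi_m\in\mathbb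 G(\mathcal C_m)$ we have $\Psi_m\in W^p_\gamma$, and $$\|f-\Psi_m\|_p\le c\,m^{-r}\|(\Delta^*)^rf\|_p\quad\text{implies}\quad\|(\Delta^*)^\gamma f-(\Delta^*)^\gamma\Psi_m\|_p\le c'\,m^{\gamma-r}\|(\Delta^*)^rf\|_p.$$ -/

import Mathlib

open MeasureTheory Filter Topology
open scoped Manifold ContDiff ENNReal Bundle

namespace Eignet

noncomputable section

/-! ### The system `{φ_j}`, `{ℓ_j}`: diffusion polynomials, heat kernel, Fourier coefficients -/

/-- `Π_L`: the (complex) span of those `φ_j` with `ℓ_j ≤ L`. -/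
def diffusionPoly {X : Type*} (φ : ℕ → X → ℝ) (ℓ : ℕ → ℝ) (L : ℝ) : Submodule ℂ (X → ℂ) :=
  Submodule.span ℂ {P | ∃ j, ℓ j ≤ L ∧ P = fun x => ((φ j x : ℝ) : ℂ)}

/-- The `L^p` distance `dist(p; f, W)` from `f` to a set `W` of functions. -/
def distLp {X : Type*} [MeasurableSpace X] (μ : Measure X) (p : ℝ≥0∞) (f : X → ℂ)
    (W : Set (X → ℂ)) : ℝ≥0∞ :=
  ⨅ P ∈ W, eLpNorm (f - P) p μ

/-- `X^p`: the `L^p` closure of the union of all `Π_L`. Members are functions, norms and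
distances do not see null sets. -/
def closureLp {X : Type*} [MeasurableSpace X] (μ : Measure X) (φ : ℕ → X → ℝ) (ℓ : ℕ → ℝ)
    (p : ℝ≥0∞) : Set (X → ℂ) :=
  {f | MemLp f p μ ∧ distLp μ p f (⋃ L : ℝ, (diffusionPoly φ ℓ L : Set (X → ℂ))) = 0}

/-- The coefficient `⟨f, φ_k⟩ = ∫ f φ_k dμ`. -/
def coeff {X : Type*} [MeasurableSpace X] (μ : Measure X) (φ : ℕ → X → ℝ) (f : X → ℂ)
    (k : ℕ) : ℂ :=
  ∫ x, f x * ((φ k x : ℝ) : ℂ) ∂μ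

/-- The heat kernel `K_t(x,y) = ∑_j exp(-ℓ_j² t) φ_j(x) φ_j(y)`. -/
def heatKernel {X : Type*} (φ : ℕ → X → ℝ) (ℓ : ℕ → ℝ) (t : ℝ) (x y : X) : ℝ :=
  ∑' j, Real.exp (-(ℓ j) ^ 2 * t) * φ j x * φ j y

/-- `ε_L = sup_{ℓ_j, ℓ_k ≤ L} dist(∞; φ_j φ_k, Π_{AL})`. -/
def productError {X : Type*} [MeasurableSpace X] (μ : Measure X) (φ : ℕ → X → ℝ) (ℓ : ℕ → ℝ)
    (A L : ℝ) : ℝ≥0∞ :=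
  ⨆ (j : ℕ) (k : ℕ) (_ : ℓ j ≤ L) (_ : ℓ k ≤ L),
    distLp μ ∞ (fun x => ((φ j x * φ k x : ℝ) : ℂ)) (diffusionPoly φ ℓ (A * L) : Set (X → ℂ))

/-- The derivative of `u` at `y` in the direction of the tangent vector `v`. -/
def dirDeriv {n : ℕ} {X : Type*} [TopologicalSpace X]
    [ChartedSpace (EuclideanSpace ℝ (Fin n)) X] (u : X → ℝ) (y : X)
    (v : TangentSpace (𝓡 n) y) : ℝ :=
  mfderiv (𝓡 n) 𝓘(ℝ, ℝ) u y v

/-- The standing assumptions on the measure `μ` and the systems `{φ_j}`, `{ℓ_j}` on a compact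
Riemannian manifold `X` of dimension `n` (whose distance is the geodesic distance). -/
structure IsAdmissibleSystem {n : ℕ} {X : Type*} [MetricSpace X]
    [ChartedSpace (EuclideanSpace ℝ (Fin n)) X]
    [Bundle.RiemannianBundle (fun x : X => TangentSpace (𝓡 n) x)]
    [MeasurableSpace X] (μ : Measure X) (φ : ℕ → X → ℝ) (ℓ : ℕ → ℝ) (α A : ℝ) : Prop where
  alpha_pos : 0 < α
  continuous_phi : ∀ j, Continuous (φ j)
  orthonormal : ∀ j k, ∫ x, φ j x * φ k x ∂μ = if j = k then 1 else 0
  phi_zero : ∀ x, φ 0 x = 1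
  ell_zero : ℓ 0 = 0
  ell_mono : Monotone ℓ
  ell_tendsto : Tendsto ℓ atTop atTop
  /-- `μ(B(x,r)) ≤ c r^α`. -/
  ball_measure : ∃ c > 0, ∀ (x : X) (r : ℝ), 0 < r →
    μ (Metric.closedBall x r) ≤ ENNReal.ofReal (c * r ^ α)
  /-- The series that defines the heat kernel converges. -/
  heat_summable : ∀ t ∈ Set.Ioc (0 : ℝ) 1, ∀ x y : X,
    Summable fun j => Real.exp (-(ℓ j) ^ 2 * t) * φ j x * φ j y
  heat_integral : ∀ t ∈ Set.Ioc (0 : ℝ) 1, ∀ x : X, ∫ y, heatKernel φ ℓ t x y ∂μ = 1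
  /-- The Gaussian upper bound. -/
  heat_upper : ∃ c₁ > 0, ∃ c > 0, ∀ t ∈ Set.Ioc (0 : ℝ) 1, ∀ x y : X,
    |heatKernel φ ℓ t x y| ≤ c₁ * t ^ (-α / 2) * Real.exp (-c * dist x y ^ 2 / t)
  /-- The Gaussian bound on the first order derivatives in the second variable, in all
  directions `v` and measured in the Riemannian norm (in normal coordinates at `y` the
  coordinate directions are orthonormal at `y`). -/
  heat_gradient : ∃ c₁ > 0, ∃ c > 0, ∀ t ∈ Set.Ioc (0 : ℝ) 1, ∀ x y : X,
    MDifferentiableAt (𝓡 n) 𝓘(ℝ, ℝ) (heatKernel φ ℓ t x) y ∧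
    ∀ v : TangentSpace (𝓡 n) y,
      |dirDeriv (heatKernel φ ℓ t x) y v| ≤
        c₁ * t ^ (-α / 2 - 1) * Real.exp (-c * dist x y ^ 2 / t) * ‖v‖
  two_le_A : 2 ≤ A
  /-- The product assumption: `L^c ε_L → 0` for every `c > 0`. -/
  product : ∀ c : ℝ, 0 < c →
    Tendsto (fun L : ℝ => ENNReal.ofReal (L ^ c) * productError μ φ ℓ A L) atTop (𝓝 0)

/-- The lower bound `K_t(x,x) ≥ c t^{-α/2}` on the diagonal. -/
def HeatLowerBound {X : Type*} (φ : ℕ → X → ℝ) (ℓ : ℕ → ℝ) (α : ℝ) : Prop :=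
  ∃ c > 0, ∀ t ∈ Set.Ioc (0 : ℝ) 1, ∀ x : X, c * t ^ (-α / 2) ≤ heatKernel φ ℓ t x x

/-! ### The operators `(Δ*)^r` and the classes `W^p_r` -/

/-- `g = (Δ*)^r f`: `g` is the integrable function with
`⟨g, φ_k⟩ = (1 + ℓ_k)^r ⟨f, φ_k⟩` for all `k`. -/
def IsDeltaStar {X : Type*} [MeasurableSpace X] (μ : Measure X) (φ : ℕ → X → ℝ) (ℓ : ℕ → ℝ)
    (r : ℝ) (f g : X → ℂ) : Prop :=
  Integrable g μ ∧ ∀ k, coeff μ φ g k = (((1 + ℓ k) ^ r : ℝ) : ℂ) * coeff μ φ f k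

/-- `W^p_r`: all `f ∈ X^p` with `(Δ*)^r f ∈ X^p`. -/
def smoothClass {X : Type*} [MeasurableSpace X] (μ : Measure X) (φ : ℕ → X → ℝ) (ℓ : ℕ → ℝ)
    (p : ℝ≥0∞) (r : ℝ) : Set (X → ℂ) :=
  {f | f ∈ closureLp μ φ ℓ p ∧ ∃ g ∈ closureLp μ φ ℓ p, IsDeltaStar μ φ ℓ r f g}

/-! ### Masks, kernels and eignets -/

/-- `b` is a mask of type `β` (with `S` derivatives). -/
def IsMask (S : ℕ) (β : ℝ) (b : ℝ → ℝ) : Prop :=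
  (∀ t, b (-t) = b t) ∧ ContDiff ℝ S b ∧
  ∃ F : ℝ → ℝ, ContDiff ℝ S F ∧
    (∀ t, 0 < t → b t = (1 + t) ^ (-β) * F (Real.log t)) ∧
    (∃ c, ∀ k ≤ S, ∀ u, |iteratedDeriv k F u| ≤ c) ∧
    ∃ c₁ > 0, ∀ u, c₁ ≤ F u

/-- The formal expansion `G(x,y) = ∑_j b(ℓ_j) φ_j(x) φ_j(y)`: each `G(·,y)` is integrable and
its `k`-th coefficient is `b(ℓ_k) φ_k(y)`. -/
def HasFormalExpansion {X : Type*} [MeasurableSpace X] (μ : Measure X) (φ : ℕ → X → ℝ)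
    (ℓ : ℕ → ℝ) (b : ℝ → ℝ) (G : X → X → ℝ) : Prop :=
  ∀ y, Integrable (fun x => G x y) μ ∧ ∀ k, ∫ x, G x y * φ k x ∂μ = b (ℓ k) * φ k y

/-- The set of eignets with kernel `G` and centers `C`. -/
def eignets {X : Type*} (G : X → X → ℝ) (C : Finset X) : Set (X → ℝ) :=
  {Ψ | ∃ a : X → ℝ, Ψ = fun x => ∑ y ∈ C, a y * G x y}

/-! ### Sets of centers -/

/-- The mesh norm `δ(C) = sup_x dist(x, C)`. -/
def meshNorm {X : Type*} [MetricSpace X] (C : Finset X) : ℝ :=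
  ⨆ x : X, Metric.infDist x (C : Set X)

/-- A nested sequence of finite sets `C_1 ⊆ C_2 ⊆ ⋯` with `δ(C_m) ≤ 2 q(C_m)` and
`q(C_m) ∼ δ(C_m) ∼ 1/m`, with constants `κ₁`, `κ₂`; here `q(C)`, the minimal separation, is
`Set.infsep`. -/
structure IsCenterSequence {X : Type*} [MetricSpace X] (κ₁ κ₂ : ℝ) (C : ℕ → Finset X) :
    Prop where
  nested : ∀ m, 1 ≤ m → C m ⊆ C (m + 1)
  uniform : ∀ m, 1 ≤ m → meshNorm (C m) ≤ 2 * (C m : Set X).infsep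
  sep_lower : ∀ m : ℕ, 1 ≤ m → κ₁ / m ≤ (C m : Set X).infsep
  sep_upper : ∀ m : ℕ, 1 ≤ m → (C m : Set X).infsep ≤ κ₂ / m
  mesh_lower : ∀ m : ℕ, 1 ≤ m → κ₁ / m ≤ meshNorm (C m)
  mesh_upper : ∀ m : ℕ, 1 ≤ m → meshNorm (C m) ≤ κ₂ / m

end

end Eignet

open Eignet

/-!
The proof works with an abstract *heat system* (`IsHeatSystem`): an orthonormal system on a metric
measure space whose heat kernel has Gaussian upper bounds and a lower bound on the diagonal.

*Localization.* As a function of `u = exp (-(ℓ/N)²)`, a power `u^i` has the heat kernel at time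
`i / N²` as its kernel. If `g` has `S` derivatives in `θ`, `u = (1 + cos θ) / 2`, then Jackson's
theorem with control of the coefficients (`jackson`, by iterated Fejér–Korovkin means) replaces `g`
by a polynomial of degree `n ≈ ε N ρ` with error `n^(-S)`, while the Gaussian bounds make the
polynomial part exponentially small at distance `ρ`. Hence the kernel of the multiplier `u g(u)` is
`O(N^α (1 + N ρ)^(-S))` (`exists_localization`); this covers smooth band-pass cutoffs of
`(1 + ℓ)^e F(log ℓ)`, uniformly in the scale (`exists_band_localization`).

*Multipliers.* Since `S > α`, Schur's test (`eLpNorm_le_of_schur`) bounds the operators with such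
kernels on `L^p(μ)`, and also between `L^p(μ)` and `ℓ^p` over a separated set of centers. Three facts
follow: integrable functions are determined by their coefficients (`ae_eq_of_coeff_eq`), Bernstein's
inequality for low frequencies (`exists_eLpNorm_lowPass_le`), and decay of the high frequencies of
smooth functions and of eignets (`exists_highPass`, `exists_eignet_highPass`), by summing over dyadic
bands.

*Coefficients of eignets.* In a wide band of frequencies around `N` the lower bound on the heat
kernel gives a diagonal of size `N^(α-β)` for the band of `G` (`exists_band_lower_bound`). For `N`
well above the inverse separation of the centers its matrix at the centers is diagonally dominant
(`exists_eLpNorm_coefficients_le`), so the coefficients of an eignet `Ψ` are controlled by the band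
of `Ψ`, that is, by `‖f - Ψ‖_p` and the band of `f`, which is `O(N^(-r) ‖(Δ*)^r f‖_p)`
(`exists_eLpNorm_eignet_coefficients_le`).

*Conclusion.* With `2^k ≈ m`, the difference `(Δ*)^γ f - (Δ*)^γ Ψ` is the sum of its low frequencies,
which Bernstein's inequality bounds by `m^γ ‖f - Ψ‖_p`, the high frequencies of `(Δ*)^γ f`, of order
`m^(γ-r)`, and the high frequencies of `(Δ*)^γ Ψ`, which the bound on the coefficients makes of the
same order (`exists_eLpNorm_deltaStar_sub_le`).
-/

namespace Eignet

set_option linter.unusedSectionVars false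

/-! ### Polynomials with controlled coefficients -/

/-- `f` is a polynomial function of degree less than `n` whose coefficients have absolute sum at
most `B`. -/
def HasCoeffBound (n : ℕ) (B : ℝ) (f : ℝ → ℝ) : Prop :=
  ∃ p : ℕ → ℝ, (∀ u, f u = ∑ i ∈ Finset.range n, p i * u ^ i) ∧
    ∑ i ∈ Finset.range n, |p i| ≤ B

namespace HasCoeffBound

lemma mono {n n' : ℕ} {B B' : ℝ} {f : ℝ → ℝ} (h : HasCoeffBound n B f) (hn : n ≤ n')
    (hB : B ≤ B') : HasCoeffBound n' B' f := by
  obtain ⟨p, hp, hB0⟩ := h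
  refine ⟨fun i => if i < n then p i else 0, fun u => ?_, ?_⟩
  · rw [hp u, ← Finset.sum_subset (Finset.range_mono hn)]
    · exact Finset.sum_congr rfl fun i hi => by simp [Finset.mem_range.1 hi]
    · intro i _ hi
      simp [Finset.mem_range.not.1 hi]
  · rw [← Finset.sum_subset (Finset.range_mono hn)]
    · refine le_trans (le_of_eq (Finset.sum_congr rfl fun i hi => ?_)) (hB0.trans hB)
      simp [Finset.mem_range.1 hi]
    · intro i _ hi
      simp [Finset.mem_range.not.1 hi]

lemma add {n : ℕ} {B B' : ℝ} {f g : ℝ → ℝ} (hf : HasCoeffBound n B f)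
    (hg : HasCoeffBound n B' g) : HasCoeffBound n (B + B') (fun u => f u + g u) := by
  obtain ⟨p, hp, hB⟩ := hf
  obtain ⟨q, hq, hB'⟩ := hg
  refine ⟨fun i => p i + q i, fun u => ?_, ?_⟩
  · beta_reduce
    rw [hp, hq, ← Finset.sum_add_distrib]
    exact Finset.sum_congr rfl fun i _ => by ring
  · refine le_trans (Finset.sum_le_sum fun i _ => abs_add_le (p i) (q i)) ?_
    rw [Finset.sum_add_distrib]
    exact add_le_add hB hB'

lemma const_mul {n : ℕ} {B : ℝ} {f : ℝ → ℝ} (hf : HasCoeffBound n B f) (c : ℝ) :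
    HasCoeffBound n (|c| * B) (fun u => c * f u) := by
  obtain ⟨p, hp, hB⟩ := hf
  refine ⟨fun i => c * p i, fun u => ?_, ?_⟩
  · beta_reduce
    rw [hp, Finset.mul_sum]
    exact Finset.sum_congr rfl fun i _ => by ring
  · simp only [abs_mul, ← Finset.mul_sum]
    exact mul_le_mul_of_nonneg_left hB (abs_nonneg c)

lemma mul_id {n : ℕ} {B : ℝ} {f : ℝ → ℝ} (hf : HasCoeffBound n B f) :
    HasCoeffBound (n + 1) B (fun u => u * f u) := by
  obtain ⟨p, hp, hB⟩ := hf
  refine ⟨fun i => if i = 0 then 0 else p (i - 1), fun u => ?_, ?_⟩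
  · beta_reduce
    rw [hp, Finset.sum_range_succ', Finset.mul_sum]
    simp only [Nat.add_eq_zero_iff, one_ne_zero, and_false, if_false, Nat.add_sub_cancel, if_true,
      zero_mul, add_zero]
    exact Finset.sum_congr rfl fun i _ => by ring
  · rw [Finset.sum_range_succ']
    simpa using hB

lemma sum {ι : Type*} {n : ℕ} (s : Finset ι) {B : ι → ℝ} {f : ι → ℝ → ℝ}
    (h : ∀ i ∈ s, HasCoeffBound n (B i) (f i)) :
    HasCoeffBound n (∑ i ∈ s, B i) (fun u => ∑ i ∈ s, f i u) := by
  classical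
  induction s using Finset.induction_on with
  | empty => exact ⟨0, by simp, by simp⟩
  | insert a s ha ih =>
    simp only [Finset.sum_insert ha]
    exact (h a (Finset.mem_insert_self a s)).add
      (ih fun i hi => h i (Finset.mem_insert_of_mem hi))

/-- The coefficients of the shifted Chebyshev polynomial `T_k(2u - 1)` grow at most
geometrically. -/
lemma chebyshev (k : ℕ) :
    HasCoeffBound (k + 1) (7 ^ k) (fun u => (Polynomial.Chebyshev.T ℝ k).eval (2 * u - 1)) := by
  have h0 : HasCoeffBound 1 1 (fun u => (Polynomial.Chebyshev.T ℝ (0 : ℕ)).eval (2 * u - 1)) :=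
    ⟨fun _ => 1, by simp, by simp⟩
  have h1 : HasCoeffBound 2 7 (fun u => (Polynomial.Chebyshev.T ℝ (1 : ℕ)).eval (2 * u - 1)) :=
    ⟨fun i => if i = 0 then -1 else 2, by intro u; simp [Finset.sum_range_succ]; ring,
      by norm_num [Finset.sum_range_succ]⟩
  induction k using Nat.twoStepInduction with
  | zero => simpa using h0
  | one => simpa using h1
  | more k ih1 ih2 =>
    have e : (fun u : ℝ => (Polynomial.Chebyshev.T ℝ ((k + 2 : ℕ) : ℤ)).eval (2 * u - 1)) =
        fun u => (4 * (u * (Polynomial.Chebyshev.T ℝ ((k + 1 : ℕ) : ℤ)).eval (2 * u - 1)) +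
          (-2) * (Polynomial.Chebyshev.T ℝ ((k + 1 : ℕ) : ℤ)).eval (2 * u - 1)) +
          (-1) * (Polynomial.Chebyshev.T ℝ (k : ℤ)).eval (2 * u - 1) := by
      funext u
      push_cast
      rw [Polynomial.Chebyshev.T_add_two]
      simp
      ring
    rw [e]
    refine (((ih2.mul_id.const_mul 4).add ((ih2.mono (Nat.le_succ _) le_rfl).const_mul (-2))).add
      ((ih1.mono (by omega) le_rfl).const_mul (-1))).mono (by omega) ?_
    have : (0 : ℝ) < 7 ^ k := by positivity
    norm_num [pow_succ]
    linarith

end HasCoeffBound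

/-! ### The Fejér–Korovkin kernel and Jackson's theorem -/

/-- The weights `sin (π (i + 1) / (n + 1))` of the Fejér–Korovkin kernel. They vanish for
`i = -1` and `i = n`, and are an eigenvector of the path with `n` vertices. -/
noncomputable def korovkinWeight (n i : ℕ) : ℝ := Real.sin (Real.pi * (i + 1) / (n + 1))

/-- The squared length of the vector of weights. -/
noncomputable def korovkinMass (n : ℕ) : ℝ := ∑ i ∈ Finset.range n, korovkinWeight n i ^ 2

/-- The Fejér–Korovkin kernel `|∑_{i<n} w_i e^{iit}|² / ∑ w_i²`, a nonnegative trigonometric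
polynomial of degree less than `n`. -/
noncomputable def korovkinKernel (n : ℕ) (t : ℝ) : ℝ :=
  ∑ i ∈ Finset.range n, ∑ l ∈ Finset.range n,
    korovkinWeight n i * korovkinWeight n l / korovkinMass n * Real.cos (((i : ℝ) - l) * t)

lemma korovkinMass_pos {n : ℕ} (hn : 1 ≤ n) : 0 < korovkinMass n := by
  refine Finset.sum_pos' (fun i _ => sq_nonneg _) ⟨0, Finset.mem_range.2 hn, ?_⟩
  refine pow_pos (Real.sin_pos_of_pos_of_lt_pi ?_ ?_) 2
  · have := Real.pi_pos
    positivity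
  · have hn' : (1 : ℝ) ≤ n := by exact_mod_cast hn
    rw [div_lt_iff₀ (by positivity)]
    have := Real.pi_pos
    push_cast
    nlinarith

lemma continuous_korovkinKernel (n : ℕ) : Continuous (korovkinKernel n) := by
  unfold korovkinKernel
  fun_prop

lemma korovkinKernel_nonneg (n : ℕ) (t : ℝ) : 0 ≤ korovkinKernel n t := by
  have e : korovkinKernel n t =
      ((∑ i ∈ Finset.range n, korovkinWeight n i * Real.cos (i * t)) ^ 2 +
        (∑ i ∈ Finset.range n, korovkinWeight n i * Real.sin (i * t)) ^ 2) / korovkinMass n := by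
    rw [sq, sq, Finset.sum_mul_sum, Finset.sum_mul_sum, ← Finset.sum_add_distrib, Finset.sum_div]
    refine Finset.sum_congr rfl fun i _ => ?_
    rw [← Finset.sum_add_distrib, Finset.sum_div]
    refine Finset.sum_congr rfl fun l _ => ?_
    rw [sub_mul, Real.cos_sub]
    ring
  rw [e]
  have : 0 ≤ korovkinMass n := Finset.sum_nonneg fun i _ => sq_nonneg _
  positivity

lemma integral_cos_int_mul (k : ℤ) :
    ∫ t in (-Real.pi)..Real.pi, Real.cos (k * t) = if k = 0 then 2 * Real.pi else 0 := by
  split_ifs with h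
  · subst h
    simp
    ring
  · have hk : (k : ℝ) ≠ 0 := by exact_mod_cast h
    rw [intervalIntegral.integral_comp_mul_left (fun x => Real.cos x) hk, integral_cos]
    simp [Real.sin_int_mul_pi]

lemma integral_korovkinKernel {n : ℕ} (hn : 1 ≤ n) :
    ∫ t in (-Real.pi)..Real.pi, korovkinKernel n t = 2 * Real.pi := by
  unfold korovkinKernel
  rw [intervalIntegral.integral_finsetSum
    (fun i _ => Continuous.intervalIntegrable (by fun_prop) _ _)]
  have h : ∀ i ∈ Finset.range n, (∫ t in (-Real.pi)..Real.pi, ∑ l ∈ Finset.range n,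
      korovkinWeight n i * korovkinWeight n l / korovkinMass n * Real.cos (((i : ℝ) - l) * t)) =
      korovkinWeight n i ^ 2 * (2 * Real.pi / korovkinMass n) := by
    intro i hi
    rw [intervalIntegral.integral_finsetSum
      (fun i _ => Continuous.intervalIntegrable (by fun_prop) _ _)]
    have h2 : ∀ l ∈ Finset.range n, (∫ t in (-Real.pi)..Real.pi,
        korovkinWeight n i * korovkinWeight n l / korovkinMass n * Real.cos (((i : ℝ) - l) * t)) =
        if i = l then korovkinWeight n i ^ 2 * (2 * Real.pi / korovkinMass n) else 0 := by
      intro l _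
      rw [intervalIntegral.integral_const_mul]
      have := integral_cos_int_mul ((i : ℤ) - l)
      push_cast at this
      rw [this]
      have e : ((i : ℤ) - l = 0) ↔ i = l := by omega
      by_cases hil : i = l
      · subst hil
        simp
        ring
      · rw [if_neg (e.not.2 hil), if_neg hil, mul_zero]
    rw [Finset.sum_congr rfl h2, Finset.sum_ite_eq, if_pos hi]
  rw [Finset.sum_congr rfl h, ← Finset.sum_mul]
  have := (korovkinMass_pos hn).ne'
  change korovkinMass n * _ = _
  field_simp

lemma integral_cos_mul_cos_int (k : ℤ) :
    ∫ t in (-Real.pi)..Real.pi, Real.cos t * Real.cos (k * t) =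
      (if k = 1 then Real.pi else 0) + (if k = -1 then Real.pi else 0) := by
  have e : ∀ t : ℝ, Real.cos t * Real.cos (k * t) =
      2⁻¹ * Real.cos (((k + 1 : ℤ) : ℝ) * t) + 2⁻¹ * Real.cos (((k - 1 : ℤ) : ℝ) * t) := by
    intro t
    push_cast
    rw [add_mul, sub_mul, one_mul, Real.cos_add, Real.cos_sub]
    ring
  simp only [e]
  rw [intervalIntegral.integral_add (Continuous.intervalIntegrable (by fun_prop) _ _)
    (Continuous.intervalIntegrable (by fun_prop) _ _), intervalIntegral.integral_const_mul,
    intervalIntegral.integral_const_mul, integral_cos_int_mul, integral_cos_int_mul]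
  have h1 : k + 1 = 0 ↔ k = -1 := by omega
  have h2 : k - 1 = 0 ↔ k = 1 := by omega
  simp only [h1, h2]
  split_ifs <;> first | omega | ring

/-- The eigenvalue `2 cos (π / (n + 1))` is the reason for this choice of weights: it is the largest
one of the path, which brings the mean of `cos` under the kernel within `O(n⁻²)` of `1`. -/
lemma korovkinWeight_eigen {n i : ℕ} (hi : i < n) :
    (∑ l ∈ Finset.range n, if l + 1 = i then korovkinWeight n l else 0) +
      (∑ l ∈ Finset.range n, if l = i + 1 then korovkinWeight n l else 0) =
      2 * Real.cos (Real.pi / (n + 1)) * korovkinWeight n i := by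
  have h1 : (∑ l ∈ Finset.range n, if l + 1 = i then korovkinWeight n l else 0) =
      Real.sin (Real.pi * i / (n + 1)) := by
    cases i with
    | zero => simp
    | succ j =>
      have : ∀ l, l + 1 = j + 1 ↔ l = j := by omega
      simp only [this]
      rw [Finset.sum_ite_eq' (Finset.range n) j, if_pos (Finset.mem_range.2 (by omega))]
      simp [korovkinWeight]
  have h2 : (∑ l ∈ Finset.range n, if l = i + 1 then korovkinWeight n l else 0) =
      Real.sin (Real.pi * (i + 2) / (n + 1)) := by
    rw [Finset.sum_ite_eq' (Finset.range n) (i + 1)]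
    split_ifs with h
    · unfold korovkinWeight
      congr 2
      push_cast
      ring
    · have hn : n = i + 1 := by
        have := Finset.mem_range.not.1 h
        omega
      have hn' : (n : ℝ) + 1 = i + 2 := by
        rw [hn]
        push_cast
        ring
      rw [hn', mul_div_assoc, div_self (by positivity), mul_one, Real.sin_pi]
  rw [h1, h2]
  unfold korovkinWeight
  have e1 : Real.pi * i / (n + 1) = Real.pi * (i + 1) / (n + 1) - Real.pi / (n + 1) := by ring
  have e2 : Real.pi * (i + 2) / (n + 1) = Real.pi * (i + 1) / (n + 1) + Real.pi / (n + 1) := by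
    ring
  rw [e1, e2, Real.sin_sub, Real.sin_add]
  ring

lemma integral_cos_mul_korovkinKernel {n : ℕ} (hn : 1 ≤ n) :
    ∫ t in (-Real.pi)..Real.pi, Real.cos t * korovkinKernel n t =
      2 * Real.pi * Real.cos (Real.pi / (n + 1)) := by
  unfold korovkinKernel
  simp only [Finset.mul_sum]
  rw [intervalIntegral.integral_finsetSum
    (fun i _ => Continuous.intervalIntegrable (by fun_prop) _ _)]
  have h : ∀ i ∈ Finset.range n, (∫ t in (-Real.pi)..Real.pi, ∑ l ∈ Finset.range n,
      Real.cos t * (korovkinWeight n i * korovkinWeight n l / korovkinMass n *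
        Real.cos (((i : ℝ) - l) * t))) =
      korovkinWeight n i ^ 2 *
        (2 * Real.pi * Real.cos (Real.pi / (n + 1)) / korovkinMass n) := by
    intro i hi
    rw [intervalIntegral.integral_finsetSum
      (fun i _ => Continuous.intervalIntegrable (by fun_prop) _ _)]
    have h2 : ∀ l ∈ Finset.range n, (∫ t in (-Real.pi)..Real.pi,
        Real.cos t * (korovkinWeight n i * korovkinWeight n l / korovkinMass n *
          Real.cos (((i : ℝ) - l) * t))) =
        korovkinWeight n i / korovkinMass n * Real.pi *
          ((if l + 1 = i then korovkinWeight n l else 0) +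
            if l = i + 1 then korovkinWeight n l else 0) := by
      intro l _
      have e : ∀ t : ℝ, Real.cos t * (korovkinWeight n i * korovkinWeight n l / korovkinMass n *
          Real.cos (((i : ℝ) - l) * t)) =
          korovkinWeight n i * korovkinWeight n l / korovkinMass n *
          (Real.cos t * Real.cos ((((i : ℤ) - l : ℤ) : ℝ) * t)) := by
        intro t
        push_cast
        ring
      simp only [e]
      rw [intervalIntegral.integral_const_mul, integral_cos_mul_cos_int]
      have e1 : ((i : ℤ) - l = 1) ↔ l + 1 = i := by omega
      have e2 : ((i : ℤ) - l = -1) ↔ l = i + 1 := by omega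
      simp only [e1, e2]
      split_ifs <;> ring
    rw [Finset.sum_congr rfl h2, ← Finset.mul_sum, Finset.sum_add_distrib,
      korovkinWeight_eigen (Finset.mem_range.1 hi)]
    ring
  rw [Finset.sum_congr rfl h, ← Finset.sum_mul]
  have := (korovkinMass_pos hn).ne'
  change korovkinMass n * _ = _
  field_simp

/-- The first absolute moment of the kernel is `O(1/n)`. -/
lemma integral_abs_mul_korovkinKernel_le {n : ℕ} (hn : 1 ≤ n) :
    ∫ t in (-Real.pi)..Real.pi, |t| * korovkinKernel n t ≤ 2 * Real.pi * (Real.pi ^ 4 / n) := by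
  have hpi := Real.pi_pos
  have hpi3 := Real.pi_gt_three
  have hn0 : (1 : ℝ) ≤ n := by exact_mod_cast hn
  have hc := continuous_korovkinKernel n
  -- `|t| ≤ 1 / (2n) + n t² / 2`, and `t²` is at most a multiple of `1 - cos t`, whose mean under
  -- the kernel is `O(n⁻²)`
  have key : ∀ t ∈ Set.Icc (-Real.pi) Real.pi, |t| * korovkinKernel n t ≤
      (1 / (2 * n)) * korovkinKernel n t +
        (n * Real.pi ^ 2 / 4) * (korovkinKernel n t - Real.cos t * korovkinKernel n t) := by
    intro t ht
    have h1 : Real.cos t ≤ 1 - 2 / Real.pi ^ 2 * t ^ 2 :=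
      Real.cos_le_one_sub_mul_cos_sq (abs_le.2 ht)
    have h2 : t ^ 2 ≤ Real.pi ^ 2 / 2 * (1 - Real.cos t) := by
      have : Real.pi ^ 2 / 2 * (2 / Real.pi ^ 2 * t ^ 2) = t ^ 2 := by field_simp
      nlinarith [sq_nonneg Real.pi, mul_le_mul_of_nonneg_left h1 (by positivity : 0 ≤ Real.pi ^ 2 / 2)]
    have h3 : |t| ≤ 1 / (2 * n) + n / 2 * t ^ 2 := by
      have : 0 ≤ (n * |t| - 1) ^ 2 / (2 * n) := by positivity
      have e : (n * |t| - 1) ^ 2 / (2 * n) = 1 / (2 * n) + n / 2 * t ^ 2 - |t| := by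
        rw [← sq_abs t]
        field_simp
        ring
      linarith
    have h4 : |t| ≤ 1 / (2 * n) + n * Real.pi ^ 2 / 4 * (1 - Real.cos t) := by
      have := mul_le_mul_of_nonneg_left h2 (by positivity : (0 : ℝ) ≤ n / 2)
      linarith
    have := mul_le_mul_of_nonneg_right h4 (korovkinKernel_nonneg n t)
    linarith
  have h := intervalIntegral.integral_mono_on (μ := volume) (by linarith : -Real.pi ≤ Real.pi)
    (Continuous.intervalIntegrable (by fun_prop) _ _)
    (Continuous.intervalIntegrable (by fun_prop) _ _) key
  refine h.trans ?_
  rw [intervalIntegral.integral_add (Continuous.intervalIntegrable (by fun_prop) _ _)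
    (Continuous.intervalIntegrable (by fun_prop) _ _), intervalIntegral.integral_const_mul,
    intervalIntegral.integral_const_mul,
    intervalIntegral.integral_sub (Continuous.intervalIntegrable (by fun_prop) _ _)
    (Continuous.intervalIntegrable (by fun_prop) _ _), integral_korovkinKernel hn,
    integral_cos_mul_korovkinKernel hn]
  have hcos : 1 - Real.cos (Real.pi / (n + 1)) ≤ Real.pi ^ 2 / (2 * n ^ 2) := by
    have h1 := Real.one_sub_sq_div_two_le_cos (x := Real.pi / (n + 1))
    have h2 : (Real.pi / (n + 1)) ^ 2 / 2 ≤ Real.pi ^ 2 / (2 * n ^ 2) := by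
      rw [div_pow, div_div, mul_comm]
      gcongr
      linarith
    linarith
  have e : 1 / (2 * (n : ℝ)) * (2 * Real.pi) + n * Real.pi ^ 2 / 4 *
      (2 * Real.pi - 2 * Real.pi * Real.cos (Real.pi / (n + 1))) =
      2 * Real.pi * (1 / (2 * n) + n * Real.pi ^ 2 / 4 * (1 - Real.cos (Real.pi / (n + 1)))) := by
    ring
  rw [e]
  refine mul_le_mul_of_nonneg_left ?_ (by positivity)
  have h5 := mul_le_mul_of_nonneg_left hcos (by positivity : 0 ≤ n * Real.pi ^ 2 / 4)
  have e2 : n * Real.pi ^ 2 / 4 * (Real.pi ^ 2 / (2 * n ^ 2)) = Real.pi ^ 4 / 8 / n := by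
    field_simp
    ring
  have h6 : 1 / (2 * (n : ℝ)) + Real.pi ^ 4 / 8 / n ≤ Real.pi ^ 4 / n := by
    have : 1 / (2 * (n : ℝ)) + Real.pi ^ 4 / 8 / n = (1 / 2 + Real.pi ^ 4 / 8) / n := by
      field_simp
    rw [this]
    gcongr
    have : (1 : ℝ) ≤ Real.pi ^ 4 := one_le_pow₀ (by linarith)
    linarith
  linarith

/-- Convolution with the Fejér–Korovkin kernel over one period. -/
noncomputable def korovkinMean (n : ℕ) (f : ℝ → ℝ) (x : ℝ) : ℝ :=
  (2 * Real.pi)⁻¹ * ∫ t in (-Real.pi)..Real.pi, f (x - t) * korovkinKernel n t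

/-- The residual `f - K_n f` of the Fejér–Korovkin mean. -/
noncomputable def korovkinResidual (n : ℕ) (f : ℝ → ℝ) (x : ℝ) : ℝ := f x - korovkinMean n f x

lemma continuous_korovkinMean (n : ℕ) {f : ℝ → ℝ} (hf : Continuous f) :
    Continuous (korovkinMean n f) := by
  refine Continuous.mul continuous_const ?_
  refine intervalIntegral.continuous_parametric_intervalIntegral_of_continuous' ?_ _ _
  have := continuous_korovkinKernel n
  simp only [Function.uncurry_def]
  fun_prop

lemma continuous_korovkinResidual (n : ℕ) {f : ℝ → ℝ} (hf : Continuous f) :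
    Continuous (korovkinResidual n f) :=
  hf.sub (continuous_korovkinMean n hf)

lemma continuous_korovkinResidual_iterate (n k : ℕ) {f : ℝ → ℝ} (hf : Continuous f) :
    Continuous ((korovkinResidual n)^[k] f) := by
  induction k with
  | zero => exact hf
  | succ k ih =>
    rw [Function.iterate_succ_apply']
    exact continuous_korovkinResidual n ih

lemma korovkinResidual_sub (n : ℕ) {f g : ℝ → ℝ} (hf : Continuous f) (hg : Continuous g) :
    korovkinResidual n (fun x => f x - g x) =
      fun x => korovkinResidual n f x - korovkinResidual n g x := by
  have hc := continuous_korovkinKernel n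
  funext x
  unfold korovkinResidual korovkinMean
  simp only [sub_mul]
  rw [intervalIntegral.integral_sub (Continuous.intervalIntegrable (by fun_prop) _ _)
    (Continuous.intervalIntegrable (by fun_prop) _ _)]
  ring

lemma korovkinResidual_shift (n : ℕ) (f : ℝ → ℝ) (h : ℝ) :
    korovkinResidual n (fun x => f (x + h)) = fun x => korovkinResidual n f (x + h) := by
  funext x
  unfold korovkinResidual korovkinMean
  simp only [sub_add_eq_add_sub]

lemma korovkinResidual_iterate_shift_sub (n k : ℕ) {f : ℝ → ℝ} (hf : Continuous f) (h : ℝ) :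
    (korovkinResidual n)^[k] (fun x => f (x + h) - f x) =
      fun x => (korovkinResidual n)^[k] f (x + h) - (korovkinResidual n)^[k] f x := by
  induction k with
  | zero => rfl
  | succ k ih =>
    have hc := continuous_korovkinResidual_iterate n k hf
    rw [Function.iterate_succ_apply', ih, korovkinResidual_sub n (by fun_prop) hc,
      korovkinResidual_shift, Function.iterate_succ_apply']

lemma korovkinResidual_eq {n : ℕ} (hn : 1 ≤ n) {f : ℝ → ℝ} (hf : Continuous f) (x : ℝ) :
    korovkinResidual n f x =
      (2 * Real.pi)⁻¹ * ∫ t in (-Real.pi)..Real.pi, (f x - f (x - t)) * korovkinKernel n t := by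
  have hc := continuous_korovkinKernel n
  simp only [sub_mul]
  rw [intervalIntegral.integral_sub (Continuous.intervalIntegrable (by fun_prop) _ _)
    (Continuous.intervalIntegrable (by fun_prop) _ _), intervalIntegral.integral_const_mul,
    integral_korovkinKernel hn, mul_sub]
  unfold korovkinResidual korovkinMean
  have := Real.pi_pos.ne'
  congr 1
  field_simp

lemma abs_korovkinResidual_le_of_lipschitz {n : ℕ} (hn : 1 ≤ n) {f : ℝ → ℝ} (hf : Continuous f)
    {K : ℝ} (hK : ∀ x h, |f (x + h) - f x| ≤ K * |h|) (x : ℝ) :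
    |korovkinResidual n f x| ≤ Real.pi ^ 4 / n * K := by
  have hc := continuous_korovkinKernel n
  have hpi := Real.pi_pos
  have hK0 : 0 ≤ K := by simpa using (abs_nonneg _).trans (hK 0 1)
  rw [korovkinResidual_eq hn hf, abs_mul, abs_of_pos (by positivity)]
  have h1 : |∫ t in (-Real.pi)..Real.pi, (f x - f (x - t)) * korovkinKernel n t| ≤
      ∫ t in (-Real.pi)..Real.pi, K * (|t| * korovkinKernel n t) := by
    refine (intervalIntegral.abs_integral_le_integral_abs (by linarith)).trans ?_
    refine intervalIntegral.integral_mono_on (by linarith)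
      (Continuous.intervalIntegrable (by fun_prop) _ _)
      (Continuous.intervalIntegrable (by fun_prop) _ _) fun t _ => ?_
    rw [abs_mul, abs_of_nonneg (korovkinKernel_nonneg n t), ← mul_assoc]
    refine mul_le_mul_of_nonneg_right ?_ (korovkinKernel_nonneg n t)
    have := hK (x - t) t
    rwa [sub_add_cancel] at this
  rw [intervalIntegral.integral_const_mul] at h1
  have h2 := mul_le_mul_of_nonneg_left (integral_abs_mul_korovkinKernel_le hn) hK0
  calc (2 * Real.pi)⁻¹ * |∫ t in (-Real.pi)..Real.pi, (f x - f (x - t)) * korovkinKernel n t|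
      ≤ (2 * Real.pi)⁻¹ * (K * (2 * Real.pi * (Real.pi ^ 4 / n))) :=
        mul_le_mul_of_nonneg_left (h1.trans h2) (by positivity)
    _ = Real.pi ^ 4 / n * K := by field_simp

lemma abs_korovkinResidual_le {n : ℕ} (hn : 1 ≤ n) {f : ℝ → ℝ} (hf : Continuous f)
    {M : ℝ} (hM : ∀ x, |f x| ≤ M) (x : ℝ) : |korovkinResidual n f x| ≤ 2 * M := by
  have hc := continuous_korovkinKernel n
  have hpi := Real.pi_pos
  rw [korovkinResidual_eq hn hf, abs_mul, abs_of_pos (by positivity)]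
  have h1 : |∫ t in (-Real.pi)..Real.pi, (f x - f (x - t)) * korovkinKernel n t| ≤
      ∫ t in (-Real.pi)..Real.pi, 2 * M * korovkinKernel n t := by
    refine (intervalIntegral.abs_integral_le_integral_abs (by linarith)).trans ?_
    refine intervalIntegral.integral_mono_on (by linarith)
      (Continuous.intervalIntegrable (by fun_prop) _ _)
      (Continuous.intervalIntegrable (by fun_prop) _ _) fun t _ => ?_
    rw [abs_mul, abs_of_nonneg (korovkinKernel_nonneg n t)]
    refine mul_le_mul_of_nonneg_right ?_ (korovkinKernel_nonneg n t)
    have := abs_sub (f x) (f (x - t))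
    linarith [hM x, hM (x - t)]
  rw [intervalIntegral.integral_const_mul, integral_korovkinKernel hn] at h1
  calc (2 * Real.pi)⁻¹ * |∫ t in (-Real.pi)..Real.pi, (f x - f (x - t)) * korovkinKernel n t|
      ≤ (2 * Real.pi)⁻¹ * (2 * M * (2 * Real.pi)) :=
        mul_le_mul_of_nonneg_left h1 (by positivity)
    _ = 2 * M := by field_simp

lemma abs_korovkinResidual_iterate_le {n : ℕ} (hn : 1 ≤ n) {f : ℝ → ℝ} (hf : Continuous f)
    {M : ℝ} (hM : ∀ x, |f x| ≤ M) (k : ℕ) (x : ℝ) :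
    |(korovkinResidual n)^[k] f x| ≤ 2 ^ k * M := by
  induction k generalizing x with
  | zero => simpa using hM x
  | succ k ih =>
    rw [Function.iterate_succ_apply', pow_succ', mul_assoc]
    exact abs_korovkinResidual_le hn (continuous_korovkinResidual_iterate n k hf) ih x

/-- Iterating the residual `S` times gains the full power `n ^ (-S)`; the step uses that the
residual commutes with translations, so that its Lipschitz constant is controlled by the
induction hypothesis for the differences of `f`. -/
lemma abs_korovkinResidual_iterate_le_of_iteratedDeriv {n : ℕ} (hn : 1 ≤ n) (S : ℕ)
    {f : ℝ → ℝ} (hf : ContDiff ℝ S f) {M : ℝ} (hM : ∀ x, |iteratedDeriv S f x| ≤ M) (x : ℝ) :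
    |(korovkinResidual n)^[S] f x| ≤ (Real.pi ^ 4 / n) ^ S * M := by
  induction S generalizing f M x with
  | zero => simpa using hM x
  | succ S ih =>
    have hfc : Continuous f := hf.continuous
    have hfS : ContDiff ℝ S f := hf.of_le (by exact_mod_cast Nat.le_succ S)
    have hM0 : 0 ≤ M := (abs_nonneg _).trans (hM 0)
    rw [Function.iterate_succ_apply', pow_succ', mul_assoc]
    refine abs_korovkinResidual_le_of_lipschitz hn
      (continuous_korovkinResidual_iterate n S hfc) (fun y h => ?_) x
    have e := congrFun (korovkinResidual_iterate_shift_sub n S hfc h) y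
    rw [← e, mul_assoc]
    have hsh : ContDiff ℝ S (fun x => f (x + h)) :=
      hfS.comp (contDiff_id.add contDiff_const)
    refine ih (hsh.sub hfS) (fun z => ?_) y
    have e2 : iteratedDeriv S (fun x => f (x + h) - f x) z =
        iteratedDeriv S f (z + h) - iteratedDeriv S f z := by
      have := iteratedDeriv_fun_sub (n := S) (x := z) hsh.contDiffAt hfS.contDiffAt
      rw [this, iteratedDeriv_comp_add_const]
    rw [e2]
    have hd : ∀ w, HasDerivAt (iteratedDeriv S f) (iteratedDeriv (S + 1) f w) w := by
      intro w
      rw [iteratedDeriv_succ]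
      refine DifferentiableAt.hasDerivAt ?_
      exact (hf.differentiable_iteratedDeriv S (by exact_mod_cast Nat.lt_succ_self S)) w
    have := Convex.norm_image_sub_le_of_norm_hasDerivWithin_le (s := Set.univ)
      (f := iteratedDeriv S f) (x := z) (y := z + h)
      (fun w _ => (hd w).hasDerivWithinAt) (fun w _ => by simpa using hM w) convex_univ
      (Set.mem_univ _) (Set.mem_univ _)
    simpa using this

lemma intervalIntegral_eq_zero_of_odd {g : ℝ → ℝ} (hg : ∀ t, g (-t) = -g t) (a : ℝ) :
    ∫ t in (-a)..a, g t = 0 := by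
  have h := intervalIntegral.integral_comp_neg (a := -a) (b := a) g
  simp only [hg, intervalIntegral.integral_neg, neg_neg] at h
  linarith

/-- On even periodic functions the Fejér–Korovkin mean is a cosine polynomial. -/
lemma korovkinMean_eq_sum (n : ℕ) {g : ℝ → ℝ} (hg : Continuous g)
    (hper : Function.Periodic g (2 * Real.pi)) (heven : ∀ t, g (-t) = g t) (x : ℝ) :
    korovkinMean n g x = ∑ i ∈ Finset.range n, ∑ l ∈ Finset.range n,
      korovkinWeight n i * korovkinWeight n l / korovkinMass n *
        ((2 * Real.pi)⁻¹ * ∫ t in (-Real.pi)..Real.pi, g t * Real.cos (((i : ℝ) - l) * t)) *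
        Real.cos (((i : ℝ) - l) * x) := by
  have hc := continuous_korovkinKernel n
  have h1 : ∫ t in (-Real.pi)..Real.pi, g (x - t) * korovkinKernel n t =
      ∫ t in (-Real.pi)..Real.pi, g t * korovkinKernel n (x - t) := by
    have e1 := intervalIntegral.integral_comp_sub_left (a := -Real.pi) (b := Real.pi)
      (fun s => g s * korovkinKernel n (x - s)) x
    simp only [sub_sub_cancel] at e1
    rw [e1]
    have hp : Function.Periodic (fun s => g s * korovkinKernel n (x - s)) (2 * Real.pi) := by
      intro s
      have : korovkinKernel n (x - (s + 2 * Real.pi)) = korovkinKernel n (x - s) := by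
        unfold korovkinKernel
        refine Finset.sum_congr rfl fun i _ => Finset.sum_congr rfl fun l _ => ?_
        congr 1
        have : ((i : ℝ) - l) * (x - (s + 2 * Real.pi)) =
            ((i : ℝ) - l) * (x - s) - ((i - l : ℤ) : ℝ) * (2 * Real.pi) := by
          push_cast
          ring
        rw [this, Real.cos_sub_int_mul_two_pi]
      simp only [this, hper s]
    have := hp.intervalIntegral_add_eq (x - Real.pi) (-Real.pi)
    convert this using 2 <;> ring
  unfold korovkinMean
  rw [h1]
  have h2 : ∀ t, g t * korovkinKernel n (x - t) = ∑ i ∈ Finset.range n, ∑ l ∈ Finset.range n,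
      ((korovkinWeight n i * korovkinWeight n l / korovkinMass n *
        Real.cos (((i : ℝ) - l) * x)) * (g t * Real.cos (((i : ℝ) - l) * t)) +
      (korovkinWeight n i * korovkinWeight n l / korovkinMass n *
        Real.sin (((i : ℝ) - l) * x)) * (g t * Real.sin (((i : ℝ) - l) * t))) := by
    intro t
    unfold korovkinKernel
    rw [Finset.mul_sum]
    refine Finset.sum_congr rfl fun i _ => ?_
    rw [Finset.mul_sum]
    refine Finset.sum_congr rfl fun l _ => ?_
    rw [mul_sub, Real.cos_sub]
    ring
  simp only [h2]
  rw [intervalIntegral.integral_finsetSum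
    (fun i _ => Continuous.intervalIntegrable (by fun_prop) _ _), Finset.mul_sum]
  refine Finset.sum_congr rfl fun i _ => ?_
  rw [intervalIntegral.integral_finsetSum
    (fun i _ => Continuous.intervalIntegrable (by fun_prop) _ _), Finset.mul_sum]
  refine Finset.sum_congr rfl fun l _ => ?_
  rw [intervalIntegral.integral_add (Continuous.intervalIntegrable (by fun_prop) _ _)
    (Continuous.intervalIntegrable (by fun_prop) _ _), intervalIntegral.integral_const_mul,
    intervalIntegral.integral_const_mul,
    intervalIntegral_eq_zero_of_odd (g := fun t => g t * Real.sin (((i : ℝ) - l) * t))]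
  · ring
  · intro t
    rw [heven, mul_neg, Real.sin_neg, mul_neg]

/-- The mean of an even periodic function is a polynomial in `(1 + cos θ) / 2`, as
`cos (k θ) = T_k(cos θ)`. -/
lemma korovkinMean_hasCoeffBound {n : ℕ} (hn : 1 ≤ n) {g : ℝ → ℝ} (hg : Continuous g)
    (hper : Function.Periodic g (2 * Real.pi)) (heven : ∀ t, g (-t) = g t)
    {M : ℝ} (hM : ∀ t, |g t| ≤ M) :
    ∃ P : ℝ → ℝ, HasCoeffBound n (n * 7 ^ n * M) P ∧
      ∀ x, korovkinMean n g x = P ((1 + Real.cos x) / 2) := by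
  have hpi := Real.pi_pos
  have hM0 : 0 ≤ M := (abs_nonneg _).trans (hM 0)
  set d : ℕ → ℕ → ℝ := fun i l =>
    korovkinWeight n i * korovkinWeight n l / korovkinMass n *
        ((2 * Real.pi)⁻¹ * ∫ t in (-Real.pi)..Real.pi, g t * Real.cos (((i : ℝ) - l) * t)) with hd
  have hdb : ∀ i l, |d i l| ≤ (korovkinWeight n i ^ 2 + korovkinWeight n l ^ 2) / 2 /
      korovkinMass n * M := by
    intro i l
    have hA := korovkinMass_pos hn
    have h1 : |(2 * Real.pi)⁻¹ * ∫ t in (-Real.pi)..Real.pi,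
        g t * Real.cos (((i : ℝ) - l) * t)| ≤ M := by
      have := intervalIntegral.norm_integral_le_of_norm_le_const (a := -Real.pi) (b := Real.pi)
        (f := fun t => g t * Real.cos (((i : ℝ) - l) * t)) (C := M) (fun t _ => by
          rw [Real.norm_eq_abs, abs_mul]
          exact (mul_le_of_le_one_right (abs_nonneg _) (Real.abs_cos_le_one _)).trans (hM t))
      rw [Real.norm_eq_abs] at this
      rw [abs_mul, abs_of_pos (by positivity : 0 < (2 * Real.pi)⁻¹), inv_mul_le_iff₀ (by positivity)]
      refine this.trans (le_of_eq ?_)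
      rw [abs_of_pos (by linarith)]
      ring
    have h2 : |korovkinWeight n i * korovkinWeight n l| ≤
        (korovkinWeight n i ^ 2 + korovkinWeight n l ^ 2) / 2 := by
      rw [abs_mul]
      have := two_mul_le_add_sq |korovkinWeight n i| |korovkinWeight n l|
      rw [sq_abs, sq_abs] at this
      linarith
    rw [hd]
    simp only [abs_mul, abs_div, abs_of_pos hA] at h1 h2 ⊢
    gcongr
  refine ⟨fun u => ∑ i ∈ Finset.range n, ∑ l ∈ Finset.range n,
    d i l * (Polynomial.Chebyshev.T ℝ ((((i : ℤ) - l).natAbs : ℕ) : ℤ)).eval (2 * u - 1), ?_, ?_⟩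
  · have h := HasCoeffBound.sum (n := n) (Finset.range n) fun i hi =>
      HasCoeffBound.sum (n := n) (Finset.range n) fun l hl =>
        (((HasCoeffBound.chebyshev (((i : ℤ) - l).natAbs)).mono
          (n' := n) (B' := 7 ^ n) (by
            have := Finset.mem_range.1 hi
            have := Finset.mem_range.1 hl
            omega) (pow_le_pow_right₀ (by norm_num) (by
            have := Finset.mem_range.1 hi
            have := Finset.mem_range.1 hl
            omega))).const_mul (d i l))
    refine h.mono le_rfl ?_
    have hA := korovkinMass_pos hn
    calc ∑ i ∈ Finset.range n, ∑ l ∈ Finset.range n, |d i l| * 7 ^ n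
        ≤ ∑ i ∈ Finset.range n, ∑ l ∈ Finset.range n,
          (korovkinWeight n i ^ 2 + korovkinWeight n l ^ 2) * ((korovkinMass n)⁻¹ * M * 7 ^ n / 2) := by
          refine Finset.sum_le_sum fun i _ => Finset.sum_le_sum fun l _ => ?_
          refine (mul_le_mul_of_nonneg_right (hdb i l) (by positivity)).trans (le_of_eq ?_)
          field_simp
      _ = n * 7 ^ n * M := by
          simp only [← Finset.sum_mul, Finset.sum_add_distrib, Finset.sum_const, Finset.card_range,
            nsmul_eq_mul, ← Finset.mul_sum]
          change ((n : ℝ) * korovkinMass n + n * korovkinMass n) * _ = _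
          field_simp
          ring
  · intro x
    rw [korovkinMean_eq_sum n hg hper heven]
    refine Finset.sum_congr rfl fun i _ => Finset.sum_congr rfl fun l _ => ?_
    rw [Polynomial.Chebyshev.T_natAbs, show 2 * ((1 + Real.cos x) / 2) - 1 = Real.cos x by ring,
      Polynomial.Chebyshev.T_real_cos]
    push_cast
    rfl

/-- **Jackson's theorem** for polynomials in `(1 + cos θ) / 2`, with the full rate `n ^ (-S)` and
with coefficients that grow at most geometrically in the degree. -/
theorem jackson (S : ℕ) : ∃ C : ℝ, 0 < C ∧ ∀ (f : ℝ → ℝ) (M : ℝ), ContDiff ℝ S f →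
    Function.Periodic f (2 * Real.pi) → (∀ t, f (-t) = f t) → (∀ t, |f t| ≤ M) →
    (∀ t, |iteratedDeriv S f t| ≤ M) → ∀ n : ℕ, 1 ≤ n →
    ∃ P : ℝ → ℝ, HasCoeffBound n (C * M * 14 ^ n) P ∧
      ∀ t, |f t - P ((1 + Real.cos t) / 2)| ≤ C * M / n ^ S := by
  refine ⟨(Real.pi ^ 4) ^ S + ∑ k ∈ Finset.range S, 2 ^ k + 1, by positivity, ?_⟩
  intro f M hf hper heven hM hMS n hn
  have hM0 : 0 ≤ M := (abs_nonneg _).trans (hM 0)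
  have hfc := hf.continuous
  have hRper : ∀ k, Function.Periodic ((korovkinResidual n)^[k] f) (2 * Real.pi) := by
    intro k
    induction k with
    | zero => exact hper
    | succ k ih =>
      intro x
      have := congrFun (korovkinResidual_shift n ((korovkinResidual n)^[k] f) (2 * Real.pi)) x
      rw [Function.iterate_succ_apply', ← this]
      congr 1
      funext y
      exact ih y
  have hReven : ∀ k t, (korovkinResidual n)^[k] f (-t) = (korovkinResidual n)^[k] f t := by
    intro k
    induction k with
    | zero => exact heven
    | succ k ih =>
      intro t
      rw [Function.iterate_succ_apply']
      have hcont := continuous_korovkinResidual_iterate n k hfc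
      change (korovkinResidual n)^[k] f (-t) - korovkinMean n _ (-t) =
        (korovkinResidual n)^[k] f t - korovkinMean n _ t
      rw [ih t, korovkinMean_eq_sum n hcont (hRper k) ih,
        korovkinMean_eq_sum n hcont (hRper k) ih]
      simp only [mul_neg, Real.cos_neg]
  choose P hP hPe using fun k => korovkinMean_hasCoeffBound hn
    (continuous_korovkinResidual_iterate n k hfc) (hRper k) (hReven k)
    (abs_korovkinResidual_iterate_le hn hfc hM k)
  -- `f - ∑_{k<S} K_n R^k f = R^S f` for the mean `K_n` and the residual `R = 1 - K_n`
  refine ⟨fun u => ∑ k ∈ Finset.range S, P k u, ?_, fun t => ?_⟩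
  · refine (HasCoeffBound.sum (Finset.range S) fun k _ => hP k).mono le_rfl ?_
    have e : ∑ k ∈ Finset.range S, (n : ℝ) * 7 ^ n * (2 ^ k * M) =
        (∑ k ∈ Finset.range S, (2 : ℝ) ^ k) * M * (n * 7 ^ n) := by
      rw [Finset.sum_mul, Finset.sum_mul]
      exact Finset.sum_congr rfl fun k _ => by ring
    rw [e]
    have h1 : (n : ℝ) * 7 ^ n ≤ 14 ^ n := by
      rw [show (14 : ℝ) = 2 * 7 by norm_num, mul_pow]
      gcongr
      exact_mod_cast Nat.lt_two_pow_self.le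
    have h2 : (0 : ℝ) ≤ (Real.pi ^ 4) ^ S := by positivity
    gcongr
    linarith
  · have htel : ∀ k, f t - ∑ i ∈ Finset.range k, P i ((1 + Real.cos t) / 2) =
        (korovkinResidual n)^[k] f t := by
      intro k
      induction k with
      | zero => simp
      | succ k ih =>
        rw [Finset.sum_range_succ, ← sub_sub, ih, Function.iterate_succ_apply', ← hPe k t]
        rfl
    rw [htel]
    refine (abs_korovkinResidual_iterate_le_of_iteratedDeriv hn S hf hMS t).trans ?_
    rw [div_pow, div_mul_eq_mul_div]
    have h2 : (0 : ℝ) ≤ ∑ k ∈ Finset.range S, 2 ^ k := Finset.sum_nonneg fun _ _ => by positivity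
    gcongr
    linarith

/-! ### Uniform smoothness of the rescaled multipliers -/

lemma contDiff_cutoff_mul {ψ f : ℝ → ℝ} {U : Set ℝ} (hU : IsOpen U) (hψ : ContDiff ℝ ∞ ψ)
    (hsupp : tsupport ψ ⊆ U) (hf : ContDiffOn ℝ ∞ f U) : ContDiff ℝ ∞ (fun u => ψ u * f u) := by
  rw [contDiff_iff_contDiffAt]
  intro u
  by_cases hu : u ∈ U
  · exact hψ.contDiffAt.mul (hf.contDiffAt (hU.mem_nhds hu))
  · have h0 : ψ =ᶠ[𝓝 u] 0 := notMem_tsupport_iff_eventuallyEq.1 fun h => hu (hsupp h)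
    refine (contDiffAt_const (c := (0 : ℝ))).congr_of_eventuallyEq ?_
    filter_upwards [h0] with v hv
    simp [hv]

/-- Derivatives in the second variable preserve joint smoothness. -/
lemma contDiff_iteratedDeriv_param {Φ : ℝ → ℝ → ℝ}
    (hΦ : ContDiff ℝ ∞ (fun z : ℝ × ℝ => Φ z.1 z.2)) (k : ℕ) :
    ContDiff ℝ ∞ (fun z : ℝ × ℝ => iteratedDeriv k (Φ z.1) z.2) := by
  induction k with
  | zero => simpa using hΦ
  | succ k ih =>
    have e : (fun z : ℝ × ℝ => iteratedDeriv (k + 1) (Φ z.1) z.2) =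
        fun z => fderiv ℝ (fun z : ℝ × ℝ => iteratedDeriv k (Φ z.1) z.2) z (0, 1) := by
      funext z
      rw [iteratedDeriv_succ]
      have h1 : HasFDerivAt (fun z : ℝ × ℝ => iteratedDeriv k (Φ z.1) z.2)
          (fderiv ℝ (fun z : ℝ × ℝ => iteratedDeriv k (Φ z.1) z.2) z) (z.1, z.2) :=
        (ih.differentiable (by simp) z).hasFDerivAt
      have h2 : HasDerivAt (fun s : ℝ => (z.1, s)) ((0 : ℝ), (1 : ℝ)) z.2 :=
        (hasDerivAt_const _ _).prodMk (hasDerivAt_id _)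
      exact (h1.comp_hasDerivAt z.2 h2).deriv
    rw [e]
    exact (ih.fderiv_right (by simp)).clm_apply contDiff_const

/-- A smooth family of periodic functions has derivatives that are bounded uniformly in the
parameter, by compactness. -/
lemma exists_bound_iteratedDeriv_param {Φ : ℝ → ℝ → ℝ}
    (hΦ : ContDiff ℝ ∞ (fun z : ℝ × ℝ => Φ z.1 z.2)) {T : ℝ} (hT : 0 < T)
    (hper : ∀ a, Function.Periodic (Φ a) T) (S : ℕ) :
    ∃ M : ℝ, ∀ k ≤ S, ∀ a ∈ Set.Icc (0 : ℝ) 1, ∀ θ, |iteratedDeriv k (Φ a) θ| ≤ M := by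
  have h1 : ∀ k, ∃ M : ℝ, 0 ≤ M ∧
      ∀ a ∈ Set.Icc (0 : ℝ) 1, ∀ θ, |iteratedDeriv k (Φ a) θ| ≤ M := by
    intro k
    have hK : IsCompact (Set.Icc (0 : ℝ) 1 ×ˢ Set.Icc (0 : ℝ) T) := isCompact_Icc.prod isCompact_Icc
    obtain ⟨M, hM⟩ := hK.exists_bound_of_continuousOn
      (contDiff_iteratedDeriv_param hΦ k).continuous.continuousOn
    refine ⟨max M 0, le_max_right _ _, fun a ha θ => ?_⟩
    have hp : Function.Periodic (iteratedDeriv k (Φ a)) T := by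
      intro s
      have h := congrFun (iteratedDeriv_comp_add_const k (Φ a) T) s
      have h2 : (fun y => Φ a (y + T)) = Φ a := funext (hper a)
      rw [h2] at h
      exact h.symm
    obtain ⟨y, hy, hye⟩ := hp.exists_mem_Ico₀ hT θ
    rw [hye]
    exact (hM (a, y) ⟨ha, hy.1, hy.2.le⟩).trans (le_max_left _ _)
  choose M hM0 hM using h1
  refine ⟨∑ k ∈ Finset.range (S + 1), M k, fun k hk a ha θ => (hM k a ha θ).trans ?_⟩
  exact Finset.single_le_sum (f := M) (fun i _ => hM0 i) (Finset.mem_range.2 (by omega))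

lemma abs_iteratedDeriv_mul_le {S : ℕ} {f g : ℝ → ℝ} (hf : ContDiff ℝ S f) (hg : ContDiff ℝ S g)
    {A B : ℝ} (hA : ∀ k ≤ S, ∀ x, |iteratedDeriv k f x| ≤ A)
    (hB : ∀ k ≤ S, ∀ x, |iteratedDeriv k g x| ≤ B) {k : ℕ} (hk : k ≤ S) (x : ℝ) :
    |iteratedDeriv k (fun x => f x * g x) x| ≤ 2 ^ k * (A * B) := by
  have h := norm_iteratedFDeriv_mul_le hf hg x (n := k) (by exact_mod_cast hk)
  simp only [norm_iteratedFDeriv_eq_norm_iteratedDeriv, Real.norm_eq_abs] at h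
  refine h.trans ?_
  have hA0 : 0 ≤ A := (abs_nonneg _).trans (hA 0 (Nat.zero_le _) 0)
  calc ∑ i ∈ Finset.range (k + 1), (k.choose i : ℝ) * |iteratedDeriv i f x| *
        |iteratedDeriv (k - i) g x|
      ≤ ∑ i ∈ Finset.range (k + 1), (k.choose i : ℝ) * A * B := by
        refine Finset.sum_le_sum fun i hi => ?_
        have := Finset.mem_range.1 hi
        have h1 := hA i (by omega) x
        have h2 := hB (k - i) (by omega) x
        gcongr
    _ = 2 ^ k * (A * B) := by
        rw [← Finset.sum_mul, ← Finset.sum_mul, ← Nat.cast_sum, Nat.sum_range_choose]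
        push_cast
        ring

/-- Multipliers `t(u) (1 + x)^e F(log x)` with `u = exp (-(x/N)²)` and a cutoff `t` vanishing near
`u = 0` and near `u = 1`: after division by `N^e u` they are functions of `u = (1 + cos θ) / 2`
whose derivatives in `θ` are bounded uniformly in the scale `N`. -/
theorem exists_rescaled_multiplier (S : ℕ) {F : ℝ → ℝ} (hF : ContDiff ℝ S F) {c : ℝ}
    (hFc : ∀ k ≤ S, ∀ x, |iteratedDeriv k F x| ≤ c) (e : ℝ) {δ : ℝ} (hδ : 0 < δ)
    (hδ2 : δ < 1 / 2) {t : ℝ → ℝ} (ht : ContDiff ℝ ∞ t)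
    (ht0 : ∀ u ∈ Set.Icc (0 : ℝ) 1, u ∉ Set.Icc δ (1 - δ) → t u = 0) :
    ∃ M : ℝ, ∀ N : ℝ, 1 ≤ N → ∃ g : ℝ → ℝ,
      ContDiff ℝ S (fun θ => g ((1 + Real.cos θ) / 2)) ∧
      (∀ θ, |g ((1 + Real.cos θ) / 2)| ≤ M) ∧
      (∀ θ, |iteratedDeriv S (fun θ => g ((1 + Real.cos θ) / 2)) θ| ≤ M) ∧
      ∀ x, 0 ≤ x → t (Real.exp (-(x / N) ^ 2)) * ((1 + x) ^ e * F (Real.log x)) =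
        N ^ e * (Real.exp (-(x / N) ^ 2) * g (Real.exp (-(x / N) ^ 2))) := by
  let ψ : ContDiffBump (1 / 2 : ℝ) := ⟨1 / 2 - δ, 1 / 2 - δ / 2, by linarith, by linarith⟩
  have hψ1 : ∀ u ∈ Set.Icc δ (1 - δ), ψ u = 1 := fun u hu => ψ.one_of_mem_closedBall (by
    rw [Metric.mem_closedBall, Real.dist_eq, abs_le]
    constructor <;> simp only [ψ] <;> linarith [hu.1, hu.2])
  have hψs : tsupport ψ ⊆ Set.Ioo (0 : ℝ) 1 := by
    rw [ψ.tsupport_eq]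
    intro u hu
    rw [Metric.mem_closedBall, Real.dist_eq, abs_le] at hu
    simp only [ψ] at hu
    constructor <;> linarith [hu.1, hu.2]
  have hψc : ContDiff ℝ ∞ ψ := ψ.contDiff
  -- the cut-off version of `u ↦ log √(-log u)`, which is `log (x / N)`
  set Λ : ℝ → ℝ := fun u => ψ u * (1 / 2 * Real.log (-Real.log u)) with hΛ
  have hΛc : ContDiff ℝ ∞ Λ := by
    refine contDiff_cutoff_mul isOpen_Ioo hψc hψs (contDiffOn_const.mul ?_)
    refine ContDiffOn.log (ContDiffOn.neg (contDiffOn_id.log fun u hu => hu.1.ne')) fun u hu => ?_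
    exact (neg_pos.2 (Real.log_neg hu.1 hu.2)).ne'
  set τ : ℝ → ℝ := fun u => ψ u * u⁻¹ * t u with hτ
  have hτc : ContDiff ℝ ∞ τ :=
    (contDiff_cutoff_mul isOpen_Ioo hψc hψs
      (contDiffOn_id.inv fun u hu => hu.1.ne')).mul ht
  have hu : ContDiff ℝ ∞ (fun θ : ℝ => (1 + Real.cos θ) / 2) := by fun_prop
  -- `a² + exp (Λ u)` is `(1 + x) / N` for `a² = 1 / N`; the parameter enters through its square so
  -- that the base of the power is positive for every real `a`
  set A : ℝ → ℝ → ℝ := fun a θ => τ ((1 + Real.cos θ) / 2) *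
    (a ^ 2 + Real.exp (Λ ((1 + Real.cos θ) / 2))) ^ e with hA
  have hAc : ContDiff ℝ ∞ (fun z : ℝ × ℝ => A z.1 z.2) := by
    refine ContDiff.mul ((hτc.comp hu).comp contDiff_snd) ?_
    refine ContDiff.rpow_const_of_ne ?_ fun z => by positivity
    exact (contDiff_fst.pow 2).add ((Real.contDiff_exp.comp (hΛc.comp hu)).comp contDiff_snd)
  obtain ⟨M₁, hM₁⟩ := exists_bound_iteratedDeriv_param hAc Real.two_pi_pos
    (fun a θ => by simp only [hA, Real.cos_add_two_pi]) S
  have hΛu : ContDiff ℝ ∞ (fun θ => Λ ((1 + Real.cos θ) / 2)) := hΛc.comp hu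
  obtain ⟨D, hD⟩ := exists_bound_iteratedDeriv_param (Φ := fun _ θ => Λ ((1 + Real.cos θ) / 2))
    (hΛu.comp contDiff_snd) Real.two_pi_pos (fun a θ => by simp only [Real.cos_add_two_pi]) S
  set D' := max D 1 with hD'
  have hc0 : 0 ≤ c := (abs_nonneg _).trans (hFc 0 (Nat.zero_le _) 0)
  set M₂ : ℝ := S.factorial * c * D' ^ S with hM₂
  have hS : (S : ℕ∞ω) ≤ (∞ : ℕ∞ω) := by exact_mod_cast le_top
  have hcomp : ∀ σ : ℝ, ContDiff ℝ S (fun θ => F (σ + Λ ((1 + Real.cos θ) / 2))) := fun σ =>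
    hF.comp (contDiff_const.add (hΛu.of_le hS))
  -- the scale enters `F (log x) = F (log N + log (x / N))` through a translation only
  have hcompb : ∀ σ : ℝ, ∀ k ≤ S, ∀ θ,
      |iteratedDeriv k (fun θ => F (σ + Λ ((1 + Real.cos θ) / 2))) θ| ≤ M₂ := by
    intro σ k hk θ
    have h := norm_iteratedFDeriv_comp_le (g := F) (n := k) (N := S)
      (f := fun θ => σ + Λ ((1 + Real.cos θ) / 2)) (C := c) (D := D') hF
      (contDiff_const.add (hΛu.of_le hS)) (by exact_mod_cast hk) θ
      (fun i hi => by
        rw [norm_iteratedFDeriv_eq_norm_iteratedDeriv]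
        exact hFc i (hi.trans hk) _)
      (fun i hi hik => by
        rw [norm_iteratedFDeriv_eq_norm_iteratedDeriv, iteratedDeriv_const_add (by omega)]
        refine (hD i (hik.trans hk) 0 (by simp) θ).trans ((le_max_left D 1).trans ?_)
        exact le_self_pow₀ (le_max_right D 1) (by omega))
    rw [norm_iteratedFDeriv_eq_norm_iteratedDeriv] at h
    refine h.trans ?_
    have h1 : (1 : ℝ) ≤ D' := le_max_right D 1
    rw [hM₂]
    gcongr
  have hAS : ∀ a, ContDiff ℝ S (A a) := fun a =>
    (hAc.comp (contDiff_const.prodMk contDiff_id)).of_le hS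
  have hM₁0 : 0 ≤ M₁ := (abs_nonneg _).trans (hM₁ 0 (Nat.zero_le _) 0 (by simp) 0)
  have hM₂0 : 0 ≤ M₂ := (abs_nonneg _).trans (hcompb 0 0 (Nat.zero_le _) 0)
  refine ⟨2 ^ S * (M₁ * M₂), fun N hN => ?_⟩
  have hN0 : 0 < N := by linarith
  have ha : √(N⁻¹) ∈ Set.Icc (0 : ℝ) 1 := by
    refine ⟨Real.sqrt_nonneg _, Real.sqrt_le_one.2 ?_⟩
    exact inv_le_one_of_one_le₀ hN
  have hbd : ∀ k ≤ S, ∀ θ, |iteratedDeriv k (fun θ => A (√(N⁻¹)) θ *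
      F (Real.log N + Λ ((1 + Real.cos θ) / 2))) θ| ≤ 2 ^ S * (M₁ * M₂) := by
    intro k hk θ
    refine (abs_iteratedDeriv_mul_le (hAS _) (hcomp _) (fun k hk x => hM₁ k hk _ ha x)
      (hcompb (Real.log N)) hk θ).trans ?_
    gcongr
    norm_num
  refine ⟨fun u => τ u * (√(N⁻¹) ^ 2 + Real.exp (Λ u)) ^ e * F (Real.log N + Λ u),
    (hAS _).mul (hcomp _), fun θ => ?_, hbd S le_rfl, fun x hx => ?_⟩
  · have h := hbd 0 (Nat.zero_le _) θ
    rwa [iteratedDeriv_zero] at h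
  set u := Real.exp (-(x / N) ^ 2) with hudef
  have hu0 : 0 < u := Real.exp_pos _
  have hu1 : u ≤ 1 := Real.exp_le_one_iff.2 (by nlinarith [sq_nonneg (x / N)])
  by_cases hmem : u ∈ Set.Icc δ (1 - δ)
  · have hψu := hψ1 u hmem
    have hx0 : 0 < x := by
      rcases hx.eq_or_lt with h | h
      · rw [← h] at hudef
        simp at hudef
        linarith [hmem.2]
      · exact h
    have hΛu' : Λ u = Real.log (x / N) := by
      have h2 : Real.log (-Real.log u) = 2 * Real.log (x / N) := by
        rw [hudef, Real.log_exp, neg_neg, Real.log_pow]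
        push_cast
        rfl
      simp only [hΛ]
      rw [hψu, h2]
      ring
    have hsq : √(N⁻¹) ^ 2 = N⁻¹ := Real.sq_sqrt (by positivity)
    have h1 : N ^ e * (N⁻¹ + x / N) ^ e = (1 + x) ^ e := by
      rw [← Real.mul_rpow hN0.le (by positivity)]
      congr 1
      field_simp
    simp only [hτ, hψu, hΛu', hsq]
    rw [Real.exp_log (by positivity), Real.log_div hx0.ne' hN0.ne', ← h1]
    field_simp
    ring_nf
  · have := ht0 u ⟨hu0.le, hu1⟩ hmem
    simp [hτ, this]

/-! ### Localized kernels -/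

/-- The part of the standing assumptions that the estimates rest on: an orthonormal system on a
metric measure space with `α`-dimensional balls, and a heat kernel with Gaussian upper bound and
lower bound on the diagonal. -/
structure IsHeatSystem {X : Type*} [MetricSpace X] [MeasurableSpace X] (μ : Measure X)
    (φ : ℕ → X → ℝ) (ℓ : ℕ → ℝ) (α : ℝ) : Prop where
  alpha_pos : 0 < α
  continuous_phi : ∀ j, Continuous (φ j)
  orthonormal : ∀ j k, ∫ x, φ j x * φ k x ∂μ = if j = k then 1 else 0
  phi_zero : ∀ x, φ 0 x = 1
  ell_zero : ℓ 0 = 0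
  ell_mono : Monotone ℓ
  ell_tendsto : Tendsto ℓ atTop atTop
  ball_measure : ∃ c > 0, ∀ (x : X) (r : ℝ), 0 < r →
    μ (Metric.closedBall x r) ≤ ENNReal.ofReal (c * r ^ α)
  heat_summable : ∀ t ∈ Set.Ioc (0 : ℝ) 1, ∀ x y : X,
    Summable fun j => Real.exp (-(ℓ j) ^ 2 * t) * φ j x * φ j y
  heat_upper : ∃ c₁ > 0, ∃ c > 0, ∀ t ∈ Set.Ioc (0 : ℝ) 1, ∀ x y : X,
    |heatKernel φ ℓ t x y| ≤ c₁ * t ^ (-α / 2) * Real.exp (-c * dist x y ^ 2 / t)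
  heat_lower : ∃ c > 0, ∀ t ∈ Set.Ioc (0 : ℝ) 1, ∀ x : X, c * t ^ (-α / 2) ≤ heatKernel φ ℓ t x x

/-- The kernel `∑_j H_j φ_j(x) φ_j(y)` of the multiplier `H`. -/
noncomputable def multKernel {X : Type*} (φ : ℕ → X → ℝ) (H : ℕ → ℝ) (x y : X) : ℝ :=
  ∑' j, H j * φ j x * φ j y

/-- The heat multiplier `exp (-(ℓ_j / N)²)` at frequency scale `N`. -/
noncomputable def heatMult (ℓ : ℕ → ℝ) (N : ℝ) (j : ℕ) : ℝ := Real.exp (-(ℓ j / N) ^ 2)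

lemma heatMult_pos (ℓ : ℕ → ℝ) (N : ℝ) (j : ℕ) : 0 < heatMult ℓ N j := Real.exp_pos _

lemma heatMult_le_one (ℓ : ℕ → ℝ) (N : ℝ) (j : ℕ) : heatMult ℓ N j ≤ 1 :=
  Real.exp_le_one_iff.2 (neg_nonpos.2 (sq_nonneg _))

lemma heatMult_pow (ℓ : ℕ → ℝ) (N : ℝ) (i j : ℕ) :
    heatMult ℓ N j ^ i = Real.exp (-(ℓ j) ^ 2 * (i / N ^ 2)) := by
  unfold heatMult
  rw [← Real.exp_nat_mul]
  congr 1
  ring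

lemma exists_cos_eq_heatMult (ℓ : ℕ → ℝ) (N : ℝ) (j : ℕ) :
    ∃ θ, (1 + Real.cos θ) / 2 = heatMult ℓ N j := by
  refine ⟨Real.arccos (2 * heatMult ℓ N j - 1), ?_⟩
  rw [Real.cos_arccos]
  · ring
  · linarith [heatMult_pos ℓ N j]
  · linarith [heatMult_le_one ℓ N j]

variable {X : Type*} [MetricSpace X] [MeasurableSpace X] {μ : Measure X} {φ : ℕ → X → ℝ}
  {ℓ : ℕ → ℝ} {α : ℝ}

namespace IsHeatSystem

lemma ell_nonneg (h : IsHeatSystem μ φ ℓ α) (j : ℕ) : 0 ≤ ℓ j := by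
  rw [← h.ell_zero]
  exact h.ell_mono (Nat.zero_le j)

lemma finite_ell_le (h : IsHeatSystem μ φ ℓ α) (L : ℝ) : {j | ℓ j ≤ L}.Finite := by
  obtain ⟨n, hn⟩ := (h.ell_tendsto.eventually_gt_atTop L).exists_forall_of_atTop
  refine (Set.finite_lt_nat n).subset fun j hj => ?_
  by_contra hlt
  exact absurd (hn j (not_lt.1 hlt)) (not_lt.2 hj)

/-- By `heatMult_pow` this is the series of the heat kernel at time `i / N²`. -/
lemma summable_heatMult_pow (h : IsHeatSystem μ φ ℓ α) {N : ℝ} {i : ℕ} (hi : 0 < i)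
    (hiN : (i : ℝ) ≤ N ^ 2) (x y : X) :
    Summable fun j => heatMult ℓ N j ^ i * φ j x * φ j y := by
  have hi' : (0 : ℝ) < i := by exact_mod_cast hi
  simp only [heatMult_pow]
  refine h.heat_summable _ ⟨div_pos hi' (by linarith), ?_⟩ x y
  exact (div_le_one (by linarith)).2 hiN

lemma exists_multKernel_heatMult_pow_le (h : IsHeatSystem μ φ ℓ α) :
    ∃ c₁ > 0, ∃ c > 0, ∀ (N : ℝ) (i : ℕ), 0 < N → 0 < i → (i : ℝ) ≤ N ^ 2 → ∀ x y,
      |multKernel φ (fun j => heatMult ℓ N j ^ i) x y| ≤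
        c₁ * N ^ α * (i : ℝ) ^ (-α / 2) * Real.exp (-c * (N * dist x y) ^ 2 / i) := by
  obtain ⟨c₁, hc₁, c, hc, H⟩ := h.heat_upper
  refine ⟨c₁, hc₁, c, hc, fun N i hN hi hiN x y => ?_⟩
  have hi' : (0 : ℝ) < i := by exact_mod_cast hi
  have h1 := H (i / N ^ 2) ⟨by positivity, (div_le_one (by positivity)).2 hiN⟩ x y
  have e1 : multKernel φ (fun j => heatMult ℓ N j ^ i) x y = heatKernel φ ℓ (i / N ^ 2) x y := by
    unfold multKernel heatKernel
    simp only [heatMult_pow]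
  have e2 : ((i : ℝ) / N ^ 2) ^ (-α / 2) = N ^ α * (i : ℝ) ^ (-α / 2) := by
    rw [Real.div_rpow hi'.le (by positivity), ← Real.rpow_natCast, ← Real.rpow_mul hN.le,
      div_eq_mul_inv, ← Real.rpow_neg hN.le, mul_comm]
    congr 2
    push_cast
    ring
  have e3 : -c * dist x y ^ 2 / (i / N ^ 2) = -c * (N * dist x y) ^ 2 / i := by
    field_simp
  rw [e1]
  refine h1.trans (le_of_eq ?_)
  rw [e2, e3]
  ring

/-- The bound `∑_j exp (-(ℓ_j/N)²) |φ_j(x) φ_j(y)| ≤ C N^α` of the Christoffel function. -/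
lemma exists_christoffel_le (h : IsHeatSystem μ φ ℓ α) :
    ∃ C > 0, ∀ N : ℝ, 1 ≤ N → ∀ x y,
      Summable (fun j => heatMult ℓ N j * (|φ j x| * |φ j y|)) ∧
      ∑' j, heatMult ℓ N j * (|φ j x| * |φ j y|) ≤ C * N ^ α := by
  obtain ⟨c₁, hc₁, c, hc, H⟩ := h.exists_multKernel_heatMult_pow_le
  refine ⟨c₁, hc₁, fun N hN x y => ?_⟩
  have hN0 : 0 < N := by linarith
  have hN2 : ((1 : ℕ) : ℝ) ≤ N ^ 2 := by
    push_cast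
    nlinarith
  have hs : ∀ z, Summable fun j => heatMult ℓ N j * φ j z * φ j z := fun z => by
    simpa using h.summable_heatMult_pow one_pos hN2 z z
  have hb : ∀ z, ∑' j, heatMult ℓ N j * φ j z * φ j z ≤ c₁ * N ^ α := fun z => by
    have h1 := (le_abs_self _).trans (H N 1 hN0 one_pos hN2 z z)
    simpa [multKernel] using h1
  have hle : ∀ j, heatMult ℓ N j * (|φ j x| * |φ j y|) ≤
      2⁻¹ * (heatMult ℓ N j * φ j x * φ j x + heatMult ℓ N j * φ j y * φ j y) := by
    intro j
    have h1 := two_mul_le_add_sq |φ j x| |φ j y|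
    rw [sq_abs, sq_abs] at h1
    have h2 := mul_le_mul_of_nonneg_left h1 (heatMult_pos ℓ N j).le
    linarith
  have hsum := ((hs x).add (hs y)).mul_left 2⁻¹
  have hnn : ∀ j, 0 ≤ heatMult ℓ N j * (|φ j x| * |φ j y|) := fun j =>
    mul_nonneg (heatMult_pos ℓ N j).le (by positivity)
  have hS := hsum.of_nonneg_of_le hnn hle
  refine ⟨hS, (hS.tsum_le_tsum hle hsum).trans ?_⟩
  rw [tsum_mul_left, (hs x).tsum_add (hs y)]
  linarith [hb x, hb y]

/-- A multiplier dominated by `η` times the heat multiplier has a kernel of size `O(η N^α)`. -/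
lemma exists_abs_tsum_le (h : IsHeatSystem μ φ ℓ α) :
    ∃ C > 0, ∀ N : ℝ, 1 ≤ N → ∀ (H : ℕ → ℝ) (η : ℝ), (∀ j, |H j| ≤ η * heatMult ℓ N j) →
      ∀ x y, Summable (fun j => H j * φ j x * φ j y) ∧
        |multKernel φ H x y| ≤ η * (C * N ^ α) := by
  obtain ⟨C, hC, hchr⟩ := h.exists_christoffel_le
  refine ⟨C, hC, fun N hN H η hH x y => ?_⟩
  obtain ⟨hs, hb⟩ := hchr N hN x y
  have hη : 0 ≤ η := by
    have := (abs_nonneg _).trans (hH 0)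
    exact nonneg_of_mul_nonneg_left this (heatMult_pos ℓ N 0)
  have hle : ∀ j, ‖H j * φ j x * φ j y‖ ≤ η * (heatMult ℓ N j * (|φ j x| * |φ j y|)) := by
    intro j
    rw [Real.norm_eq_abs, abs_mul, abs_mul, mul_assoc, ← mul_assoc η]
    exact mul_le_mul_of_nonneg_right (hH j) (by positivity)
  refine ⟨Summable.of_norm_bounded (hs.mul_left η) hle, ?_⟩
  have h1 := tsum_of_norm_bounded (hs.mul_left η).hasSum hle
  rw [Real.norm_eq_abs, tsum_mul_left] at h1
  exact h1.trans (mul_le_mul_of_nonneg_left hb hη)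

/-- **Localization.** If `g` is `S` times differentiable as a function of `θ`, where
`u = (1 + cos θ) / 2`, then the kernel of the multiplier `u g(u)`, `u = exp (-(ℓ_j/N)²)`, decays
like `(1 + N ρ)^(-S)`. At distance `ρ`, replace `g` by a polynomial of degree about `ε N ρ`:
the error is `(N ρ)^(-S)` by Jackson's theorem, and the polynomial gives a combination of heat
kernels at times at most `ε ρ / N`, whose Gaussian smallness `exp (-c N ρ / ε)` beats the
geometric growth of the coefficients. -/
theorem exists_localization [CompactSpace X] (h : IsHeatSystem μ φ ℓ α) (S : ℕ) :
    ∃ C > 0, ∀ (g : ℝ → ℝ) (M : ℝ), ContDiff ℝ S (fun θ => g ((1 + Real.cos θ) / 2)) →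
      (∀ θ, |g ((1 + Real.cos θ) / 2)| ≤ M) →
      (∀ θ, |iteratedDeriv S (fun θ => g ((1 + Real.cos θ) / 2)) θ| ≤ M) →
      ∀ N : ℝ, 1 ≤ N → ∀ x y,
        |multKernel φ (fun j => heatMult ℓ N j * g (heatMult ℓ N j)) x y| ≤
          C * M * N ^ α * (1 + N * dist x y) ^ (-(S : ℝ)) := by
  obtain ⟨CJ, hCJ, hJ⟩ := jackson S
  obtain ⟨C₀, hC₀, hchr⟩ := h.exists_abs_tsum_le
  obtain ⟨c₁, hc₁, c, hc, hheat⟩ := h.exists_multKernel_heatMult_pow_le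
  obtain ⟨R, hR0, hR⟩ : ∃ R : ℝ, 0 < R ∧ ∀ x y : X, dist x y ≤ R := by
    obtain ⟨R, hR⟩ := (Metric.isBounded_iff.1 (isCompact_univ (X := X)).isBounded)
    exact ⟨max R 1, by positivity, fun x y =>
      (hR (Set.mem_univ x) (Set.mem_univ y)).trans (le_max_left _ _)⟩
  -- `ε R ≤ 1` keeps the heat times in `(0, 1]`; `4 ε ≤ c` makes the Gaussian factor at most
  -- `exp (-4D)`, `D = N ρ`, against coefficients of size `14^n ≤ exp (3D)`
  set ε : ℝ := min (min 1 (c / 4)) (1 / R) with hε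
  have hε0 : 0 < ε := by positivity
  have hε1 : ε ≤ 1 := (min_le_left _ _).trans (min_le_left _ _)
  have hεc : 4 * ε ≤ c := by
    have : ε ≤ c / 4 := (min_le_left _ _).trans (min_le_right _ _)
    linarith
  have hεR : ε * R ≤ 1 := by
    have : ε ≤ 1 / R := min_le_right _ _
    calc ε * R ≤ 1 / R * R := by gcongr
      _ = 1 := by field_simp
  set a₁ : ℝ := C₀ * (1 + 1 / ε) ^ S
  set a₂ : ℝ := CJ * C₀ * (2 * (1 + ε) / ε) ^ S
  set a₃ : ℝ := CJ * c₁ * (Real.exp 1 * S.factorial)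
  have ha₁ : 0 < a₁ := by positivity
  have ha₂ : 0 < a₂ := by positivity
  have ha₃ : 0 < a₃ := by positivity
  refine ⟨a₁ + a₂ + a₃, by positivity, fun g M hg hgM hgS N hN x y => ?_⟩
  have hN0 : 0 < N := by linarith
  have hM0 : 0 ≤ M := (abs_nonneg _).trans (hgM 0)
  set D : ℝ := N * dist x y with hD
  have hD0 : 0 ≤ D := by positivity
  have hpw : (1 + D) ^ (-(S : ℝ)) = ((1 + D) ^ S)⁻¹ := by
    rw [Real.rpow_neg (by positivity), Real.rpow_natCast]
  have hgu : ∀ j, |g (heatMult ℓ N j)| ≤ M := by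
    intro j
    obtain ⟨θ, hθ⟩ := exists_cos_eq_heatMult ℓ N j
    rw [← hθ]
    exact hgM θ
  rw [hpw]
  have hNα : 0 < N ^ α := by positivity
  set n : ℕ := ⌊ε * D⌋₊ with hn
  rcases Nat.eq_zero_or_pos n with hn0 | hnpos
  · -- close to the diagonal the bound of the Christoffel function suffices
    have hlt : ε * D < 1 := by
      have := Nat.lt_floor_add_one (ε * D)
      rw [← hn, hn0] at this
      simpa using this
    have h1 := (hchr N hN (fun j => heatMult ℓ N j * g (heatMult ℓ N j)) M (fun j => by
      rw [abs_mul, abs_of_pos (heatMult_pos ℓ N j), mul_comm]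
      exact mul_le_mul_of_nonneg_right (hgu j) (heatMult_pos ℓ N j).le) x y).2
    have hD1 : D ≤ 1 / ε := by
      rw [le_div_iff₀ hε0]
      linarith
    have h2 : (1 : ℝ) ≤ (1 + 1 / ε) ^ S * ((1 + D) ^ S)⁻¹ := by
      rw [← div_eq_mul_inv, one_le_div (by positivity)]
      gcongr
    calc _ ≤ M * (C₀ * N ^ α) := h1
      _ ≤ M * (C₀ * N ^ α) * ((1 + 1 / ε) ^ S * ((1 + D) ^ S)⁻¹) :=
          le_mul_of_one_le_right (by positivity) h2
      _ = a₁ * (M * N ^ α * ((1 + D) ^ S)⁻¹) := by ring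
      _ ≤ (a₁ + a₂ + a₃) * (M * N ^ α * ((1 + D) ^ S)⁻¹) := by
          gcongr
          linarith
      _ = _ := by ring
  · have hn1 : (1 : ℝ) ≤ n := by exact_mod_cast hnpos
    have hnle : (n : ℝ) ≤ ε * D := Nat.floor_le (by positivity)
    have hnlt : ε * D < n + 1 := Nat.lt_floor_add_one _
    have hDpos : 0 < D := by
      by_contra hneg
      have : D = 0 := le_antisymm (not_lt.1 hneg) hD0
      rw [this] at hnle
      linarith
    have hnN : (n : ℝ) ≤ N ^ 2 := by
      have h1 : ε * D ≤ N := by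
        calc ε * D = N * (ε * dist x y) := by rw [hD]; ring
          _ ≤ N * (ε * R) := by
              gcongr
              exact hR x y
          _ ≤ N * 1 := by gcongr
          _ = N := mul_one N
      nlinarith
    obtain ⟨P, ⟨p, hp, hpB⟩, hPerr⟩ := hJ (fun θ => g ((1 + Real.cos θ) / 2)) M hg
      (fun θ => by simp only [Real.cos_add_two_pi]) (fun θ => by simp only [Real.cos_neg])
      hgM hgS n hnpos
    have herr : ∀ j, |heatMult ℓ N j * (g (heatMult ℓ N j) - P (heatMult ℓ N j))| ≤
        CJ * M / n ^ S * heatMult ℓ N j := by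
      intro j
      obtain ⟨θ, hθ⟩ := exists_cos_eq_heatMult ℓ N j
      rw [abs_mul, abs_of_pos (heatMult_pos ℓ N j), mul_comm]
      refine mul_le_mul_of_nonneg_right ?_ (heatMult_pos ℓ N j).le
      rw [← hθ]
      exact hPerr θ
    obtain ⟨hs1, hb1⟩ := hchr N hN _ _ herr x y
    have hs2 : ∀ i ∈ Finset.range n,
        Summable (fun j => p i * (heatMult ℓ N j ^ (i + 1) * φ j x * φ j y)) := by
      intro i hi
      have hin : ((i + 1 : ℕ) : ℝ) ≤ n := by exact_mod_cast Finset.mem_range.1 hi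
      exact (h.summable_heatMult_pow (Nat.succ_pos i) (hin.trans hnN) x y).mul_left (p i)
    have hsplit : multKernel φ (fun j => heatMult ℓ N j * g (heatMult ℓ N j)) x y =
        multKernel φ (fun j => heatMult ℓ N j * (g (heatMult ℓ N j) - P (heatMult ℓ N j))) x y +
        ∑ i ∈ Finset.range n, p i * multKernel φ (fun j => heatMult ℓ N j ^ (i + 1)) x y := by
      have e1 : ∑ i ∈ Finset.range n, p i * multKernel φ (fun j => heatMult ℓ N j ^ (i + 1)) x y =
          ∑' j, ∑ i ∈ Finset.range n, p i * (heatMult ℓ N j ^ (i + 1) * φ j x * φ j y) := by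
        rw [Summable.tsum_finsetSum hs2]
        refine Finset.sum_congr rfl fun i _ => ?_
        rw [tsum_mul_left]
        rfl
      rw [e1]
      unfold multKernel
      rw [← hs1.tsum_add (summable_sum hs2)]
      refine tsum_congr fun j => ?_
      have e2 : ∑ i ∈ Finset.range n, p i * (heatMult ℓ N j ^ (i + 1) * φ j x * φ j y) =
          heatMult ℓ N j * P (heatMult ℓ N j) * φ j x * φ j y := by
        rw [hp, Finset.mul_sum, Finset.sum_mul, Finset.sum_mul]
        exact Finset.sum_congr rfl fun i _ => by ring
      rw [e2]
      ring
    have hexp : ∀ i ∈ Finset.range n,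
        |multKernel φ (fun j => heatMult ℓ N j ^ (i + 1)) x y| ≤
          c₁ * N ^ α * Real.exp (-(4 * D)) := by
      intro i hi
      have hin : ((i + 1 : ℕ) : ℝ) ≤ n := by exact_mod_cast Finset.mem_range.1 hi
      have hi1 : (1 : ℝ) ≤ ((i + 1 : ℕ) : ℝ) := by exact_mod_cast Nat.succ_pos i
      refine (hheat N (i + 1) hN0 (Nat.succ_pos i) (hin.trans hnN) x y).trans ?_
      have e1 : ((i + 1 : ℕ) : ℝ) ^ (-α / 2) ≤ 1 :=
        Real.rpow_le_one_of_one_le_of_nonpos hi1 (by linarith [h.alpha_pos])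
      have e2 : Real.exp (-c * (N * dist x y) ^ 2 / ((i + 1 : ℕ) : ℝ)) ≤ Real.exp (-(4 * D)) := by
        rw [Real.exp_le_exp, ← hD, div_le_iff₀ (by linarith)]
        have h3 : ((i + 1 : ℕ) : ℝ) ≤ ε * D := hin.trans hnle
        have h4 : 4 * D * ((i + 1 : ℕ) : ℝ) ≤ 4 * D * (ε * D) := by gcongr
        have h5 : 4 * ε * D ^ 2 ≤ c * D ^ 2 := by gcongr
        nlinarith
      calc c₁ * N ^ α * ((i + 1 : ℕ) : ℝ) ^ (-α / 2) *
            Real.exp (-c * (N * dist x y) ^ 2 / ((i + 1 : ℕ) : ℝ))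
          ≤ c₁ * N ^ α * 1 * Real.exp (-(4 * D)) := by gcongr
        _ = _ := by ring
    have hb2 : |∑ i ∈ Finset.range n, p i * multKernel φ (fun j => heatMult ℓ N j ^ (i + 1)) x y| ≤
        a₃ * (M * N ^ α * ((1 + D) ^ S)⁻¹) := by
      have h14 : (14 : ℝ) ^ n ≤ Real.exp (3 * D) := by
        have e1 : (14 : ℝ) ≤ Real.exp 3 := by
          have h2 : (2.7 : ℝ) ≤ Real.exp 1 := by linarith [Real.exp_one_gt_d9]
          calc (14 : ℝ) ≤ 2.7 ^ 3 := by norm_num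
            _ ≤ Real.exp 1 ^ 3 := by gcongr
            _ = Real.exp 3 := by rw [← Real.exp_nat_mul]; norm_num
        calc (14 : ℝ) ^ n ≤ Real.exp 3 ^ n := by gcongr
          _ = Real.exp (3 * n) := by rw [← Real.exp_nat_mul, mul_comm]
          _ ≤ Real.exp (3 * D) := by
              rw [Real.exp_le_exp]
              have : ε * D ≤ 1 * D := by gcongr
              linarith
      have hfac : Real.exp (-D) ≤ Real.exp 1 * S.factorial * ((1 + D) ^ S)⁻¹ := by
        have e1 := Real.pow_div_factorial_le_exp (1 + D) (by positivity) S
        have e2 : (1 + D) ^ S ≤ Real.exp (1 + D) * S.factorial := by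
          rwa [div_le_iff₀ (by positivity)] at e1
        rw [← div_eq_mul_inv, le_div_iff₀ (by positivity)]
        calc Real.exp (-D) * (1 + D) ^ S
            ≤ Real.exp (-D) * (Real.exp (1 + D) * S.factorial) := by gcongr
          _ = Real.exp 1 * S.factorial := by
              rw [← mul_assoc, ← Real.exp_add]
              congr 2
              ring
      calc _ ≤ ∑ i ∈ Finset.range n,
            |p i * multKernel φ (fun j => heatMult ℓ N j ^ (i + 1)) x y| :=
            Finset.abs_sum_le_sum_abs _ _
        _ ≤ ∑ i ∈ Finset.range n, |p i| * (c₁ * N ^ α * Real.exp (-(4 * D))) := by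
            refine Finset.sum_le_sum fun i hi => ?_
            rw [abs_mul]
            exact mul_le_mul_of_nonneg_left (hexp i hi) (abs_nonneg _)
        _ = (∑ i ∈ Finset.range n, |p i|) * (c₁ * N ^ α * Real.exp (-(4 * D))) := by
            rw [Finset.sum_mul]
        _ ≤ (CJ * M * Real.exp (3 * D)) * (c₁ * N ^ α * Real.exp (-(4 * D))) := by
            refine mul_le_mul_of_nonneg_right (hpB.trans ?_) (by positivity)
            gcongr
        _ = CJ * M * c₁ * N ^ α * (Real.exp (3 * D) * Real.exp (-(4 * D))) := by ring
        _ = CJ * M * c₁ * N ^ α * Real.exp (-D) := by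
            rw [← Real.exp_add]
            congr 2
            ring
        _ ≤ CJ * M * c₁ * N ^ α * (Real.exp 1 * S.factorial * ((1 + D) ^ S)⁻¹) := by gcongr
        _ = _ := by ring
    have hb1' : CJ * M / n ^ S * (C₀ * N ^ α) ≤ a₂ * (M * N ^ α * ((1 + D) ^ S)⁻¹) := by
      have h1 : (1 : ℝ) / n ≤ 2 * (1 + ε) / ε * (1 + D)⁻¹ := by
        rw [← div_eq_mul_inv, div_div, div_le_div_iff₀ (by linarith) (by positivity)]
        have h2 : ε * (1 + D) ≤ (1 + ε) * (ε * D) + ε := by nlinarith [mul_pos hε0 hDpos, sq_nonneg ε]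
        nlinarith
      have h2 : (1 : ℝ) / n ^ S ≤ (2 * (1 + ε) / ε) ^ S * ((1 + D) ^ S)⁻¹ := by
        rw [← inv_pow, ← mul_pow, ← one_div_pow]
        exact pow_le_pow_left₀ (by positivity) h1 S
      calc CJ * M / n ^ S * (C₀ * N ^ α) = CJ * M * (C₀ * N ^ α) * (1 / n ^ S) := by ring
        _ ≤ CJ * M * (C₀ * N ^ α) * ((2 * (1 + ε) / ε) ^ S * ((1 + D) ^ S)⁻¹) := by gcongr
        _ = _ := by ring
    rw [hsplit]
    have hpos : 0 ≤ a₁ * (M * N ^ α * ((1 + D) ^ S)⁻¹) := by positivity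
    calc _ ≤ _ := abs_add_le _ _
      _ ≤ a₂ * (M * N ^ α * ((1 + D) ^ S)⁻¹) + a₃ * (M * N ^ α * ((1 + D) ^ S)⁻¹) :=
          add_le_add (hb1.trans hb1') hb2
      _ ≤ a₁ * (M * N ^ α * ((1 + D) ^ S)⁻¹) + (a₂ * (M * N ^ α * ((1 + D) ^ S)⁻¹) +
          a₃ * (M * N ^ α * ((1 + D) ^ S)⁻¹)) := le_add_of_nonneg_left hpos
      _ = _ := by ring

end IsHeatSystem

/-! ### Schur's test and the integral of the localization weight -/

omit [MetricSpace X] in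
/-- Schur's test between two measures on the same space, for `1 ≤ p ≤ ∞`. -/
theorem eLpNorm_le_of_schur {μ ν : Measure X} [SFinite μ] [SFinite ν] {k : X → X → ℝ≥0∞}
    (hk : Measurable (Function.uncurry k)) {A B : ℝ≥0∞}
    (hA : ∀ x, ∫⁻ y, k x y ∂ν ≤ A) (hB : ∀ y, ∫⁻ x, k x y ∂μ ≤ B) {p : ℝ≥0∞} (hp : 1 ≤ p)
    {f g : X → ℂ} (hg : AEStronglyMeasurable g ν)
    (hfg : ∀ x, ‖f x‖ₑ ≤ ∫⁻ y, k x y * ‖g y‖ₑ ∂ν) :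
    eLpNorm f p μ ≤ A ^ (1 - (p⁻¹).toReal) * B ^ (p⁻¹).toReal * eLpNorm g p ν := by
  have hkx : ∀ x, Measurable (k x) := fun x => hk.comp measurable_prodMk_left
  rcases eq_or_ne p ∞ with rfl | hpt
  · simp only [ENNReal.inv_top, ENNReal.toReal_zero, sub_zero, ENNReal.rpow_one,
      ENNReal.rpow_zero, mul_one, eLpNorm_exponent_top]
    refine eLpNormEssSup_le_of_ae_enorm_bound (ae_of_all _ fun x => (hfg x).trans ?_)
    calc ∫⁻ y, k x y * ‖g y‖ₑ ∂ν ≤ ∫⁻ y, k x y * eLpNormEssSup g ν ∂ν := by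
          refine lintegral_mono_ae ?_
          filter_upwards [enorm_ae_le_eLpNormEssSup g ν] with y hy
          gcongr
      _ = (∫⁻ y, k x y ∂ν) * eLpNormEssSup g ν := lintegral_mul_const _ (hkx x)
      _ ≤ A * eLpNormEssSup g ν := by
          gcongr
          exact hA x
  · have hp0 : p ≠ 0 := (zero_lt_one.trans_le hp).ne'
    set q := p.toReal with hq
    have hq1 : 1 ≤ q := by
      rw [hq, ← ENNReal.toReal_one]
      exact ENNReal.toReal_mono hpt hp
    have hq0 : 0 < q := by linarith
    have hgm : AEMeasurable (fun y => ‖g y‖ₑ) ν := hg.enorm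
    have hpow : ∀ x, ‖f x‖ₑ ^ q ≤ A ^ (q - 1) * ∫⁻ y, k x y * ‖g y‖ₑ ^ q ∂ν := by
      intro x
      -- Hölder's inequality for the measure `k(x, ·) ν`
      have h1 := eLpNorm'_le_eLpNorm'_mul_rpow_measure_univ (f := g) (μ := ν.withDensity (k x))
        (p := 1) (q := q) one_pos hq1 (hg.mono_ac (withDensity_absolutelyContinuous _ _))
      unfold eLpNorm' at h1
      simp only [ENNReal.rpow_one, div_one, withDensity_apply _ MeasurableSet.univ,
        Measure.restrict_univ] at h1
      rw [lintegral_withDensity_eq_lintegral_mul₀ (hkx x).aemeasurable hgm,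
        lintegral_withDensity_eq_lintegral_mul₀ (hkx x).aemeasurable (hgm.pow_const q)] at h1
      have h2 := ENNReal.rpow_le_rpow ((hfg x).trans h1) hq0.le
      refine h2.trans ?_
      rw [ENNReal.mul_rpow_of_nonneg _ _ hq0.le, ← ENNReal.rpow_mul, ← ENNReal.rpow_mul,
        one_div_mul_cancel hq0.ne', ENNReal.rpow_one, sub_mul, one_mul,
        one_div_mul_cancel hq0.ne', mul_comm]
      exact mul_le_mul' (ENNReal.rpow_le_rpow (hA x) (by linarith)) le_rfl
    have hI : ∫⁻ x, ‖f x‖ₑ ^ q ∂μ ≤ A ^ (q - 1) * (B * ∫⁻ y, ‖g y‖ₑ ^ q ∂ν) := by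
      have hm : AEMeasurable (Function.uncurry fun x y => k x y * ‖g y‖ₑ ^ q) (μ.prod ν) :=
        hk.aemeasurable.mul (hgm.pow_const q).comp_snd
      calc ∫⁻ x, ‖f x‖ₑ ^ q ∂μ ≤ ∫⁻ x, A ^ (q - 1) * ∫⁻ y, k x y * ‖g y‖ₑ ^ q ∂ν ∂μ :=
            lintegral_mono hpow
        _ = A ^ (q - 1) * ∫⁻ x, ∫⁻ y, k x y * ‖g y‖ₑ ^ q ∂ν ∂μ :=
            lintegral_const_mul'' _ hm.lintegral_prod_right'
        _ = A ^ (q - 1) * ∫⁻ y, ∫⁻ x, k x y * ‖g y‖ₑ ^ q ∂μ ∂ν := by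
            rw [lintegral_lintegral_swap hm]
        _ = A ^ (q - 1) * ∫⁻ y, (∫⁻ x, k x y ∂μ) * ‖g y‖ₑ ^ q ∂ν := by
            congr 1
            refine lintegral_congr fun y => ?_
            exact lintegral_mul_const _ (hk.comp measurable_prodMk_right)
        _ ≤ A ^ (q - 1) * ∫⁻ y, B * ‖g y‖ₑ ^ q ∂ν := by
            gcongr with y
            exact hB y
        _ = _ := by rw [lintegral_const_mul'' _ (hgm.pow_const q)]
    rw [eLpNorm_eq_lintegral_rpow_enorm_toReal hp0 hpt, eLpNorm_eq_lintegral_rpow_enorm_toReal hp0 hpt,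
      ENNReal.toReal_inv, ← hq]
    refine (ENNReal.rpow_le_rpow hI (by positivity : 0 ≤ 1 / q)).trans (le_of_eq ?_)
    rw [ENNReal.mul_rpow_of_nonneg _ _ (by positivity),
      ENNReal.mul_rpow_of_nonneg _ _ (by positivity), ← ENNReal.rpow_mul, ← mul_assoc]
    congr 3
    · field_simp
    · rw [one_div]

/-- The weight `(1 + N ρ)^(-σ)` with `σ > α` is integrable with respect to every measure whose
balls of radius `s ≥ 1/N` have measure `O((N s)^α)`; this applies to `μ` and to the counting
measure of a separated set. -/
lemma exists_lintegral_weight_le {α σ : ℝ} (hασ : α < σ) (hσ : 0 < σ) :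
    ∃ C > 0, ∀ (ν : Measure X) (x : X) (N A : ℝ), 0 < N → 0 ≤ A → [OpensMeasurableSpace X] →
      (∀ s, 1 / N ≤ s → ν (Metric.closedBall x s) ≤ ENNReal.ofReal (A * (N * s) ^ α)) →
      ∫⁻ y, ENNReal.ofReal ((1 + N * dist x y) ^ (-σ)) ∂ν ≤ ENNReal.ofReal (C * A) := by
  have hr0 : (0 : ℝ) < 2 ^ (α - σ) := by positivity
  have hr1 : (2 : ℝ) ^ (α - σ) < 1 :=
    Real.rpow_lt_one_of_one_lt_of_neg one_lt_two (by linarith)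
  refine ⟨2 ^ σ * (1 - 2 ^ (α - σ))⁻¹, mul_pos (by positivity) (inv_pos.2 (by linarith)), ?_⟩
  intro ν x N A hN hA _ hball
  -- compare with the term of the least `i` such that `y` lies in the ball of radius `2^i / N`
  have hpt : ∀ y, ENNReal.ofReal ((1 + N * dist x y) ^ (-σ)) ≤
      ∑' i : ℕ, ENNReal.ofReal (2 ^ σ * ((2 : ℝ) ^ i) ^ (-σ)) *
        (Metric.closedBall x (2 ^ i / N)).indicator 1 y := by
    intro y
    have hd : 0 ≤ N * dist x y := by positivity
    have hex : ∃ i : ℕ, N * dist x y ≤ 2 ^ i :=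
      (pow_unbounded_of_one_lt (N * dist x y) one_lt_two).imp fun _ h => h.le
    classical
    set i := Nat.find hex with hi
    have hle : N * dist x y ≤ 2 ^ i := Nat.find_spec hex
    refine le_trans ?_ (ENNReal.le_tsum i)
    have hmem : y ∈ Metric.closedBall x (2 ^ i / N) := by
      rw [Metric.mem_closedBall, dist_comm, le_div_iff₀ hN, mul_comm]
      exact hle
    rw [Set.indicator_of_mem hmem, Pi.one_apply, mul_one]
    refine ENNReal.ofReal_le_ofReal ?_
    have hge : (2 : ℝ) ^ i / 2 ≤ 1 + N * dist x y := by
      rcases Nat.eq_zero_or_pos i with h0 | hpos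
      · rw [h0]
        norm_num
        linarith
      · have := Nat.find_min hex (m := i - 1) (by omega)
        have h2 : (2 : ℝ) ^ i = 2 ^ (i - 1) * 2 := by
          rw [← pow_succ]
          congr 1
          omega
        rw [h2]
        linarith [not_le.1 this]
    calc (1 + N * dist x y) ^ (-σ) ≤ ((2 : ℝ) ^ i / 2) ^ (-σ) :=
          Real.rpow_le_rpow_of_nonpos (by positivity) hge (by linarith)
      _ = 2 ^ σ * ((2 : ℝ) ^ i) ^ (-σ) := by
          rw [Real.div_rpow (by positivity) (by norm_num), Real.rpow_neg (x := 2) (by norm_num),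
            div_inv_eq_mul, mul_comm]
  have hsum : HasSum (fun i : ℕ => 2 ^ σ * A * ((2 : ℝ) ^ (α - σ)) ^ i)
      (2 ^ σ * A * (1 - 2 ^ (α - σ))⁻¹) :=
    (hasSum_geometric_of_lt_one hr0.le hr1).mul_left _
  calc ∫⁻ y, ENNReal.ofReal ((1 + N * dist x y) ^ (-σ)) ∂ν
      ≤ ∫⁻ y, ∑' i : ℕ, ENNReal.ofReal (2 ^ σ * ((2 : ℝ) ^ i) ^ (-σ)) *
        (Metric.closedBall x (2 ^ i / N)).indicator 1 y ∂ν := lintegral_mono hpt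
    _ = ∑' i : ℕ, ENNReal.ofReal (2 ^ σ * ((2 : ℝ) ^ i) ^ (-σ)) *
        ν (Metric.closedBall x (2 ^ i / N)) := by
        rw [lintegral_tsum fun i => ((measurable_one.indicator
          Metric.isClosed_closedBall.measurableSet).const_mul _).aemeasurable]
        refine tsum_congr fun i => ?_
        rw [lintegral_const_mul _ (measurable_one.indicator
          Metric.isClosed_closedBall.measurableSet),
          lintegral_indicator_one Metric.isClosed_closedBall.measurableSet]
    _ ≤ ∑' i : ℕ, ENNReal.ofReal (2 ^ σ * A * ((2 : ℝ) ^ (α - σ)) ^ i) := by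
        refine ENNReal.tsum_le_tsum fun i => ?_
        have h1 : (1 : ℝ) ≤ 2 ^ i := one_le_pow₀ one_le_two
        have h2 := hball (2 ^ i / N) (by gcongr)
        rw [mul_div_cancel₀ _ hN.ne'] at h2
        refine (mul_le_mul_right h2 _).trans (le_of_eq ?_)
        rw [← ENNReal.ofReal_mul (by positivity)]
        congr 1
        rw [← Real.rpow_natCast, ← Real.rpow_natCast, ← Real.rpow_mul (by norm_num),
          ← Real.rpow_mul (by norm_num), ← Real.rpow_mul (by norm_num)]
        have : (α - σ) * (i : ℝ) = i * (-σ) + i * α := by ring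
        rw [this, Real.rpow_add (by norm_num)]
        ring
    _ = ENNReal.ofReal (2 ^ σ * A * (1 - 2 ^ (α - σ))⁻¹) := by
        rw [← ENNReal.ofReal_tsum_of_nonneg (fun i => by positivity) hsum.summable, hsum.tsum_eq]
    _ = _ := by
        congr 1
        ring

/-! ### Band-limited multipliers -/

/-- `H` vanishes at the frequencies above `L`. -/
def BandLimited (ℓ : ℕ → ℝ) (L : ℝ) (H : ℕ → ℝ) : Prop := ∀ j, L < ℓ j → H j = 0

/-- The multiplier operator `f ↦ ∑_j H_j ⟨f, φ_j⟩ φ_j`. -/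
noncomputable def multOp (μ : Measure X) (φ : ℕ → X → ℝ) (H : ℕ → ℝ) (f : X → ℂ) (x : X) : ℂ :=
  ∑' j, (H j : ℂ) * coeff μ φ f j * (φ j x : ℂ)

namespace IsHeatSystem

/-- The finitely many indices of frequency at most `L`. -/
noncomputable def band (h : IsHeatSystem μ φ ℓ α) (L : ℝ) : Finset ℕ :=
  (h.finite_ell_le L).toFinset

lemma mem_band (h : IsHeatSystem μ φ ℓ α) {L : ℝ} {j : ℕ} : j ∈ h.band L ↔ ℓ j ≤ L := by
  simp [band]

lemma bandLimited_apply (h : IsHeatSystem μ φ ℓ α) {L : ℝ} {H : ℕ → ℝ} (hH : BandLimited ℓ L H)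
    {j : ℕ} (hj : j ∉ h.band L) : H j = 0 :=
  hH j (not_le.1 fun hle => hj (h.mem_band.2 hle))

lemma multKernel_eq_sum (h : IsHeatSystem μ φ ℓ α) {L : ℝ} {H : ℕ → ℝ} (hH : BandLimited ℓ L H)
    (x y : X) : multKernel φ H x y = ∑ j ∈ h.band L, H j * φ j x * φ j y := by
  unfold multKernel
  exact tsum_eq_sum fun j hj => by simp [h.bandLimited_apply hH hj]

lemma multOp_eq_sum (h : IsHeatSystem μ φ ℓ α) {L : ℝ} {H : ℕ → ℝ} (hH : BandLimited ℓ L H)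
    (f : X → ℂ) : multOp μ φ H f =
      fun x => ∑ j ∈ h.band L, (H j : ℂ) * coeff μ φ f j * (φ j x : ℂ) := by
  funext x
  unfold multOp
  exact tsum_eq_sum fun j hj => by simp [h.bandLimited_apply hH hj]

lemma continuous_phi_ofReal (h : IsHeatSystem μ φ ℓ α) (j : ℕ) :
    Continuous fun x => (φ j x : ℂ) :=
  Complex.continuous_ofReal.comp (h.continuous_phi j)

variable [CompactSpace X] [BorelSpace X] [IsProbabilityMeasure μ]

omit [BorelSpace X] [IsProbabilityMeasure μ] in
lemma exists_phi_bound (h : IsHeatSystem μ φ ℓ α) (j : ℕ) : ∃ C, ∀ x, ‖(φ j x : ℂ)‖ ≤ C := by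
  obtain ⟨C, hC⟩ := (isCompact_univ (X := X)).exists_bound_of_continuousOn
    (h.continuous_phi_ofReal j).continuousOn
  exact ⟨C, fun x => hC x (Set.mem_univ x)⟩

omit [IsProbabilityMeasure μ] in
lemma integrable_mul_phi (h : IsHeatSystem μ φ ℓ α) {f : X → ℂ} (hf : Integrable f μ) (j : ℕ) :
    Integrable (fun x => f x * (φ j x : ℂ)) μ := by
  obtain ⟨C, hC⟩ := h.exists_phi_bound j
  exact hf.mul_bdd (h.continuous_phi_ofReal j).aestronglyMeasurable (ae_of_all _ hC)

lemma coeff_finsetSum_phi (h : IsHeatSystem μ φ ℓ α) (s : Finset ℕ) (a : ℕ → ℂ) (k : ℕ) :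
    coeff μ φ (fun x => ∑ j ∈ s, a j * (φ j x : ℂ)) k = if k ∈ s then a k else 0 := by
  unfold coeff
  have h1 : ∀ x, (∑ j ∈ s, a j * (φ j x : ℂ)) * (φ k x : ℂ) =
      ∑ j ∈ s, a j * ((φ j x * φ k x : ℝ) : ℂ) := by
    intro x
    rw [Finset.sum_mul]
    exact Finset.sum_congr rfl fun j _ => by push_cast; ring
  simp only [h1]
  rw [integral_finsetSum]
  · have h2 : ∀ j ∈ s, ∫ x, a j * ((φ j x * φ k x : ℝ) : ℂ) ∂μ = if j = k then a k else 0 := by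
      intro j _
      rw [integral_const_mul, integral_complex_ofReal, h.orthonormal]
      split_ifs with hjk
      · simp [hjk]
      · simp
    rw [Finset.sum_congr rfl h2, Finset.sum_ite_eq']
  · intro j _
    refine Integrable.const_mul ?_ _
    have hc : Continuous fun x => ((φ j x * φ k x : ℝ) : ℂ) :=
      Complex.continuous_ofReal.comp ((h.continuous_phi j).mul (h.continuous_phi k))
    exact hc.integrable_of_hasCompactSupport (HasCompactSupport.of_compactSpace _)

lemma coeff_multOp (h : IsHeatSystem μ φ ℓ α) {L : ℝ} {H : ℕ → ℝ} (hH : BandLimited ℓ L H)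
    (f : X → ℂ) (k : ℕ) : coeff μ φ (multOp μ φ H f) k = H k * coeff μ φ f k := by
  rw [h.multOp_eq_sum hH, h.coeff_finsetSum_phi]
  split_ifs with hk
  · rfl
  · simp [h.bandLimited_apply hH hk]

omit [CompactSpace X] [BorelSpace X] [IsProbabilityMeasure μ] in
lemma multOp_mem_diffusionPoly (h : IsHeatSystem μ φ ℓ α) {L : ℝ} {H : ℕ → ℝ}
    (hH : BandLimited ℓ L H) (f : X → ℂ) : multOp μ φ H f ∈ diffusionPoly φ ℓ L := by
  rw [h.multOp_eq_sum hH]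
  have e : (fun x => ∑ j ∈ h.band L, (H j : ℂ) * coeff μ φ f j * (φ j x : ℂ)) =
      ∑ j ∈ h.band L, ((H j : ℂ) * coeff μ φ f j) • fun x => (φ j x : ℂ) := by
    funext x
    simp
  rw [e]
  exact Submodule.sum_mem _ fun j hj => Submodule.smul_mem _ _
    (Submodule.subset_span ⟨j, h.mem_band.1 hj, rfl⟩)

lemma multOp_eq_integral (h : IsHeatSystem μ φ ℓ α) {L : ℝ} {H : ℕ → ℝ}
    (hH : BandLimited ℓ L H) {f : X → ℂ} (hf : Integrable f μ) (x : X) :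
    multOp μ φ H f x = ∫ y, (multKernel φ H x y : ℂ) * f y ∂μ := by
  rw [h.multOp_eq_sum hH]
  have e : ∀ y, (multKernel φ H x y : ℂ) * f y =
      ∑ j ∈ h.band L, ((H j : ℂ) * (φ j x : ℂ)) * (f y * (φ j y : ℂ)) := by
    intro y
    rw [h.multKernel_eq_sum hH]
    push_cast
    rw [Finset.sum_mul]
    exact Finset.sum_congr rfl fun j _ => by ring
  simp only [e]
  rw [integral_finsetSum _ fun j _ => (h.integrable_mul_phi hf j).const_mul _]
  refine Finset.sum_congr rfl fun j _ => ?_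
  rw [integral_const_mul]
  unfold coeff
  ring

end IsHeatSystem

/-- The localization weight `N^α (1 + N ρ(x,y))^(-σ)` at frequency scale `N`. -/
noncomputable def locWeight (α σ N : ℝ) (x y : X) : ℝ := N ^ α * (1 + N * dist x y) ^ (-σ)

omit [MeasurableSpace X] in
lemma locWeight_nonneg (α σ : ℝ) {N : ℝ} (hN : 0 < N) (x y : X) : 0 ≤ locWeight α σ N x y := by
  unfold locWeight
  positivity

omit [MeasurableSpace X] in
lemma locWeight_comm (α σ N : ℝ) (x y : X) : locWeight α σ N x y = locWeight α σ N y x := by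
  unfold locWeight
  rw [dist_comm]

omit [MeasurableSpace X] in
lemma locWeight_le (α : ℝ) {σ : ℝ} (hσ : 0 ≤ σ) {N : ℝ} (hN : 0 < N) (x y : X) :
    locWeight α σ N x y ≤ N ^ α := by
  unfold locWeight
  refine mul_le_of_le_one_right (by positivity) ?_
  refine Real.rpow_le_one_of_one_le_of_nonpos ?_ (by linarith)
  have : 0 ≤ N * dist x y := by positivity
  linarith

omit [MeasurableSpace X] in
lemma continuous_locWeight (α σ : ℝ) {N : ℝ} (hN : 0 < N) :
    Continuous (Function.uncurry (locWeight (X := X) α σ N)) := by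
  unfold locWeight
  simp only [Function.uncurry_def]
  refine continuous_const.mul (Continuous.rpow_const (by fun_prop) fun z => Or.inl ?_)
  positivity

lemma measurable_locWeight [CompactSpace X] [BorelSpace X] (α σ A : ℝ) {N : ℝ} (hN : 0 < N) :
    Measurable (Function.uncurry fun x y : X => ENNReal.ofReal (A * locWeight α σ N x y)) := by
  have h := ((continuous_locWeight (X := X) α σ hN).const_mul A).measurable
  exact h.ennreal_ofReal

namespace IsHeatSystem

lemma exists_lintegral_locWeight_le [BorelSpace X] (h : IsHeatSystem μ φ ℓ α) {σ : ℝ}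
    (hσ : α < σ) : ∃ C > 0, ∀ N : ℝ, 0 < N → ∀ x,
      ∫⁻ y, ENNReal.ofReal (locWeight α σ N x y) ∂μ ≤ ENNReal.ofReal C := by
  obtain ⟨c, hc, hball⟩ := h.ball_measure
  obtain ⟨C, hC, hw⟩ := exists_lintegral_weight_le (X := X) hσ (h.alpha_pos.trans hσ)
  refine ⟨C * c, by positivity, fun N hN x => ?_⟩
  have h1 := hw μ x N (c * N ^ (-α)) hN (by positivity) (fun s hs => by
    have hs0 : 0 < s := (by positivity : 0 < 1 / N).trans_le hs
    refine (hball x s hs0).trans (le_of_eq ?_)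
    congr 1
    rw [Real.mul_rpow hN.le hs0.le, Real.rpow_neg hN.le]
    field_simp)
  unfold locWeight
  have hNα : 0 ≤ N ^ α := by positivity
  simp only [ENNReal.ofReal_mul hNα]
  rw [lintegral_const_mul' _ _ ENNReal.ofReal_ne_top]
  refine (mul_le_mul_right h1 _).trans (le_of_eq ?_)
  rw [← ENNReal.ofReal_mul hNα]
  congr 1
  rw [Real.rpow_neg hN.le]
  field_simp

lemma lintegral_const_mul_locWeight_le {ν : Measure X} {σ A C N : ℝ} (hA : 0 ≤ A) (x : X)
    (hC : ∫⁻ y, ENNReal.ofReal (locWeight α σ N x y) ∂ν ≤ ENNReal.ofReal C) :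
    ∫⁻ y, ENNReal.ofReal (A * locWeight α σ N x y) ∂ν ≤ ENNReal.ofReal (A * C) := by
  simp only [ENNReal.ofReal_mul hA]
  rw [lintegral_const_mul' _ _ ENNReal.ofReal_ne_top]
  exact mul_le_mul_right hC _

variable [CompactSpace X] [BorelSpace X] [IsProbabilityMeasure μ]

lemma enorm_multOp_le (h : IsHeatSystem μ φ ℓ α) {L : ℝ} {H : ℕ → ℝ}
    (hH : BandLimited ℓ L H) {f : X → ℂ} (hf : Integrable f μ) {w : X → X → ℝ}
    (hw : ∀ x y, |multKernel φ H x y| ≤ w x y) (x : X) :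
    ‖multOp μ φ H f x‖ₑ ≤ ∫⁻ y, ENNReal.ofReal (w x y) * ‖f y‖ₑ ∂μ := by
  rw [h.multOp_eq_integral hH hf]
  refine (enorm_integral_le_lintegral_enorm _).trans (lintegral_mono fun y => ?_)
  rw [enorm_mul]
  gcongr
  rw [← ofReal_norm, Complex.norm_real]
  exact ENNReal.ofReal_le_ofReal (hw x y)

/-- Multipliers with localized kernels are bounded on every `L^p`, uniformly in the scale. -/
theorem exists_eLpNorm_multOp_le (h : IsHeatSystem μ φ ℓ α) {σ : ℝ} (hσ : α < σ) :
    ∃ C > 0, ∀ (p : ℝ≥0∞), 1 ≤ p → ∀ (L : ℝ) (H : ℕ → ℝ) (A N : ℝ), BandLimited ℓ L H → 0 < N →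
      0 ≤ A → (∀ x y, |multKernel φ H x y| ≤ A * locWeight α σ N x y) →
      ∀ f, Integrable f μ →
        eLpNorm (multOp μ φ H f) p μ ≤ ENNReal.ofReal (A * C) * eLpNorm f p μ := by
  obtain ⟨C, hC, hw⟩ := h.exists_lintegral_locWeight_le hσ
  refine ⟨C, hC, fun p hp L H A N hH hN hA hb f hf => ?_⟩
  have hx : ∀ x, ∫⁻ y, ENNReal.ofReal (A * locWeight α σ N x y) ∂μ ≤ ENNReal.ofReal (A * C) :=
    fun x => lintegral_const_mul_locWeight_le hA x (hw N hN x)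
  have h1 := eLpNorm_le_of_schur (measurable_locWeight α σ A hN) hx
    (fun y => by simpa only [locWeight_comm] using hx y) hp hf.aestronglyMeasurable
    (h.enorm_multOp_le hH hf hb)
  refine h1.trans (mul_le_mul_left (le_of_eq ?_) _)
  have hp1 : (p⁻¹).toReal ≤ 1 := by
    rw [← ENNReal.toReal_one]
    exact ENNReal.toReal_mono ENNReal.one_ne_top (ENNReal.inv_le_one.2 hp)
  rw [← ENNReal.rpow_add_of_nonneg _ _ (by linarith) ENNReal.toReal_nonneg, sub_add_cancel,
    ENNReal.rpow_one]

end IsHeatSystem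

/-! ### Low-pass multipliers and completeness of the system -/

/-- A smooth cutoff, equal to `1` on `[1/2, 1]` and to `0` on `[0, 1/4]`. -/
noncomputable def cutoff : ContDiffBump (1 : ℝ) := ⟨1 / 2, 3 / 4, by norm_num, by norm_num⟩

lemma cutoff_eq_one {u : ℝ} (h1 : 1 / 2 ≤ u) (h2 : u ≤ 1) : cutoff u = 1 :=
  cutoff.one_of_mem_closedBall (by
    rw [Metric.mem_closedBall, Real.dist_eq, abs_le]
    constructor <;> simp only [cutoff] <;> linarith)

lemma cutoff_eq_zero {u : ℝ} (h : u ≤ 1 / 4) : cutoff u = 0 :=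
  cutoff.zero_of_le_dist (by
    rw [Real.dist_eq, abs_of_nonpos (by linarith)]
    simp only [cutoff]
    linarith)

/-- The low-pass multiplier at scale `N`: a cutoff of the heat multiplier. -/
noncomputable def lowPass (ℓ : ℕ → ℝ) (N : ℝ) (j : ℕ) : ℝ := cutoff (heatMult ℓ N j)

lemma heatMult_le_of_le {N c : ℝ} (hN : 0 < N) (hc : 0 ≤ c) {j : ℕ} (hj : c * N ≤ ℓ j) :
    heatMult ℓ N j ≤ Real.exp (-c ^ 2) := by
  unfold heatMult
  rw [Real.exp_le_exp, neg_le_neg_iff]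
  exact pow_le_pow_left₀ hc ((le_div_iff₀ hN).2 hj) 2

lemma bandLimited_lowPass {N : ℝ} (hN : 0 < N) : BandLimited ℓ (2 * N) (lowPass ℓ N) := by
  intro j hj
  refine cutoff_eq_zero ((heatMult_le_of_le hN (by norm_num) hj.le).trans ?_)
  have h1 : (4 : ℝ) ≤ Real.exp (2 ^ 2) := by linarith [Real.add_one_le_exp ((2 : ℝ) ^ 2)]
  rw [Real.exp_neg, one_div]
  gcongr

lemma lowPass_eq_one {N : ℝ} (hN : 0 < N) {j : ℕ} (h0 : 0 ≤ ℓ j) (hj : 2 * ℓ j ≤ N) :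
    lowPass ℓ N j = 1 := by
  refine cutoff_eq_one ?_ (heatMult_le_one ℓ N j)
  unfold heatMult
  have h1 : ℓ j / N ≤ 1 / 2 := by
    rw [div_le_iff₀ hN]
    linarith
  have h2 : (ℓ j / N) ^ 2 ≤ (1 / 2) ^ 2 := pow_le_pow_left₀ (by positivity) h1 2
  have h3 := Real.add_one_le_exp (-(ℓ j / N) ^ 2)
  linarith

namespace IsHeatSystem

lemma exists_lowPass_localization [CompactSpace X] (h : IsHeatSystem μ φ ℓ α) (S : ℕ) :
    ∃ C > 0, ∀ N : ℝ, 1 ≤ N → ∀ x y,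
      |multKernel φ (lowPass ℓ N) x y| ≤ C * locWeight α S N x y := by
  obtain ⟨C, hC, hloc⟩ := h.exists_localization S
  -- smooth at `u = 0` as well, since the cutoff vanishes nearby
  set χ : ℝ → ℝ := fun u => u⁻¹ * cutoff u with hχ
  have hχc : ContDiff ℝ ∞ χ := by
    have h1 : ContDiff ℝ ∞ fun u : ℝ => cutoff u * u⁻¹ := by
      refine contDiff_cutoff_mul (U := Set.Ioi 0) isOpen_Ioi cutoff.contDiff ?_
        (contDiffOn_id.inv fun u hu => ne_of_gt hu)
      rw [cutoff.tsupport_eq]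
      intro u hu
      rw [Metric.mem_closedBall, Real.dist_eq, abs_le] at hu
      have := hu.1
      simp only [cutoff] at this
      simp only [Set.mem_Ioi]
      linarith
    simpa only [hχ, mul_comm] using h1
  have hg : ContDiff ℝ ∞ fun θ : ℝ => χ ((1 + Real.cos θ) / 2) := hχc.comp (by fun_prop)
  obtain ⟨M, hM⟩ := exists_bound_iteratedDeriv_param (Φ := fun _ θ => χ ((1 + Real.cos θ) / 2))
    (hg.comp contDiff_snd) Real.two_pi_pos (fun a θ => by simp only [Real.cos_add_two_pi]) S
  have hM0 : 0 ≤ M := (abs_nonneg _).trans (hM 0 (Nat.zero_le _) 0 (by simp) 0)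
  refine ⟨C * M + 1, by positivity, fun N hN x y => ?_⟩
  have h1 := hloc χ M (hg.of_le (by exact_mod_cast le_top))
    (fun θ => by simpa using hM 0 (Nat.zero_le _) 0 (by simp) θ)
    (fun θ => hM S le_rfl 0 (by simp) θ) N hN x y
  have e : (fun j => heatMult ℓ N j * χ (heatMult ℓ N j)) = lowPass ℓ N := by
    funext j
    have := (heatMult_pos ℓ N j).ne'
    simp only [hχ, lowPass]
    field_simp
  rw [e] at h1
  have h2 := locWeight_nonneg α S (by linarith : 0 < N) x y
  unfold locWeight at h2 ⊢
  refine h1.trans ?_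
  linarith

variable [CompactSpace X] [BorelSpace X] [IsProbabilityMeasure μ]

omit [CompactSpace X] [BorelSpace X] [IsProbabilityMeasure μ] in
lemma continuous_multKernel (h : IsHeatSystem μ φ ℓ α) {L : ℝ} {H : ℕ → ℝ}
    (hH : BandLimited ℓ L H) (x : X) : Continuous (multKernel φ H x) := by
  have e : multKernel φ H x = fun y => ∑ j ∈ h.band L, H j * φ j x * φ j y :=
    funext fun y => h.multKernel_eq_sum hH x y
  rw [e]
  have := h.continuous_phi
  fun_prop

lemma integral_multKernel (h : IsHeatSystem μ φ ℓ α) {L : ℝ} {H : ℕ → ℝ}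
    (hH : BandLimited ℓ L H) (hL : 0 ≤ L) (x : X) : ∫ y, multKernel φ H x y ∂μ = H 0 := by
  have e : ∀ y, multKernel φ H x y = ∑ j ∈ h.band L, H j * φ j x * (φ j y * φ 0 y) := fun y => by
    rw [h.multKernel_eq_sum hH]
    simp only [h.phi_zero, mul_one]
  simp only [e]
  have hi : ∀ j ∈ h.band L, Integrable (fun y => H j * φ j x * (φ j y * φ 0 y)) μ := fun j _ =>
    (((h.continuous_phi j).mul (h.continuous_phi 0)).integrable_of_hasCompactSupport
      (HasCompactSupport.of_compactSpace _)).const_mul _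
  rw [integral_finsetSum _ hi]
  simp only [integral_const_mul, h.orthonormal]
  rw [Finset.sum_eq_single 0]
  · simp [h.phi_zero]
  · intro j _ hj
    simp [hj]
  · intro h0
    exact absurd (h.mem_band.2 (by rw [h.ell_zero]; exact hL)) h0

lemma integral_locWeight_le {σ C N : ℝ} (hN : 0 < N) (hC0 : 0 ≤ C) (x : X)
    (hC : ∫⁻ y, ENNReal.ofReal (locWeight α σ N x y) ∂μ ≤ ENNReal.ofReal C) :
    ∫ y, locWeight α σ N x y ∂μ ≤ C := by
  rw [integral_eq_lintegral_of_nonneg_ae (ae_of_all _ fun y => locWeight_nonneg α σ hN x y)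
    ((continuous_locWeight α σ hN).comp (Continuous.prodMk_right x)).aestronglyMeasurable]
  exact ENNReal.toReal_le_of_le_ofReal hC0 hC

/-- The low-pass operators approximate continuous functions uniformly. -/
theorem exists_norm_lowPass_sub_le (h : IsHeatSystem μ φ ℓ α) {ψ : X → ℂ} (hψ : Continuous ψ)
    {ε : ℝ} (hε : 0 < ε) :
    ∃ N : ℝ, 1 ≤ N ∧ ∀ x, ‖ψ x - multOp μ φ (lowPass ℓ N) ψ x‖ ≤ ε := by
  obtain ⟨S, hS⟩ := exists_nat_gt α
  have hS0 : (0 : ℝ) < S := h.alpha_pos.trans hS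
  obtain ⟨C, hC, hloc⟩ := h.exists_lowPass_localization S
  obtain ⟨C', hC', hint⟩ := h.exists_lintegral_locWeight_le hS
  obtain ⟨B, hB⟩ := (isCompact_univ (X := X)).exists_bound_of_continuousOn hψ.continuousOn
  have hψu := CompactSpace.uniformContinuous_of_continuous hψ
  set η := ε / (2 * (C * C')) with hη
  have hη0 : 0 < η := by positivity
  obtain ⟨δ, hδ, hδψ⟩ := Metric.uniformContinuous_iff.1 hψu η hη0
  have hB' : ∀ x y, ‖ψ y - ψ x‖ ≤ 2 * |B| := fun x y => by
    have h1 := norm_sub_le (ψ y) (ψ x)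
    have h2 := (hB x (Set.mem_univ x)).trans (le_abs_self B)
    have h3 := (hB y (Set.mem_univ y)).trans (le_abs_self B)
    linarith
  -- far from the diagonal the kernel is uniformly small since `S > α`
  have hlim : Tendsto (fun N : ℝ => C * (2 * |B| * δ ^ (-(S : ℝ))) * N ^ (-(S - α))) atTop
      (𝓝 (C * (2 * |B| * δ ^ (-(S : ℝ))) * 0)) :=
    (tendsto_rpow_neg_atTop (by linarith)).const_mul _
  rw [mul_zero] at hlim
  obtain ⟨N, hN1, hN⟩ := ((eventually_ge_atTop (1 : ℝ)).and
    (hlim.eventually (eventually_le_nhds (by positivity : 0 < ε / 2)))).exists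
  have hN0 : 0 < N := by linarith
  refine ⟨N, hN1, fun x => ?_⟩
  have hb := bandLimited_lowPass (ℓ := ℓ) hN0
  have hψi : Integrable ψ μ := hψ.integrable_of_hasCompactSupport
    (HasCompactSupport.of_compactSpace _)
  have hkc : Continuous fun y => (multKernel φ (lowPass ℓ N) x y : ℂ) :=
    Complex.continuous_ofReal.comp (h.continuous_multKernel hb x)
  have h1 : ∫ y, (multKernel φ (lowPass ℓ N) x y : ℂ) ∂μ = 1 := by
    rw [integral_complex_ofReal, h.integral_multKernel hb (by positivity),
      lowPass_eq_one hN0 (h.ell_nonneg 0) (by rw [h.ell_zero]; linarith)]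
    rfl
  have h2 : multOp μ φ (lowPass ℓ N) ψ x - ψ x =
      ∫ y, (multKernel φ (lowPass ℓ N) x y : ℂ) * (ψ y - ψ x) ∂μ := by
    simp only [mul_sub]
    rw [integral_sub, h.multOp_eq_integral hb hψi, integral_mul_const, h1, one_mul]
    · exact (hkc.mul hψ).integrable_of_hasCompactSupport (HasCompactSupport.of_compactSpace _)
    · exact (hkc.mul continuous_const).integrable_of_hasCompactSupport
        (HasCompactSupport.of_compactSpace _)
  rw [norm_sub_rev, h2]
  have hpt : ∀ y, ‖(multKernel φ (lowPass ℓ N) x y : ℂ) * (ψ y - ψ x)‖ ≤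
      C * η * locWeight α S N x y + C * (2 * |B| * δ ^ (-(S : ℝ))) * N ^ (-(S - α)) := by
    intro y
    rw [norm_mul, Complex.norm_real, Real.norm_eq_abs]
    have hk := hloc N hN1 x y
    have hw := locWeight_nonneg α S hN0 x y
    have hc0 : 0 ≤ C * (2 * |B| * δ ^ (-(S : ℝ))) * N ^ (-(S - α)) := by positivity
    rcases lt_or_ge (dist y x) δ with hd | hd
    · have hp := (dist_eq_norm (ψ y) (ψ x) ▸ hδψ hd).le
      have : |multKernel φ (lowPass ℓ N) x y| * ‖ψ y - ψ x‖ ≤ C * locWeight α S N x y * η := by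
        gcongr
      linarith
    · have hfar : locWeight α S N x y ≤ N ^ (-(S - α)) * δ ^ (-(S : ℝ)) := by
        unfold locWeight
        have e1 : N ^ (-((S : ℝ) - α)) * δ ^ (-(S : ℝ)) = N ^ α * (N * δ) ^ (-(S : ℝ)) := by
          rw [Real.mul_rpow hN0.le hδ.le, ← mul_assoc, ← Real.rpow_add hN0]
          congr 2
          ring
        rw [e1]
        refine mul_le_mul_of_nonneg_left ?_ (by positivity)
        refine Real.rpow_le_rpow_of_nonpos (by positivity) ?_ (by linarith)
        rw [dist_comm]
        nlinarith
      have : |multKernel φ (lowPass ℓ N) x y| * ‖ψ y - ψ x‖ ≤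
          C * (N ^ (-(S - α)) * δ ^ (-(S : ℝ))) * (2 * |B|) := by
        refine mul_le_mul (hk.trans ?_) (hB' x y) (norm_nonneg _) (by positivity)
        gcongr
      have : 0 ≤ C * η * locWeight α S N x y := by positivity
      linarith
  have hwc : Continuous fun y => locWeight α S N x y :=
    (continuous_locWeight α S hN0).comp (Continuous.prodMk_right x)
  have hwi : Integrable (fun y => locWeight α S N x y) μ :=
    hwc.integrable_of_hasCompactSupport (HasCompactSupport.of_compactSpace _)
  refine (norm_integral_le_of_norm_le ((hwi.const_mul (C * η)).add (integrable_const _))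
    (ae_of_all _ hpt)).trans ?_
  simp only [Pi.add_apply]
  rw [integral_add (hwi.const_mul _) (integrable_const _), integral_const_mul, integral_const]
  have h3 := integral_locWeight_le hN0 hC'.le x (hint N hN0 x)
  have h4 : C * η * ∫ y, locWeight α S N x y ∂μ ≤ C * η * C' := by gcongr
  have h5 : C * η * C' = ε / 2 := by
    rw [hη]
    field_simp
  simp only [probReal_univ, one_smul]
  linarith

omit [CompactSpace X] [BorelSpace X] [IsProbabilityMeasure μ] in
lemma multOp_congr {f g : X → ℂ} (hfg : ∀ k, coeff μ φ f k = coeff μ φ g k) (H : ℕ → ℝ) :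
    multOp μ φ H f = multOp μ φ H g := by
  funext x
  unfold multOp
  simp only [hfg]

lemma coeff_sub (h : IsHeatSystem μ φ ℓ α) {f g : X → ℂ} (hf : Integrable f μ)
    (hg : Integrable g μ) (k : ℕ) :
    coeff μ φ (fun x => f x - g x) k = coeff μ φ f k - coeff μ φ g k := by
  unfold coeff
  simp only [sub_mul]
  exact integral_sub (h.integrable_mul_phi hf k) (h.integrable_mul_phi hg k)

lemma coeff_add (h : IsHeatSystem μ φ ℓ α) {f g : X → ℂ} (hf : Integrable f μ)
    (hg : Integrable g μ) (k : ℕ) :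
    coeff μ φ (fun x => f x + g x) k = coeff μ φ f k + coeff μ φ g k := by
  unfold coeff
  simp only [add_mul]
  exact integral_add (h.integrable_mul_phi hf k) (h.integrable_mul_phi hg k)

/-- **Completeness.** An integrable function is determined by its coefficients. -/
theorem ae_eq_of_coeff_eq (h : IsHeatSystem μ φ ℓ α) {f g : X → ℂ} (hf : Integrable f μ)
    (hg : Integrable g μ) (hfg : ∀ k, coeff μ φ f k = coeff μ φ g k) : f =ᵐ[μ] g := by
  set d : X → ℂ := fun x => f x - g x with hd
  have hdi : Integrable d μ := hf.sub hg
  have hd0 : ∀ k, coeff μ φ d k = 0 := fun k => by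
    rw [h.coeff_sub hf hg, hfg, sub_self]
  obtain ⟨S, hS⟩ := exists_nat_gt α
  obtain ⟨C, hC, hloc⟩ := h.exists_lowPass_localization S
  obtain ⟨C', hC', hop⟩ := h.exists_eLpNorm_multOp_le hS
  -- take a continuous `ψ` close to `d` in `L¹`: its low-pass part is close to `ψ`, and small
  -- because the low-pass part of `d` vanishes
  have key : ∀ ε : ℝ, 0 < ε → eLpNorm d 1 μ ≤ ENNReal.ofReal (2 * ε + C * C' * ε) := by
    intro ε hε
    obtain ⟨ψ, hψ, -⟩ := (memLp_one_iff_integrable.2 hdi).exists_boundedContinuous_eLpNorm_sub_le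
      ENNReal.one_ne_top (ε := ENNReal.ofReal ε) (by simpa using hε)
    have hψi : Integrable ψ μ := ψ.continuous.integrable_of_hasCompactSupport
      (HasCompactSupport.of_compactSpace _)
    obtain ⟨N, hN, hNψ⟩ := h.exists_norm_lowPass_sub_le ψ.continuous hε
    have hN0 : 0 < N := by linarith
    have hb := bandLimited_lowPass (ℓ := ℓ) hN0
    have hsub : multOp μ φ (lowPass ℓ N) ψ = multOp μ φ (lowPass ℓ N) (fun x => ψ x - d x) :=
      multOp_congr (fun k => by rw [h.coeff_sub hψi hdi, hd0, sub_zero]) _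
    have h1 : eLpNorm (fun x => ψ x - multOp μ φ (lowPass ℓ N) ψ x) 1 μ ≤ ENNReal.ofReal ε := by
      have := eLpNorm_le_of_ae_bound (p := 1) (μ := μ) (ae_of_all μ hNψ)
      simpa using this
    have h2 : eLpNorm (fun x => ψ x - d x) 1 μ ≤ ENNReal.ofReal ε := by
      rw [← eLpNorm_neg]
      refine le_trans (le_of_eq (congrArg (eLpNorm · 1 μ) ?_)) hψ
      funext x
      simp
    have h3 : eLpNorm (multOp μ φ (lowPass ℓ N) ψ) 1 μ ≤ ENNReal.ofReal (C * C' * ε) := by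
      rw [hsub, ENNReal.ofReal_mul (by positivity)]
      exact (hop 1 le_rfl _ _ C N hb hN0 hC.le (hloc N hN) _ (hψi.sub hdi)).trans
        (mul_le_mul_right h2 _)
    have hVc : Continuous (multOp μ φ (lowPass ℓ N) ψ) := by
      rw [h.multOp_eq_sum hb]
      have := h.continuous_phi_ofReal
      fun_prop
    have e : d = fun x => ((ψ x - multOp μ φ (lowPass ℓ N) ψ x) + multOp μ φ (lowPass ℓ N) ψ x) -
        (ψ x - d x) := by
      funext x
      ring
    have hm := (ψ.continuous.sub hVc).aestronglyMeasurable (μ := μ)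
    rw [e]
    refine (eLpNorm_sub_le (hm.add hVc.aestronglyMeasurable)
      (hψi.sub hdi).aestronglyMeasurable le_rfl).trans ?_
    refine (add_le_add ((eLpNorm_add_le hm hVc.aestronglyMeasurable le_rfl).trans
      (add_le_add h1 h3)) h2).trans (le_of_eq ?_)
    rw [← ENNReal.ofReal_add (by positivity) (by positivity),
      ← ENNReal.ofReal_add (by positivity) (by positivity)]
    congr 1
    ring
  have h0 : eLpNorm d 1 μ = 0 := by
    refine le_antisymm (ENNReal.le_of_forall_pos_le_add fun ε hε _ => ?_) bot_le
    have := key (ε / (2 + C * C')) (by positivity)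
    have e : 2 * ((ε : ℝ) / (2 + C * C')) + C * C' * (ε / (2 + C * C')) = ε := by
      field_simp
    rw [e, ENNReal.ofReal_coe_nnreal] at this
    simpa using this
  have := (eLpNorm_eq_zero_iff hdi.aestronglyMeasurable one_ne_zero).1 h0
  filter_upwards [this] with x hx
  exact sub_eq_zero.1 hx

end IsHeatSystem

/-! ### Series of diffusion polynomials -/

omit [MetricSpace X] [MeasurableSpace X] in
lemma diffusionPoly_mono {L L' : ℝ} (hL : L ≤ L') :
    diffusionPoly φ ℓ L ≤ diffusionPoly φ ℓ L' :=
  Submodule.span_mono fun _ ⟨j, hj, e⟩ => ⟨j, hj.trans hL, e⟩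

lemma mem_closureLp_of_ae_eq {p : ℝ≥0∞} {f g : X → ℂ} (hfg : f =ᵐ[μ] g)
    (hf : f ∈ closureLp μ φ ℓ p) : g ∈ closureLp μ φ ℓ p := by
  refine ⟨hf.1.ae_eq hfg, ?_⟩
  rw [← hf.2]
  unfold distLp
  refine iInf_congr fun P => iInf_congr fun _ => ?_
  exact eLpNorm_congr_ae (hfg.symm.sub (ae_eq_refl P))

namespace IsHeatSystem

lemma continuous_of_mem_diffusionPoly (h : IsHeatSystem μ φ ℓ α) {L : ℝ} {P : X → ℂ}
    (hP : P ∈ diffusionPoly φ ℓ L) : Continuous P := by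
  unfold diffusionPoly at hP
  induction hP using Submodule.span_induction with
  | mem x hx =>
    obtain ⟨j, -, rfl⟩ := hx
    exact h.continuous_phi_ofReal j
  | zero => exact continuous_const
  | add x y _ _ hx hy => exact hx.add hy
  | smul a x _ hx => exact hx.const_smul a

variable [CompactSpace X] [BorelSpace X] [IsProbabilityMeasure μ]

omit [IsProbabilityMeasure μ] in
lemma memLp_of_mem_diffusionPoly [IsFiniteMeasure μ] (h : IsHeatSystem μ φ ℓ α) {L : ℝ}
    {P : X → ℂ} (hP : P ∈ diffusionPoly φ ℓ L) (p : ℝ≥0∞) : MemLp P p μ := by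
  have hc := h.continuous_of_mem_diffusionPoly hP
  obtain ⟨C, hC⟩ := (isCompact_univ (X := X)).exists_bound_of_continuousOn hc.continuousOn
  exact MemLp.of_bound hc.aestronglyMeasurable C (ae_of_all _ fun x => hC x (Set.mem_univ x))

lemma add_mem_closureLp (h : IsHeatSystem μ φ ℓ α) {p : ℝ≥0∞} {L : ℝ} {f P : X → ℂ}
    (hf : f ∈ closureLp μ φ ℓ p) (hP : P ∈ diffusionPoly φ ℓ L) :
    (fun x => f x + P x) ∈ closureLp μ φ ℓ p := by
  refine ⟨hf.1.add (h.memLp_of_mem_diffusionPoly hP p), ?_⟩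
  rw [← le_zero_iff, ← hf.2]
  unfold distLp
  refine le_iInf₂ fun Q hQ => ?_
  obtain ⟨L', hL'⟩ := Set.mem_iUnion.1 hQ
  have hmem : Q + P ∈ ⋃ L : ℝ, (diffusionPoly φ ℓ L : Set (X → ℂ)) :=
    Set.mem_iUnion.2 ⟨max L L', Submodule.add_mem _ (diffusionPoly_mono (le_max_right _ _) hL')
      (diffusionPoly_mono (le_max_left _ _) hP)⟩
  refine (iInf₂_le (Q + P) hmem).trans (le_of_eq ?_)
  congr 1
  funext x
  simp

lemma exists_norm_coeff_le (h : IsHeatSystem μ φ ℓ α) {p : ℝ≥0∞} (hp : 1 ≤ p) (j : ℕ) :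
    ∃ C, ∀ f, MemLp f p μ → ‖coeff μ φ f j‖ ≤ C * (eLpNorm f p μ).toReal := by
  obtain ⟨C, hC⟩ := h.exists_phi_bound j
  refine ⟨|C|, fun f hf => ?_⟩
  have hfi : Integrable f μ := hf.integrable hp
  have h1 : ‖coeff μ φ f j‖ ≤ ∫ x, |C| * ‖f x‖ ∂μ := by
    refine norm_integral_le_of_norm_le (hfi.norm.const_mul _) (ae_of_all _ fun x => ?_)
    rw [norm_mul, mul_comm]
    exact mul_le_mul_of_nonneg_right ((hC x).trans (le_abs_self C)) (norm_nonneg _)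
  rw [integral_const_mul] at h1
  refine h1.trans (mul_le_mul_of_nonneg_left ?_ (abs_nonneg C))
  rw [integral_norm_eq_lintegral_enorm hfi.aestronglyMeasurable, ← eLpNorm_one_eq_lintegral_enorm]
  exact ENNReal.toReal_mono hf.eLpNorm_ne_top
    (eLpNorm_le_eLpNorm_of_exponent_le hp hf.aestronglyMeasurable)

/-- The coefficient functional on `L^p`. -/
noncomputable def coeffCLM (h : IsHeatSystem μ φ ℓ α) (p : ℝ≥0∞) [hp : Fact (1 ≤ p)] (j : ℕ) :
    Lp ℂ p μ →L[ℂ] ℂ :=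
  LinearMap.mkContinuous
    { toFun := fun f => coeff μ φ f j
      map_add' := fun f g => by
        have hi : ∀ f : Lp ℂ p μ, Integrable f μ := fun f => (Lp.memLp f).integrable hp.out
        rw [← h.coeff_add (hi f) (hi g)]
        unfold coeff
        refine integral_congr_ae ?_
        filter_upwards [Lp.coeFn_add f g] with x hx
        rw [hx, Pi.add_apply]
      map_smul' := fun a f => by
        unfold coeff
        rw [RingHom.id_apply, smul_eq_mul, ← integral_const_mul]
        refine integral_congr_ae ?_
        filter_upwards [Lp.coeFn_smul a f] with x hx
        rw [hx, Pi.smul_apply, smul_eq_mul, mul_assoc] }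
    (h.exists_norm_coeff_le hp.out j).choose
    fun f => by
      rw [Lp.norm_def]
      exact (h.exists_norm_coeff_le hp.out j).choose_spec f (Lp.memLp f)

/-- An `L^p`-summable series of diffusion polynomials converges to an element of `X^p`, and its
coefficients are the sums of the coefficients. -/
theorem exists_sum_mem_closureLp (h : IsHeatSystem μ φ ℓ α) {p : ℝ≥0∞} (hp : 1 ≤ p)
    {P : ℕ → X → ℂ} (hP : ∀ k, ∃ L, P k ∈ diffusionPoly φ ℓ L) {B : ℝ≥0∞}
    (hB : ∑' k, eLpNorm (P k) p μ ≤ B) (hBt : B ≠ ⊤) :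
    ∃ g ∈ closureLp μ φ ℓ p, eLpNorm g p μ ≤ B ∧
      ∀ j, HasSum (fun k => coeff μ φ (P k) j) (coeff μ φ g j) := by
  have : Fact (1 ≤ p) := ⟨hp⟩
  choose L hL using hP
  have hm : ∀ k, MemLp (P k) p μ := fun k => h.memLp_of_mem_diffusionPoly (hL k) p
  set F : ℕ → Lp ℂ p μ := fun k => (hm k).toLp (P k) with hF
  have hne : ∀ k, ‖F k‖ₑ = eLpNorm (P k) p μ := fun k => Lp.enorm_toLp (hm k)
  have htop : ∑' k, eLpNorm (P k) p μ ≠ ⊤ := ne_top_of_le_ne_top hBt hB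
  have hsn : Summable fun k => ‖F k‖ := by
    have := ENNReal.summable_toReal htop
    refine this.congr fun k => ?_
    rw [← hne k, toReal_enorm]
  have hs : Summable F := hsn.of_norm
  set G : Lp ℂ p μ := ∑' k, F k with hG
  have hHS : HasSum F G := hs.hasSum
  refine ⟨G, ⟨Lp.memLp G, ?_⟩, ?_, fun j => ?_⟩
  · have hlim : Tendsto (fun n => ‖G - ∑ k ∈ Finset.range n, F k‖ₑ) atTop (𝓝 0) := by
      have h1 := hHS.tendsto_sum_nat
      have h2 : Tendsto (fun n => G - ∑ k ∈ Finset.range n, F k) atTop (𝓝 (G - G)) :=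
        tendsto_const_nhds.sub h1
      rw [sub_self] at h2
      have h3 := (continuous_enorm.tendsto (0 : Lp ℂ p μ)).comp h2
      rw [enorm_zero] at h3
      exact h3
    refine le_antisymm (ge_of_tendsto' hlim fun n => ?_) bot_le
    have hmem : (∑ k ∈ Finset.range n, P k) ∈ ⋃ L : ℝ, (diffusionPoly φ ℓ L : Set (X → ℂ)) := by
      refine Set.mem_iUnion.2 ⟨∑ k ∈ Finset.range n, |L k|, Submodule.sum_mem _ fun k hk => ?_⟩
      refine diffusionPoly_mono ((le_abs_self (L k)).trans ?_) (hL k)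
      exact Finset.single_le_sum (f := fun k => |L k|) (fun i _ => abs_nonneg _) hk
    unfold distLp
    refine (iInf₂_le _ hmem).trans (le_of_eq ?_)
    rw [Lp.enorm_def]
    refine eLpNorm_congr_ae ?_
    have hsum : ∀ n : ℕ, (∑ k ∈ Finset.range n, F k : Lp ℂ p μ) =ᵐ[μ] ∑ k ∈ Finset.range n, P k := by
      intro n
      induction n with
      | zero => simpa using Lp.coeFn_zero ℂ p μ
      | succ n ih =>
        rw [Finset.sum_range_succ, Finset.sum_range_succ]
        exact (Lp.coeFn_add _ _).trans (ih.add (hm n).coeFn_toLp)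
    exact ((Lp.coeFn_sub _ _).trans ((ae_eq_refl _).sub (hsum n))).symm
  · rw [← Lp.enorm_def]
    refine le_trans ?_ hB
    simp only [← hne]
    exact enorm_tsum_le_tsum_enorm
  · have h1 := (h.coeffCLM p j).hasSum hHS
    have e : ∀ f : Lp ℂ p μ, h.coeffCLM p j f = coeff μ φ f j := fun _ => rfl
    simp only [e] at h1
    refine h1.congr_fun fun k => ?_
    unfold coeff
    refine integral_congr_ae ?_
    filter_upwards [(hm k).coeFn_toLp] with x hx
    rw [hx]

end IsHeatSystem

/-! ### Dyadic band-pass multipliers -/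

/-- The dyadic band-pass multiplier, a difference of consecutive low-pass multipliers. -/
noncomputable def bandPass (ℓ : ℕ → ℝ) (k j : ℕ) : ℝ :=
  lowPass ℓ (2 ^ (k + 1)) j - lowPass ℓ (2 ^ k) j

/-- Band-pass multipliers do not see the frequency `0`, where `F (log ℓ)` is meaningless. -/
lemma bandPass_eq_zero {k j : ℕ} (h0 : ℓ j = 0) : bandPass ℓ k j = 0 := by
  unfold bandPass
  rw [lowPass_eq_one (by positivity) h0.ge (by rw [h0]; simp),
    lowPass_eq_one (by positivity) h0.ge (by rw [h0]; simp), sub_self]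

lemma bandLimited_bandPass (k : ℕ) (H : ℕ → ℝ) :
    BandLimited ℓ (2 * 2 ^ (k + 1)) fun j => bandPass ℓ k j * H j := by
  intro j hj
  have h1 : lowPass ℓ (2 ^ (k + 1)) j = 0 := bandLimited_lowPass (by positivity) j hj
  have h2 : lowPass ℓ (2 ^ k) j = 0 := bandLimited_lowPass (by positivity) j (by
    refine lt_of_le_of_lt ?_ hj
    gcongr
    · norm_num
    · omega)
  simp [bandPass, h1, h2]

lemma BandLimited.mul_right {L : ℝ} {H : ℕ → ℝ} (hH : BandLimited ℓ L H) (H' : ℕ → ℝ) :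
    BandLimited ℓ L fun j => H j * H' j := fun j hj => by simp [hH j hj]

lemma hasSum_bandPass {j : ℕ} (h0 : 0 ≤ ℓ j) (k₀ : ℕ) (c : ℂ) :
    HasSum (fun i => ((bandPass ℓ (k₀ + i) j : ℝ) : ℂ) * c)
      (((1 - lowPass ℓ (2 ^ k₀) j : ℝ) : ℂ) * c) := by
  refine HasSum.mul_right c ?_
  obtain ⟨n, hn⟩ := pow_unbounded_of_one_lt (2 * ℓ j) (one_lt_two (α := ℝ))
  have hone : ∀ k, n ≤ k → lowPass ℓ (2 ^ k) j = 1 := fun k hk =>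
    lowPass_eq_one (by positivity) h0 (hn.le.trans (pow_le_pow_right₀ one_le_two hk))
  have h1 : HasSum (fun i => ((bandPass ℓ (k₀ + i) j : ℝ) : ℂ))
      (∑ i ∈ Finset.range n, ((bandPass ℓ (k₀ + i) j : ℝ) : ℂ)) := by
    refine hasSum_sum_of_ne_finset_zero fun i hi => ?_
    have := Finset.mem_range.not.1 hi
    unfold bandPass
    rw [hone _ (by omega), hone _ (by omega)]
    simp
  have h2 := Finset.sum_range_sub (fun i => lowPass ℓ (2 ^ (k₀ + i)) j) n
  simp only [add_zero] at h2
  rw [hone _ (by omega)] at h2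
  rw [← h2, Complex.ofReal_sum]
  exact h1

namespace IsHeatSystem

lemma multKernel_const_mul (c : ℝ) (H : ℕ → ℝ) (x y : X) :
    multKernel φ (fun j => c * H j) x y = c * multKernel φ H x y := by
  unfold multKernel
  rw [← tsum_mul_left]
  exact tsum_congr fun j => by ring

/-- Localization of the kernels of `t(u_j) (1 + ℓ_j)^e F(log ℓ_j)`, for a cutoff `t` to a band of
frequencies comparable to `N`. -/
theorem exists_band_localization [CompactSpace X] (h : IsHeatSystem μ φ ℓ α) {S : ℕ} {F : ℝ → ℝ}
    (hF : ContDiff ℝ S F) {c : ℝ} (hFc : ∀ k ≤ S, ∀ x, |iteratedDeriv k F x| ≤ c) (e : ℝ) {δ : ℝ}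
    (hδ : 0 < δ) (hδ2 : δ < 1 / 2) {t : ℝ → ℝ} (ht : ContDiff ℝ ∞ t)
    (ht0 : ∀ u ∈ Set.Icc (0 : ℝ) 1, u ∉ Set.Icc δ (1 - δ) → t u = 0) :
    ∃ C > 0, ∀ N : ℝ, 1 ≤ N → ∀ x y,
      |multKernel φ (fun j => t (heatMult ℓ N j) * ((1 + ℓ j) ^ e * F (Real.log (ℓ j)))) x y| ≤
        C * N ^ e * locWeight α S N x y := by
  obtain ⟨C, hC, hloc⟩ := h.exists_localization S
  obtain ⟨M, hM⟩ := exists_rescaled_multiplier S hF hFc e hδ hδ2 ht ht0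
  have hM0 : 0 ≤ M := by
    obtain ⟨g, -, hg, -⟩ := hM 1 le_rfl
    exact (abs_nonneg _).trans (hg 0)
  refine ⟨C * M + 1, by positivity, fun N hN x y => ?_⟩
  obtain ⟨g, hg1, hg2, hg3, hge⟩ := hM N hN
  have hN0 : 0 < N := by linarith
  have e1 : (fun j => t (heatMult ℓ N j) * ((1 + ℓ j) ^ e * F (Real.log (ℓ j)))) =
      fun j => N ^ e * (heatMult ℓ N j * g (heatMult ℓ N j)) :=
    funext fun j => hge (ℓ j) (h.ell_nonneg j)
  rw [e1, multKernel_const_mul, abs_mul, abs_of_pos (by positivity : 0 < N ^ e)]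
  have h1 := hloc g M hg1 hg2 hg3 N hN x y
  have h2 := locWeight_nonneg α S hN0 x y
  have h3 : 0 ≤ N ^ e * locWeight α S N x y := by positivity
  calc _ ≤ N ^ e * (C * M * N ^ α * (1 + N * dist x y) ^ (-(S : ℝ))) := by gcongr
    _ = C * M * (N ^ e * locWeight α S N x y) := by
        unfold locWeight
        ring
    _ ≤ (C * M + 1) * (N ^ e * locWeight α S N x y) := by linarith
    _ = _ := by ring

lemma exists_bandPass_localization [CompactSpace X] (h : IsHeatSystem μ φ ℓ α) {S : ℕ} {F : ℝ → ℝ}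
    (hF : ContDiff ℝ S F) {c : ℝ} (hFc : ∀ k ≤ S, ∀ x, |iteratedDeriv k F x| ≤ c) (e : ℝ) :
    ∃ C > 0, ∀ k : ℕ, ∀ x y,
      |multKernel φ (fun j => bandPass ℓ k j * ((1 + ℓ j) ^ e * F (Real.log (ℓ j)))) x y| ≤
        C * ((2 : ℝ) ^ (k + 1)) ^ e * locWeight α S (2 ^ (k + 1)) x y := by
  -- passing from scale `N` to `N / 2` raises the heat multiplier to the fourth power, and
  -- `(1 - 3/20)^4 ≥ 1/2`
  have ht : ContDiff ℝ ∞ fun u : ℝ => cutoff u - cutoff (u ^ 4) :=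
    cutoff.contDiff.sub (cutoff.contDiff.comp (contDiff_id.pow 4))
  obtain ⟨C, hC, hloc⟩ := h.exists_band_localization hF hFc e (δ := 3 / 20) (by norm_num)
    (by norm_num) ht (fun u hu hδ => by
      have hδ' : u < 3 / 20 ∨ 1 - 3 / 20 < u := by
        by_contra hcon
        push Not at hcon
        exact hδ hcon
      rcases hδ' with h1 | h1
      · have h4 : u ^ 4 ≤ u := pow_le_of_le_one hu.1 hu.2 (by norm_num)
        rw [cutoff_eq_zero (by linarith), cutoff_eq_zero (by linarith), sub_self]
      · have h4 : (1 - 3 / 20 : ℝ) ^ 4 ≤ u ^ 4 := pow_le_pow_left₀ (by norm_num) h1.le 4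
        rw [cutoff_eq_one (by linarith) hu.2,
          cutoff_eq_one (le_trans (by norm_num) h4) (pow_le_one₀ hu.1 hu.2), sub_self])
  refine ⟨C, hC, fun k x y => ?_⟩
  have h1 := hloc (2 ^ (k + 1)) (one_le_pow₀ one_le_two) x y
  have e1 : ∀ j, cutoff (heatMult ℓ (2 ^ (k + 1)) j) - cutoff (heatMult ℓ (2 ^ (k + 1)) j ^ 4) =
      bandPass ℓ k j := by
    intro j
    have : heatMult ℓ (2 ^ (k + 1)) j ^ 4 = heatMult ℓ (2 ^ k) j := by
      unfold heatMult
      rw [← Real.exp_nat_mul]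
      congr 1
      rw [show (2 : ℝ) ^ (k + 1) = 2 ^ k * 2 from pow_succ _ _]
      push_cast
      field_simp
      ring
    rw [this]
    rfl
  simpa only [e1] using h1

variable [CompactSpace X] [BorelSpace X] [IsProbabilityMeasure μ]

/-- The operators `bandPass · (1 + ℓ)^e` have `L^p` norm of order `2^(k e)`. -/
lemma exists_eLpNorm_bandPass_le (h : IsHeatSystem μ φ ℓ α) (e : ℝ) :
    ∃ C > 0, ∀ p : ℝ≥0∞, 1 ≤ p → ∀ (k : ℕ) (f : X → ℂ), Integrable f μ →
      eLpNorm (multOp μ φ (fun j => bandPass ℓ k j * (1 + ℓ j) ^ e) f) p μ ≤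
        ENNReal.ofReal (C * ((2 : ℝ) ^ e) ^ (k + 1)) * eLpNorm f p μ := by
  obtain ⟨S, hS⟩ := exists_nat_gt α
  have hF1 : ∀ k ≤ S, ∀ x, |iteratedDeriv k (fun _ : ℝ => (1 : ℝ)) x| ≤ 1 := by
    intro k _ x
    rw [iteratedDeriv_const]
    split_ifs <;> simp
  obtain ⟨C, hC, hloc⟩ := h.exists_bandPass_localization (S := S) contDiff_const hF1 e
  obtain ⟨C', hC', hop⟩ := h.exists_eLpNorm_multOp_le hS
  refine ⟨C * C', by positivity, fun p hp k f hf => ?_⟩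
  have h1 := hop p hp _ _ (C * ((2 : ℝ) ^ (k + 1)) ^ e) (2 ^ (k + 1))
    (bandLimited_bandPass k fun j => (1 + ℓ j) ^ e) (by positivity) (by positivity)
    (fun x y => by simpa using hloc k x y) f hf
  refine h1.trans (le_of_eq ?_)
  have e1 : ((2 : ℝ) ^ (k + 1)) ^ e = ((2 : ℝ) ^ e) ^ (k + 1) := by
    rw [← Real.rpow_natCast, ← Real.rpow_natCast, ← Real.rpow_mul (by norm_num),
      ← Real.rpow_mul (by norm_num), mul_comm]
  rw [e1]
  congr 2
  ring

/-- Every band-limited multiplier is bounded on all `L^p`. -/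
lemma exists_eLpNorm_bandLimited_le (h : IsHeatSystem μ φ ℓ α) {L : ℝ} {H : ℕ → ℝ}
    (hH : BandLimited ℓ L H) : ∃ C > 0, ∀ p : ℝ≥0∞, 1 ≤ p → ∀ f : X → ℂ, Integrable f μ →
      eLpNorm (multOp μ φ H f) p μ ≤ ENNReal.ofReal C * eLpNorm f p μ := by
  obtain ⟨C', hC', hop⟩ := h.exists_eLpNorm_multOp_le (σ := α + 1) (by linarith)
  obtain ⟨M, hM⟩ : ∃ M : ℝ, ∀ x y, |multKernel φ H x y| ≤ M := by
    have hc : Continuous fun z : X × X => multKernel φ H z.1 z.2 := by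
      have e : (fun z : X × X => multKernel φ H z.1 z.2) =
          fun z => ∑ j ∈ h.band L, H j * φ j z.1 * φ j z.2 :=
        funext fun z => h.multKernel_eq_sum hH z.1 z.2
      rw [e]
      have := h.continuous_phi
      fun_prop
    obtain ⟨M, hM⟩ := (isCompact_univ (X := X × X)).exists_bound_of_continuousOn hc.continuousOn
    exact ⟨M, fun x y => hM (x, y) (Set.mem_univ _)⟩
  obtain ⟨R, hR⟩ := Metric.isBounded_iff.1 (isCompact_univ (X := X)).isBounded
  have hR' : ∀ x y : X, dist x y ≤ |R| := fun x y =>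
    (hR (Set.mem_univ x) (Set.mem_univ y)).trans (le_abs_self R)
  refine ⟨(|M| * (1 + |R|) ^ (α + 1) + 1) * C', by positivity, fun p hp f hf => ?_⟩
  refine hop p hp L H _ 1 hH one_pos (by positivity) (fun x y => ?_) f hf
  unfold locWeight
  rw [Real.one_rpow, one_mul, one_mul]
  have h1 : (1 + |R|) ^ (-(α + 1)) ≤ (1 + dist x y) ^ (-(α + 1)) :=
    Real.rpow_le_rpow_of_nonpos (by positivity) (by linarith [hR' x y])
      (by linarith [h.alpha_pos])
  have h2 : (0 : ℝ) < (1 + dist x y) ^ (-(α + 1)) := by positivity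
  calc |multKernel φ H x y| ≤ |M| := (hM x y).trans (le_abs_self M)
    _ = |M| * (1 + |R|) ^ (α + 1) * (1 + |R|) ^ (-(α + 1)) := by
        rw [Real.rpow_neg (by positivity), mul_assoc, mul_inv_cancel₀ (by positivity), mul_one]
    _ ≤ |M| * (1 + |R|) ^ (α + 1) * (1 + dist x y) ^ (-(α + 1)) := by gcongr
    _ ≤ _ := by nlinarith

/-- A **Bernstein inequality**: the low-pass part of `(Δ*)^e f` is controlled by `N^e ‖f‖`. -/
lemma exists_eLpNorm_lowPass_le (h : IsHeatSystem μ φ ℓ α) {e : ℝ} (he : 0 < e) :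
    ∃ C > 0, ∀ p : ℝ≥0∞, 1 ≤ p → ∀ (k : ℕ) (f : X → ℂ), Integrable f μ →
      eLpNorm (multOp μ φ (fun j => lowPass ℓ (2 ^ k) j * (1 + ℓ j) ^ e) f) p μ ≤
        ENNReal.ofReal (C * ((2 : ℝ) ^ e) ^ k) * eLpNorm f p μ := by
  obtain ⟨C₁, hC₁, hb⟩ := h.exists_eLpNorm_bandPass_le e
  have hlow : ∀ k : ℕ, BandLimited ℓ (2 * 2 ^ k) fun j => lowPass ℓ (2 ^ k) j * (1 + ℓ j) ^ e :=
    fun k => (bandLimited_lowPass (by positivity)).mul_right _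
  obtain ⟨C₀, hC₀, h0⟩ := h.exists_eLpNorm_bandLimited_le (hlow 0)
  have hq : (1 : ℝ) < 2 ^ e := Real.one_lt_rpow one_lt_two he
  set q : ℝ := 2 ^ e
  -- room for the geometric sum over the bands, which is dominated by the last one as `e > 0`
  set D : ℝ := C₀ + C₁ * q / (q - 1) with hD
  have hq1 : 0 < q - 1 := by linarith
  refine ⟨D, by positivity, fun p hp k f hf => ?_⟩
  induction k with
  | zero =>
    refine (h0 p hp f hf).trans (mul_le_mul_left (ENNReal.ofReal_le_ofReal ?_) _)
    have : 0 ≤ C₁ * q / (q - 1) := by positivity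
    rw [pow_zero, mul_one]
    linarith
  | succ k ih =>
    have e1 : multOp μ φ (fun j => lowPass ℓ (2 ^ (k + 1)) j * (1 + ℓ j) ^ e) f =
        multOp μ φ (fun j => lowPass ℓ (2 ^ k) j * (1 + ℓ j) ^ e) f +
        multOp μ φ (fun j => bandPass ℓ k j * (1 + ℓ j) ^ e) f := by
      have hk : BandLimited ℓ (2 * 2 ^ (k + 1)) fun j => lowPass ℓ (2 ^ k) j * (1 + ℓ j) ^ e :=
        fun j hj => hlow k j (lt_of_le_of_lt (by gcongr <;> norm_num) hj)
      rw [h.multOp_eq_sum (hlow (k + 1)), h.multOp_eq_sum hk,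
        h.multOp_eq_sum (bandLimited_bandPass k _)]
      funext x
      rw [Pi.add_apply, ← Finset.sum_add_distrib]
      refine Finset.sum_congr rfl fun j _ => ?_
      unfold bandPass
      push_cast
      ring
    have hcont : ∀ (L : ℝ) (H : ℕ → ℝ), BandLimited ℓ L H →
        AEStronglyMeasurable (multOp μ φ H f) μ := fun L H hH =>
      (h.memLp_of_mem_diffusionPoly (h.multOp_mem_diffusionPoly hH f) 1).aestronglyMeasurable
    rw [e1]
    refine (eLpNorm_add_le (hcont _ _ (hlow k)) (hcont _ _ (bandLimited_bandPass k _)) hp).trans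
      ((add_le_add ih (hb p hp k f hf)).trans ?_)
    rw [← add_mul, ← ENNReal.ofReal_add (by positivity) (by positivity)]
    refine mul_le_mul_left (ENNReal.ofReal_le_ofReal ?_) _
    have e2 : C₁ * q ≤ D * (q - 1) := by
      rw [hD, add_mul, div_mul_cancel₀ _ hq1.ne']
      nlinarith
    have hqk : 0 < q ^ k := by positivity
    rw [pow_succ]
    nlinarith

/-- The part of `(Δ*)^(-s) u` at frequencies above `2^k`, for `s ≥ 0`, lies in `X^p` and has norm
at most of order `2^(-k s)`. -/
theorem exists_highPass (h : IsHeatSystem μ φ ℓ α) {s : ℝ} (hs : 0 ≤ s) :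
    ∃ C > 0, ∀ p : ℝ≥0∞, 1 ≤ p → ∀ (k : ℕ) (u : X → ℂ), u ∈ closureLp μ φ ℓ p →
      ∃ g ∈ closureLp μ φ ℓ p,
        eLpNorm g p μ ≤ ENNReal.ofReal (C * ((2 : ℝ) ^ (-s)) ^ k) * eLpNorm u p μ ∧
        ∀ j, coeff μ φ g j =
          ((1 - lowPass ℓ (2 ^ k) j : ℝ) : ℂ) * (((1 + ℓ j) ^ (-s) : ℝ) * coeff μ φ u j) := by
  rcases hs.eq_or_lt with rfl | hs
  · -- there is no decay to sum over the bands when `s = 0`; use `u` minus its low-pass part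
    obtain ⟨S, hS⟩ := exists_nat_gt α
    obtain ⟨C, hC, hloc⟩ := h.exists_lowPass_localization S
    obtain ⟨C', hC', hop⟩ := h.exists_eLpNorm_multOp_le hS
    refine ⟨1 + C * C', by positivity, fun p hp k u hu => ?_⟩
    have hui : Integrable u μ := hu.1.integrable hp
    have hb : BandLimited ℓ (2 * 2 ^ k) (lowPass ℓ (2 ^ k)) := bandLimited_lowPass (by positivity)
    have hmem := h.multOp_mem_diffusionPoly hb u
    have hm := h.memLp_of_mem_diffusionPoly hmem p
    refine ⟨fun x => u x + (-multOp μ φ (lowPass ℓ (2 ^ k)) u) x,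
      h.add_mem_closureLp hu (Submodule.neg_mem _ hmem), ?_, fun j => ?_⟩
    · refine (eLpNorm_add_le hu.1.aestronglyMeasurable hm.neg.aestronglyMeasurable hp).trans ?_
      rw [eLpNorm_neg]
      have h1 := hop p hp _ _ C (2 ^ k) hb (by positivity) hC.le
        (hloc _ (one_le_pow₀ one_le_two)) u hui
      rw [neg_zero, Real.rpow_zero, one_pow, mul_one, ENNReal.ofReal_add zero_le_one (by positivity),
        add_mul, ENNReal.ofReal_one, one_mul]
      gcongr
    · rw [h.coeff_add hui (hm.neg.integrable hp)]
      have e : coeff μ φ (-multOp μ φ (lowPass ℓ (2 ^ k)) u) j =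
          -coeff μ φ (multOp μ φ (lowPass ℓ (2 ^ k)) u) j := by
        unfold coeff
        simp only [Pi.neg_apply, neg_mul, integral_neg]
      rw [e, h.coeff_multOp hb, neg_zero, Real.rpow_zero]
      push_cast
      ring
  · obtain ⟨C, hC, hb⟩ := h.exists_eLpNorm_bandPass_le (-s)
    have hq0 : (0 : ℝ) < 2 ^ (-s) := by positivity
    have hq1 : (2 : ℝ) ^ (-s) < 1 := Real.rpow_lt_one_of_one_lt_of_neg one_lt_two (by linarith)
    set q : ℝ := 2 ^ (-s)
    refine ⟨C * q * (1 - q)⁻¹, mul_pos (by positivity) (inv_pos.2 (by linarith)),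
      fun p hp k u hu => ?_⟩
    have hui : Integrable u μ := hu.1.integrable hp
    have hsum : HasSum (fun i : ℕ => C * q ^ (k + 1) * q ^ i) (C * q ^ (k + 1) * (1 - q)⁻¹) :=
      (hasSum_geometric_of_lt_one hq0.le hq1).mul_left _
    obtain ⟨g, hg, hgn, hgc⟩ := h.exists_sum_mem_closureLp hp
      (P := fun i => multOp μ φ (fun j => bandPass ℓ (k + i) j * (1 + ℓ j) ^ (-s)) u)
      (B := ENNReal.ofReal (C * q * (1 - q)⁻¹ * q ^ k) * eLpNorm u p μ)
      (fun i => ⟨_, h.multOp_mem_diffusionPoly (bandLimited_bandPass (k + i) _) u⟩)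
      (by
        calc _ ≤ ∑' i : ℕ, ENNReal.ofReal (C * q ^ (k + 1) * q ^ i) * eLpNorm u p μ := by
              refine ENNReal.tsum_le_tsum fun i => (hb p hp (k + i) u hui).trans (le_of_eq ?_)
              congr 2
              ring
          _ = _ := by
              rw [ENNReal.tsum_mul_right, ← ENNReal.ofReal_tsum_of_nonneg
                (fun i => by positivity) hsum.summable, hsum.tsum_eq]
              congr 2
              ring)
      (ENNReal.mul_ne_top ENNReal.ofReal_ne_top hu.1.eLpNorm_ne_top)
    refine ⟨g, hg, hgn, fun j => ?_⟩
    refine (hgc j).unique ?_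
    have h1 := hasSum_bandPass (h.ell_nonneg j) k (((1 + ℓ j) ^ (-s) : ℝ) * coeff μ φ u j)
    refine h1.congr_fun fun i => ?_
    rw [h.coeff_multOp (bandLimited_bandPass (k + i) _)]
    push_cast
    ring

end IsHeatSystem

/-! ### Separated sets of centers -/

/-- Distinct points of `C` have distance at least `q`. -/
def IsSeparatedBy (C : Finset X) (q : ℝ) : Prop := ∀ x ∈ C, ∀ y ∈ C, x ≠ y → q ≤ dist x y

/-- The counting measure of a finite set of centers. -/
noncomputable def centerMeasure (C : Finset X) : Measure X := ∑ y ∈ C, Measure.dirac y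

instance (C : Finset X) : IsFiniteMeasure (centerMeasure C) := by
  unfold centerMeasure
  infer_instance

lemma aestronglyMeasurable_centerMeasure [BorelSpace X] (C : Finset X) (f : X → ℂ) :
    AEStronglyMeasurable f (centerMeasure C) := by
  classical
  unfold centerMeasure
  induction C using Finset.induction_on with
  | empty => simp
  | insert a s ha ih =>
    rw [Finset.sum_insert ha]
    exact aestronglyMeasurable_dirac.add_measure ih

lemma lintegral_centerMeasure [BorelSpace X] (C : Finset X) (f : X → ℝ≥0∞) :
    ∫⁻ y, f y ∂(centerMeasure C) = ∑ y ∈ C, f y := by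
  unfold centerMeasure
  rw [lintegral_finsetSum_measure]
  simp only [lintegral_dirac]

lemma ae_centerMeasure [BorelSpace X] (C : Finset X) {p : X → Prop} (hp : ∀ y ∈ C, p y) :
    ∀ᵐ y ∂(centerMeasure C), p y := by
  have h1 : centerMeasure C (C : Set X)ᶜ = 0 := by
    unfold centerMeasure
    rw [Measure.coe_finsetSum, Finset.sum_apply]
    refine Finset.sum_eq_zero fun y hy => ?_
    rw [Measure.dirac_apply' y C.measurableSet.compl]
    simp [hy]
  refine (measure_mono_null fun y hy => ?_) h1
  intro hmem
  exact hy (hp y hmem)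

lemma eLpNorm_centerMeasure_ne_top [BorelSpace X] (C : Finset X) (f : X → ℂ) (p : ℝ≥0∞) :
    eLpNorm f p (centerMeasure C) ≠ ⊤ := by
  refine (MemLp.of_bound (aestronglyMeasurable_centerMeasure C f) (∑ y ∈ C, ‖f y‖)
    (ae_centerMeasure C fun y hy => ?_)).eLpNorm_ne_top
  exact Finset.single_le_sum (f := fun y => ‖f y‖) (fun _ _ => norm_nonneg _) hy

namespace IsHeatSystem

variable [CompactSpace X] [BorelSpace X] [IsProbabilityMeasure μ]

/-- Balls are not too small: the low-pass kernel at scale `R / s` has integral `1`, is bounded by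
`C (R / s)^α`, and for large `R` has at most half of its mass outside of the ball of radius
`s`. -/
lemma exists_le_measure_closedBall (h : IsHeatSystem μ φ ℓ α) :
    ∃ c > 0, ∀ (x : X) (s : ℝ), 0 < s → s ≤ 1 → c * s ^ α ≤ μ.real (Metric.closedBall x s) := by
  obtain ⟨S, hS⟩ := exists_nat_gt α
  have hα := h.alpha_pos
  set σ : ℝ := (S + α) / 2 with hσ
  have hσα : α < σ := by rw [hσ]; linarith
  have hσS : σ < S := by rw [hσ]; linarith
  obtain ⟨C, hC, hloc⟩ := h.exists_lowPass_localization S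
  obtain ⟨C', hC', hint⟩ := h.exists_lintegral_locWeight_le hσα
  have hlim : Tendsto (fun R : ℝ => C * C' * R ^ (-(S - σ))) atTop (𝓝 (C * C' * 0)) :=
    (tendsto_rpow_neg_atTop (by linarith)).const_mul _
  rw [mul_zero] at hlim
  obtain ⟨R, hR1, hR⟩ := ((eventually_ge_atTop (1 : ℝ)).and
    (hlim.eventually (eventually_le_nhds (by norm_num : (0 : ℝ) < 1 / 2)))).exists
  have hR0 : 0 < R := by linarith
  refine ⟨(2 * C * R ^ α)⁻¹, by positivity, fun x s hs hs1 => ?_⟩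
  set N : ℝ := R / s with hN
  have hN1 : 1 ≤ N := by
    rw [hN, le_div_iff₀ hs]
    linarith
  have hN0 : 0 < N := by linarith
  have hb := bandLimited_lowPass (ℓ := ℓ) hN0
  have h1 : ∫ y, multKernel φ (lowPass ℓ N) x y ∂μ = 1 := by
    rw [h.integral_multKernel hb (by positivity),
      lowPass_eq_one hN0 (h.ell_nonneg 0) (by rw [h.ell_zero]; linarith)]
  have hwi : Integrable (fun y => locWeight α σ N x y) μ :=
    ((continuous_locWeight α σ hN0).comp (Continuous.prodMk_right x)).integrable_of_hasCompactSupport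
      (HasCompactSupport.of_compactSpace _)
  have hmeas : MeasurableSet (Metric.closedBall x s) := Metric.isClosed_closedBall.measurableSet
  have hii : Integrable ((Metric.closedBall x s).indicator fun _ => C * N ^ α) μ :=
    (integrable_const _).indicator hmeas
  have hpt : ∀ y, multKernel φ (lowPass ℓ N) x y ≤
      (Metric.closedBall x s).indicator (fun _ => C * N ^ α) y +
        C * R ^ (-(S - σ)) * locWeight α σ N x y := by
    intro y
    have hk := (le_abs_self _).trans (hloc N hN1 x y)
    have hw := locWeight_nonneg α σ hN0 x y
    have hSpos : (0 : ℝ) ≤ S := Nat.cast_nonneg S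
    by_cases hy : y ∈ Metric.closedBall x s
    · rw [Set.indicator_of_mem hy]
      have h2 := mul_le_mul_of_nonneg_left (locWeight_le α hSpos hN0 x y) hC.le
      have h3 : 0 ≤ C * R ^ (-(S - σ)) * locWeight α σ N x y := by positivity
      linarith
    · rw [Set.indicator_of_notMem hy, zero_add, mul_assoc]
      refine hk.trans (mul_le_mul_of_nonneg_left ?_ hC.le)
      rw [Metric.mem_closedBall, not_le, dist_comm] at hy
      have hge : R ≤ 1 + N * dist x y := by
        have : N * s ≤ N * dist x y := by gcongr
        rw [hN, div_mul_cancel₀ _ hs.ne'] at this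
        linarith
      unfold locWeight
      have e : (1 + N * dist x y) ^ (-(S : ℝ)) =
          (1 + N * dist x y) ^ (-(S - σ)) * (1 + N * dist x y) ^ (-σ) := by
        rw [← Real.rpow_add (by linarith)]
        congr 1
        ring
      rw [e, mul_left_comm]
      refine mul_le_mul_of_nonneg_right ?_ (by positivity)
      exact Real.rpow_le_rpow_of_nonpos hR0 hge (by linarith)
  have h2 := integral_mono ((h.continuous_multKernel hb x).integrable_of_hasCompactSupport
    (HasCompactSupport.of_compactSpace _)) (hii.add (hwi.const_mul _)) hpt
  simp only [Pi.add_apply] at h2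
  rw [h1, integral_add hii (hwi.const_mul _), integral_indicator_const _ hmeas,
    integral_const_mul] at h2
  have h3 := integral_locWeight_le hN0 hC'.le x (hint N hN0 x)
  have h4 : C * R ^ (-(S - σ)) * ∫ y, locWeight α σ N x y ∂μ ≤ 1 / 2 := by
    refine le_trans ?_ hR
    have : C * R ^ (-(S - σ)) * ∫ y, locWeight α σ N x y ∂μ ≤ C * R ^ (-(S - σ)) * C' := by gcongr
    linarith
  rw [smul_eq_mul] at h2
  have h5 : 1 / 2 ≤ μ.real (Metric.closedBall x s) * (C * (R ^ α / s ^ α)) := by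
    rw [← Real.div_rpow hR0.le hs.le, ← hN]
    linarith
  have hsα : 0 < s ^ α := by positivity
  have hRα : 0 < R ^ α := by positivity
  rw [inv_mul_le_iff₀ (by positivity)]
  have h6 := mul_le_mul_of_nonneg_right h5 hsα.le
  have e : μ.real (Metric.closedBall x s) * (C * (R ^ α / s ^ α)) * s ^ α =
      C * R ^ α * μ.real (Metric.closedBall x s) := by field_simp
  rw [e] at h6
  linarith

/-- Packing: a `1/N₁`-separated set has `O((N₁ s)^α)` points in a ball of radius `s ≥ 1/N₁`. -/
lemma exists_centerMeasure_closedBall_le (h : IsHeatSystem μ φ ℓ α) :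
    ∃ A > 0, ∀ (C : Finset X) (N₁ : ℝ), 1 ≤ N₁ → IsSeparatedBy C (1 / N₁) →
      ∀ (x : X) (s : ℝ), 1 / N₁ ≤ s →
        centerMeasure C (Metric.closedBall x s) ≤ ENNReal.ofReal (A * (N₁ * s) ^ α) := by
  classical
  obtain ⟨c, hc, hball⟩ := h.ball_measure
  obtain ⟨c', hc', hlow⟩ := h.exists_le_measure_closedBall
  refine ⟨c / c' * 6 ^ α, by positivity, fun C N₁ hN₁ hsep x s hs => ?_⟩
  have hN0 : 0 < N₁ := by linarith
  have hs0 : 0 < s := (by positivity : 0 < 1 / N₁).trans_le hs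
  set T : Finset X := C.filter fun y => y ∈ Metric.closedBall x s with hT
  have hcard : centerMeasure C (Metric.closedBall x s) = (T.card : ℝ≥0∞) := by
    unfold centerMeasure
    rw [Measure.coe_finsetSum, Finset.sum_apply]
    simp only [Measure.dirac_apply' _ Metric.isClosed_closedBall.measurableSet]
    rw [hT, Finset.card_filter]
    push_cast
    exact Finset.sum_congr rfl fun y _ => by simp [Set.indicator_apply]
  -- the balls of radius `1 / (3 N₁)` around the points are disjoint and lie in `B(x, 2s)`
  set ρ : ℝ := 1 / (3 * N₁) with hρ
  have hρ0 : 0 < ρ := by positivity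
  have hρs : 3 * ρ = 1 / N₁ := by
    rw [hρ]
    field_simp
  have hρ1 : ρ ≤ 1 := by
    have : 1 / N₁ ≤ 1 := (div_le_one hN0).2 hN₁
    linarith
  have hdisj : (T : Set X).PairwiseDisjoint fun y => Metric.closedBall y ρ := by
    intro y hy z hz hyz
    refine Metric.closedBall_disjoint_closedBall ?_
    have := hsep y (Finset.mem_filter.1 hy).1 z (Finset.mem_filter.1 hz).1 hyz
    linarith
  have hsub : (⋃ y ∈ T, Metric.closedBall y ρ) ⊆ Metric.closedBall x (2 * s) := by
    refine Set.iUnion₂_subset fun y hy z hz => ?_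
    have h1 := (Finset.mem_filter.1 hy).2
    rw [Metric.mem_closedBall] at h1 hz ⊢
    linarith [dist_triangle z y x]
  have h1 : (T.card : ℝ) * (c' * ρ ^ α) ≤ c * (2 * s) ^ α := by
    have h2 : μ.real (⋃ y ∈ T, Metric.closedBall y ρ) =
        ∑ y ∈ T, μ.real (Metric.closedBall y ρ) :=
      measureReal_biUnion_finset hdisj fun y _ => Metric.isClosed_closedBall.measurableSet
    have h3 : μ.real (⋃ y ∈ T, Metric.closedBall y ρ) ≤ μ.real (Metric.closedBall x (2 * s)) :=
      measureReal_mono hsub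
    have h4 : μ.real (Metric.closedBall x (2 * s)) ≤ c * (2 * s) ^ α :=
      ENNReal.toReal_le_of_le_ofReal (by positivity) (hball x (2 * s) (by positivity))
    have h5 : (T.card : ℝ) * (c' * ρ ^ α) ≤ ∑ y ∈ T, μ.real (Metric.closedBall y ρ) := by
      rw [← nsmul_eq_mul]
      exact Finset.card_nsmul_le_sum _ _ _ fun y _ => hlow y ρ hρ0 hρ1
    linarith
  rw [hcard, ← ENNReal.ofReal_natCast]
  refine ENNReal.ofReal_le_ofReal ?_
  have h6 : (T.card : ℝ) ≤ c * (2 * s) ^ α / (c' * ρ ^ α) := by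
    rw [le_div_iff₀ (by positivity)]
    exact h1
  refine h6.trans (le_of_eq ?_)
  have h7 : 2 * s = 6 * (N₁ * s) * ρ := by
    rw [hρ]
    field_simp
    norm_num
  rw [h7, Real.mul_rpow (by positivity) hρ0.le, Real.mul_rpow (by norm_num) (by positivity)]
  have : 0 < ρ ^ α := by positivity
  field_simp

/-- The localization weight summed over a separated set. -/
lemma exists_lintegral_centerMeasure_le (h : IsHeatSystem μ φ ℓ α) {σ : ℝ} (hσ : α < σ) :
    ∃ A > 0, ∀ (C : Finset X) (N₁ : ℝ), 1 ≤ N₁ → IsSeparatedBy C (1 / N₁) →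
      ∀ N : ℝ, N₁ ≤ N → ∀ x,
        ∫⁻ y, ENNReal.ofReal (locWeight α σ N x y) ∂(centerMeasure C) ≤
          ENNReal.ofReal (A * N ^ α) := by
  obtain ⟨A, hA, hpack⟩ := h.exists_centerMeasure_closedBall_le
  obtain ⟨C₀, hC₀, hw⟩ := exists_lintegral_weight_le (X := X) hσ (h.alpha_pos.trans hσ)
  refine ⟨C₀ * A, by positivity, fun C N₁ hN₁ hsep N hN x => ?_⟩
  have hN0 : 0 < N := by linarith
  have h1 := hw (centerMeasure C) x N A hN0 hA.le (fun s hs => by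
    have hs0 : 0 < s := (by positivity : 0 < 1 / N).trans_le hs
    have hNs : 1 ≤ N * s := by
      rw [div_le_iff₀ hN0] at hs
      linarith
    rcases le_total (1 / N₁) s with h2 | h2
    · refine (hpack C N₁ hN₁ hsep x s h2).trans (ENNReal.ofReal_le_ofReal ?_)
      have := h.alpha_pos
      gcongr
    · refine (measure_mono (Metric.closedBall_subset_closedBall h2)).trans
        ((hpack C N₁ hN₁ hsep x (1 / N₁) le_rfl).trans (ENNReal.ofReal_le_ofReal ?_))
      rw [mul_one_div_cancel (by linarith), Real.one_rpow]
      gcongr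
      exact Real.one_le_rpow hNs h.alpha_pos.le)
  unfold locWeight
  have hNα : 0 ≤ N ^ α := by positivity
  simp only [ENNReal.ofReal_mul hNα]
  rw [lintegral_const_mul' _ _ ENNReal.ofReal_ne_top]
  refine (mul_le_mul_right h1 _).trans (le_of_eq ?_)
  rw [← ENNReal.ofReal_mul hNα]
  congr 1
  ring

end IsHeatSystem

lemma toReal_inv_mem_Icc {p : ℝ≥0∞} (hp : 1 ≤ p) : (p⁻¹).toReal ∈ Set.Icc (0 : ℝ) 1 := by
  refine ⟨ENNReal.toReal_nonneg, ?_⟩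
  rw [← ENNReal.toReal_one]
  exact ENNReal.toReal_mono ENNReal.one_ne_top (ENNReal.inv_le_one.2 hp)

/-- The Schur constant for a kernel whose row integrals are `A a N^α` and whose column integrals
are `A a'`. -/
lemma ofReal_rpow_mul_ofReal_rpow_le {A a a' N α θ : ℝ} (hA : 0 ≤ A) (ha : 0 < a) (ha' : 0 < a')
    (hN : 0 < N) (hθ : θ ∈ Set.Icc (0 : ℝ) 1) :
    ENNReal.ofReal (A * (a * N ^ α)) ^ θ * ENNReal.ofReal (A * a') ^ (1 - θ) ≤
      ENNReal.ofReal (A * (a + a') * N ^ (α * θ)) := by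
  have h1 : 0 ≤ 1 - θ := by linarith [hθ.2]
  have hm : 0 ≤ A * (a + a') := by positivity
  have e1 : ENNReal.ofReal (A * (a * N ^ α)) ^ θ ≤
      ENNReal.ofReal (A * (a + a')) ^ θ * ENNReal.ofReal (N ^ (α * θ)) := by
    have h2 : A * (a * N ^ α) ≤ A * (a + a') * N ^ α := by
      have : 0 ≤ A * a' * N ^ α := by positivity
      nlinarith
    rw [Real.rpow_mul hN.le, ← ENNReal.ofReal_rpow_of_nonneg (by positivity) hθ.1,
      ← ENNReal.mul_rpow_of_nonneg _ _ hθ.1, ← ENNReal.ofReal_mul hm]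
    exact ENNReal.rpow_le_rpow (ENNReal.ofReal_le_ofReal h2) hθ.1
  have e2 : ENNReal.ofReal (A * a') ^ (1 - θ) ≤ ENNReal.ofReal (A * (a + a')) ^ (1 - θ) := by
    refine ENNReal.rpow_le_rpow (ENNReal.ofReal_le_ofReal ?_) h1
    gcongr
    linarith
  calc _ ≤ ENNReal.ofReal (A * (a + a')) ^ θ * ENNReal.ofReal (N ^ (α * θ)) *
        ENNReal.ofReal (A * (a + a')) ^ (1 - θ) := mul_le_mul' e1 e2
    _ = ENNReal.ofReal (A * (a + a')) ^ θ * ENNReal.ofReal (A * (a + a')) ^ (1 - θ) *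
        ENNReal.ofReal (N ^ (α * θ)) := by ring
    _ = _ := by
        rw [← ENNReal.rpow_add_of_nonneg _ _ hθ.1 h1, add_sub_cancel, ENNReal.rpow_one,
          ← ENNReal.ofReal_mul hm]

namespace IsHeatSystem

variable [CompactSpace X] [BorelSpace X] [IsProbabilityMeasure μ]

/-- Sampling at separated centers: the values of a localized multiplier operator at the centers
have `ℓ^p` norm `O(N^(α/p))`. -/
lemma exists_eLpNorm_centerMeasure_multOp_le (h : IsHeatSystem μ φ ℓ α) {σ : ℝ} (hσ : α < σ) :
    ∃ K > 0, ∀ p : ℝ≥0∞, 1 ≤ p → ∀ (C : Finset X) (N₁ : ℝ), 1 ≤ N₁ → IsSeparatedBy C (1 / N₁) →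
      ∀ (L : ℝ) (H : ℕ → ℝ) (A N : ℝ), BandLimited ℓ L H → N₁ ≤ N → 0 ≤ A →
      (∀ x y, |multKernel φ H x y| ≤ A * locWeight α σ N x y) → ∀ f, Integrable f μ →
        eLpNorm (multOp μ φ H f) p (centerMeasure C) ≤
          ENNReal.ofReal (A * K * N ^ (α * (p⁻¹).toReal)) * eLpNorm f p μ := by
  obtain ⟨a, ha, hcen⟩ := h.exists_lintegral_centerMeasure_le hσ
  obtain ⟨a', ha', hint⟩ := h.exists_lintegral_locWeight_le hσ
  refine ⟨a + a', by positivity, fun p hp C N₁ hN₁ hsep L H A N hH hN hA hb f hf => ?_⟩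
  have hN0 : 0 < N := by linarith
  have h1 := eLpNorm_le_of_schur (μ := centerMeasure C) (ν := μ) (measurable_locWeight α σ A hN0)
    (fun x => lintegral_const_mul_locWeight_le hA x (hint N hN0 x))
    (fun y => by
      have := lintegral_const_mul_locWeight_le hA y (hcen C N₁ hN₁ hsep N hN y)
      simpa only [locWeight_comm] using this) hp hf.aestronglyMeasurable
    (h.enorm_multOp_le hH hf hb)
  refine h1.trans (mul_le_mul_left ?_ _)
  rw [mul_comm]
  exact ofReal_rpow_mul_ofReal_rpow_le hA ha ha' hN0 (toReal_inv_mem_Icc hp)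

/-- Synthesis from separated centers: a combination of localized kernels has `L^p` norm
`O(N^(α/p'))` times the `ℓ^p` norm of its coefficients. -/
lemma exists_eLpNorm_sum_multKernel_le (h : IsHeatSystem μ φ ℓ α) {σ : ℝ} (hσ : α < σ) :
    ∃ K > 0, ∀ p : ℝ≥0∞, 1 ≤ p → ∀ (C : Finset X) (N₁ : ℝ), 1 ≤ N₁ → IsSeparatedBy C (1 / N₁) →
      ∀ (H : ℕ → ℝ) (A N : ℝ), N₁ ≤ N → 0 ≤ A →
      (∀ x y, |multKernel φ H x y| ≤ A * locWeight α σ N x y) → ∀ a : X → ℝ,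
        eLpNorm (fun x => ∑ y ∈ C, (a y : ℂ) * (multKernel φ H x y : ℂ)) p μ ≤
          ENNReal.ofReal (A * K * N ^ (α * (1 - (p⁻¹).toReal))) *
            eLpNorm (fun y => (a y : ℂ)) p (centerMeasure C) := by
  obtain ⟨b, hb, hcen⟩ := h.exists_lintegral_centerMeasure_le hσ
  obtain ⟨b', hb', hint⟩ := h.exists_lintegral_locWeight_le hσ
  refine ⟨b + b', by positivity, fun p hp C N₁ hN₁ hsep H A N hN hA hk a => ?_⟩
  have hN0 : 0 < N := by linarith
  have h1 := eLpNorm_le_of_schur (μ := μ) (ν := centerMeasure C) (measurable_locWeight α σ A hN0)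
    (fun x => lintegral_const_mul_locWeight_le hA x (hcen C N₁ hN₁ hsep N hN x))
    (fun y => by
      have := lintegral_const_mul_locWeight_le hA y (hint N hN0 y)
      simpa only [locWeight_comm] using this) hp
    (aestronglyMeasurable_centerMeasure C fun y => (a y : ℂ))
    (f := fun x => ∑ y ∈ C, (a y : ℂ) * (multKernel φ H x y : ℂ)) (fun x => by
      rw [lintegral_centerMeasure]
      refine (enorm_sum_le _ _).trans (Finset.sum_le_sum fun y _ => ?_)
      rw [enorm_mul, mul_comm]
      gcongr
      rw [← ofReal_norm, Complex.norm_real]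
      exact ENNReal.ofReal_le_ofReal (hk x y))
  refine h1.trans (mul_le_mul_left ?_ _)
  have hθ := toReal_inv_mem_Icc hp
  have := ofReal_rpow_mul_ofReal_rpow_le (A := A) (α := α) hA hb hb' hN0
    (θ := 1 - (p⁻¹).toReal) ⟨by linarith [hθ.2], by linarith [hθ.1]⟩
  rwa [sub_sub_cancel] at this

end IsHeatSystem

/-! ### Stability of the coefficients of eignets -/

lemma heatMult_lt_of_lt {N δ : ℝ} (hN : 0 < N) (hδ : 0 < δ) {j : ℕ} (hj : δ⁻¹ * N < ℓ j) :
    heatMult ℓ N j < δ := by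
  refine (heatMult_le_of_le hN (by positivity) hj.le).trans_lt ?_
  have h1 := Real.add_one_le_exp ((δ⁻¹) ^ 2)
  rw [Real.exp_neg, inv_lt_comm₀ (Real.exp_pos _) hδ]
  nlinarith [sq_nonneg (δ⁻¹ - 1), inv_pos.2 hδ]

/-- Multipliers that vanish where the heat multiplier is below `δ` are band-limited. -/
lemma bandLimited_of_cutoff {N δ : ℝ} (hN : 0 < N) (hδ : 0 < δ) {t : ℝ → ℝ}
    (ht0 : ∀ u ∈ Set.Icc (0 : ℝ) 1, u ∉ Set.Icc δ (1 - δ) → t u = 0) :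
    BandLimited ℓ (δ⁻¹ * N) fun j => t (heatMult ℓ N j) := fun j hj =>
  ht0 _ ⟨(heatMult_pos ℓ N j).le, heatMult_le_one ℓ N j⟩ fun hmem =>
    absurd hmem.1 (not_le.2 (heatMult_lt_of_lt hN hδ hj))

namespace IsHeatSystem

/-- For a wide enough band of frequencies around `N`, the Christoffel function of the band is at
least of order `N^α`. The lower bound of the heat kernel gives this for all frequencies; the
frequencies below and above the band are removed by the upper bounds at a longer and at a shorter
time. -/
theorem exists_band_lower_bound (h : IsHeatSystem μ φ ℓ α) :
    ∃ δ > 0, δ < 1 / 2 ∧ ∃ w : ℝ → ℝ, ContDiff ℝ ∞ w ∧ (∀ u, 0 ≤ w u) ∧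
      (∀ u ∈ Set.Icc (0 : ℝ) 1, u ∉ Set.Icc δ (1 - δ) → w u = 0) ∧
      ∃ d > 0, ∃ B ≥ 1, ∀ N : ℝ, B ≤ N → ∀ x,
        d * N ^ α ≤ multKernel φ (fun j => w (heatMult ℓ N j)) x x := by
  obtain ⟨c₀, hc₀, hlow⟩ := h.heat_lower
  obtain ⟨c₁, hc₁, c, hc, hup⟩ := h.exists_multKernel_heatMult_pow_le
  have hα := h.alpha_pos
  -- compare the heat kernel at time `1 / N²` with the ones at the longer time `m / N²` and at the
  -- shorter time `1 / (2N)²`; the band is `ε^4 ≤ exp (-(ℓ/N)²) ≤ 1 - ε^4`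
  have hlim : Tendsto (fun m : ℕ => 2 * c₁ * (m : ℝ) ^ (-α / 2)) atTop (𝓝 (2 * c₁ * 0)) := by
    have h1 := (tendsto_rpow_neg_atTop (by linarith : 0 < α / 2)).comp
      (tendsto_natCast_atTop_atTop (R := ℝ))
    refine Tendsto.const_mul _ (h1.congr fun m => ?_)
    simp [neg_div]
  rw [mul_zero] at hlim
  obtain ⟨m, hm1, hm⟩ := ((eventually_ge_atTop 1).and
    (hlim.eventually (eventually_le_nhds (by positivity : 0 < c₀ / 4)))).exists
  have hm1' : (1 : ℝ) ≤ m := by exact_mod_cast hm1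
  set ε : ℝ := min (min (1 / 4) (1 / (2 * m))) (c₀ / (4 * (c₁ * 2 ^ α))) with hε
  have hε0 : 0 < ε := by positivity
  have hε1 : ε ≤ 1 / 4 := (min_le_left _ _).trans (min_le_left _ _)
  have hεm : ε ≤ 1 / (2 * m) := (min_le_left _ _).trans (min_le_right _ _)
  have hεc : ε * (c₁ * 2 ^ α) ≤ c₀ / 4 := by
    have h1 : ε ≤ c₀ / (4 * (c₁ * 2 ^ α)) := min_le_right _ _
    rw [le_div_iff₀ (by positivity)] at h1
    linarith
  have hε4 : ε ^ 4 ≤ ε := pow_le_of_le_one hε0.le (by linarith) (by norm_num)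
  set η : ℝ := ε ^ 4 with hη
  have hη0 : 0 < η := by positivity
  let w : ContDiffBump (1 / 2 : ℝ) := ⟨1 / 2 - η, 1 / 2 - η / 2, by linarith, by linarith⟩
  refine ⟨η / 2, by positivity, by linarith, w, w.contDiff, fun u => w.nonneg, fun u hu hnot => ?_,
    c₀ / 2, by positivity, m, hm1', fun N hN x => ?_⟩
  · refine w.zero_of_le_dist ?_
    rw [Set.mem_Icc, not_and_or, not_le, not_le] at hnot
    rw [Real.dist_eq, le_abs]
    simp only [w]
    rcases hnot with h1 | h1
    · right
      linarith
    · left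
      linarith
  have hN1 : 1 ≤ N := hm1'.trans hN
  have hN0 : 0 < N := by linarith
  -- `u ≤ w(u) + ε u^(1/4) + 2 u^m` on `(0, 1]`: the second term covers the frequencies above the
  -- band, the third one those below
  have hpt : ∀ j, heatMult ℓ N j ≤ w (heatMult ℓ N j) + ε * heatMult ℓ (2 * N) j ^ 1 +
      2 * heatMult ℓ N j ^ m := by
    intro j
    have hu0 := heatMult_pos ℓ N j
    have hu1 := heatMult_le_one ℓ N j
    have hv0 := heatMult_pos ℓ (2 * N) j
    have hw0 : 0 ≤ w (heatMult ℓ N j) := w.nonneg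
    have hum : 0 < heatMult ℓ N j ^ m := by positivity
    have huv : heatMult ℓ N j = heatMult ℓ (2 * N) j ^ 4 := by
      unfold heatMult
      rw [← Real.exp_nat_mul]
      congr 1
      push_cast
      field_simp
      norm_num
    rw [pow_one]
    rcases lt_or_ge (heatMult ℓ N j) η with h1 | h1
    · have h2 : heatMult ℓ (2 * N) j < ε := by
        rw [huv, hη] at h1
        exact lt_of_pow_lt_pow_left₀ 4 hε0.le h1
      have h3 : heatMult ℓ (2 * N) j ^ 4 ≤ ε * heatMult ℓ (2 * N) j := by
        have h4 : heatMult ℓ (2 * N) j ^ 3 ≤ heatMult ℓ (2 * N) j :=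
          pow_le_of_le_one hv0.le (heatMult_le_one _ _ _) (by norm_num)
        calc heatMult ℓ (2 * N) j ^ 4 = heatMult ℓ (2 * N) j ^ 3 * heatMult ℓ (2 * N) j := by ring
          _ ≤ ε * heatMult ℓ (2 * N) j :=
              mul_le_mul_of_nonneg_right (h4.trans h2.le) hv0.le
      linarith
    · rcases le_or_gt (heatMult ℓ N j) (1 - η) with h2 | h2
      · have : w (heatMult ℓ N j) = 1 := w.one_of_mem_closedBall (by
          rw [Metric.mem_closedBall, Real.dist_eq, abs_le]
          constructor <;> simp only [w] <;> linarith)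
        rw [this]
        have : 0 < ε * heatMult ℓ (2 * N) j := by positivity
        linarith
      · have h3 : (1 : ℝ) / 2 ≤ heatMult ℓ N j ^ m := by
          have h4 : 1 + (m : ℝ) * (-η) ≤ (1 + -η) ^ m :=
            one_add_mul_le_pow (by linarith) m
          have h5 : (1 + -η) ^ m ≤ heatMult ℓ N j ^ m :=
            pow_le_pow_left₀ (by linarith) (by linarith) m
          have h6 : (m : ℝ) * η ≤ 1 / 2 := by
            calc (m : ℝ) * η ≤ m * (1 / (2 * m)) := by
                  gcongr
                  linarith
              _ = 1 / 2 := by field_simp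
          linarith
        have : 0 < ε * heatMult ℓ (2 * N) j := by positivity
        linarith
  have hmN : (m : ℝ) ≤ N ^ 2 := by nlinarith
  have h1N : ((1 : ℕ) : ℝ) ≤ N ^ 2 := by
    push_cast
    nlinarith
  have h12N : ((1 : ℕ) : ℝ) ≤ (2 * N) ^ 2 := by
    push_cast
    nlinarith
  have hs1 := h.summable_heatMult_pow one_pos h1N x x
  have hs2 := h.summable_heatMult_pow one_pos h12N x x
  have hsm := h.summable_heatMult_pow (by omega : 0 < m) hmN x x
  have hsw : Summable fun j => w (heatMult ℓ N j) * φ j x * φ j x := by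
    have hbl : BandLimited ℓ ((η / 2)⁻¹ * N) fun j => w (heatMult ℓ N j) := by
      intro j hj
      have := heatMult_lt_of_lt hN0 (by positivity) hj
      refine w.zero_of_le_dist ?_
      rw [Real.dist_eq, le_abs]
      simp only [w]
      right
      linarith
    refine summable_of_ne_finset_zero (s := h.band ((η / 2)⁻¹ * N)) fun j hj => ?_
    have h0 : w (heatMult ℓ N j) = 0 := h.bandLimited_apply hbl hj
    rw [h0, zero_mul, zero_mul]
  have hle : multKernel φ (fun j => heatMult ℓ N j ^ 1) x x ≤
      multKernel φ (fun j => w (heatMult ℓ N j)) x x +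
      ε * multKernel φ (fun j => heatMult ℓ (2 * N) j ^ 1) x x +
      2 * multKernel φ (fun j => heatMult ℓ N j ^ m) x x := by
    unfold multKernel
    rw [← tsum_mul_left, ← tsum_mul_left, ← hsw.tsum_add (hs2.mul_left ε),
      ← (hsw.add (hs2.mul_left ε)).tsum_add (hsm.mul_left 2)]
    refine hs1.tsum_le_tsum (fun j => ?_) ((hsw.add (hs2.mul_left ε)).add (hsm.mul_left 2))
    have := mul_le_mul_of_nonneg_right (hpt j) (mul_self_nonneg (φ j x))
    rw [pow_one]
    linarith
  have hlow1 : c₀ * N ^ α ≤ multKernel φ (fun j => heatMult ℓ N j ^ 1) x x := by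
    have h2 := hlow (((1 : ℕ) : ℝ) / N ^ 2) ⟨by positivity, (div_le_one (by positivity)).2 h1N⟩ x
    have e1 : multKernel φ (fun j => heatMult ℓ N j ^ 1) x x =
        heatKernel φ ℓ (((1 : ℕ) : ℝ) / N ^ 2) x x := by
      unfold multKernel heatKernel
      simp only [heatMult_pow]
    have e2 : (((1 : ℕ) : ℝ) / N ^ 2) ^ (-α / 2) = N ^ α := by
      rw [Nat.cast_one, one_div, Real.inv_rpow (by positivity), ← Real.rpow_natCast,
        ← Real.rpow_mul hN0.le, ← Real.rpow_neg hN0.le]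
      congr 1
      push_cast
      ring
    rw [e1, ← e2]
    exact h2
  have hup2 := (le_abs_self _).trans (hup (2 * N) 1 (by positivity) one_pos h12N x x)
  have hupm := (le_abs_self _).trans (hup N m hN0 (by omega) hmN x x)
  simp only [dist_self, mul_zero, ne_eq, OfNat.ofNat_ne_zero, not_false_eq_true, zero_pow,
    zero_div, Real.exp_zero, mul_one, Nat.cast_one, Real.one_rpow] at hup2 hupm
  rw [Real.mul_rpow (by norm_num) hN0.le] at hup2
  have hNα : 0 < N ^ α := by positivity
  have h3 := mul_le_mul_of_nonneg_left hup2 hε0.le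
  have h4 := mul_le_mul_of_nonneg_right hεc hNα.le
  have h5 := mul_le_mul_of_nonneg_right hm hNα.le
  nlinarith

variable [CompactSpace X] [BorelSpace X] [IsProbabilityMeasure μ]

/-- **Stability of the coefficients.** If the centers are `1/N₁`-separated and `N ≥ B N₁`, then
the matrix of a localized kernel at scale `N` with large diagonal is diagonally dominant, so that
the coefficients are controlled in `ℓ^p` by the values at the centers. -/
theorem exists_eLpNorm_coefficients_le (h : IsHeatSystem μ φ ℓ α) {S : ℕ} (hS : α < S) {d A : ℝ}
    (hd : 0 < d) (hA : 0 < A) :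
    ∃ B ≥ 1, ∀ p : ℝ≥0∞, 1 ≤ p → ∀ (C : Finset X) (N₁ : ℝ), 1 ≤ N₁ → IsSeparatedBy C (1 / N₁) →
      ∀ N : ℝ, B * N₁ ≤ N → ∀ (H : ℕ → ℝ) (D : ℝ), 0 < D →
      (∀ x, d * D * N ^ α ≤ multKernel φ H x x) →
      (∀ x y, |multKernel φ H x y| ≤ A * D * locWeight α S N x y) → ∀ a : X → ℝ,
        eLpNorm (fun y => (a y : ℂ)) p (centerMeasure C) ≤
          ENNReal.ofReal (2 / (d * D * N ^ α)) *
            eLpNorm (fun x => ∑ y ∈ C, (a y : ℂ) * (multKernel φ H x y : ℂ)) p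
              (centerMeasure C) := by
  classical
  obtain ⟨K, hK, hcen⟩ := h.exists_lintegral_centerMeasure_le hS
  have hα := h.alpha_pos
  have hS0 : (0 : ℝ) < S := hα.trans hS
  -- the off-diagonal part has norm at most `A D N^α 2^S K (N / N₁)^(-S)`
  have hlim : Tendsto (fun B : ℝ => A * 2 ^ (S : ℝ) * K * B ^ (-(S : ℝ))) atTop
      (𝓝 (A * 2 ^ (S : ℝ) * K * 0)) := (tendsto_rpow_neg_atTop hS0).const_mul _
  rw [mul_zero] at hlim
  obtain ⟨B, hB1, hB⟩ := ((eventually_ge_atTop (1 : ℝ)).and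
    (hlim.eventually (eventually_le_nhds (by positivity : 0 < d / 2)))).exists
  have hB0 : 0 < B := by linarith
  refine ⟨B, hB1, fun p hp C N₁ hN₁ hsep N hN H D hD hdiag hloc a => ?_⟩
  have hN₁0 : 0 < N₁ := by linarith
  have hN0 : 0 < N := (by positivity : 0 < B * N₁).trans_le hN
  have hNα : 0 < N ^ α := by positivity
  set ν := centerMeasure C with hν
  set off : X → ℂ := fun x => if x ∈ C then
    ∑ y ∈ C.erase x, (a y : ℂ) * (multKernel φ H x y : ℂ) else 0 with hoff
  -- distinct centers have `N₁ ρ ≥ 1`, so that the weight at scale `N` is at most a small multiple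
  -- of the one at scale `N₁`, which is summable over the centers
  set A' : ℝ := A * D * N ^ α * 2 ^ (S : ℝ) * B ^ (-(S : ℝ)) * N₁ ^ (-α) with hA'
  have hA'0 : 0 < A' := by positivity
  have hoffk : ∀ x ∈ C, ∀ y ∈ C.erase x, |multKernel φ H x y| ≤ A' * locWeight α S N₁ x y := by
    intro x hx y hy
    have hne : x ≠ y := (Finset.mem_erase.1 hy).1.symm
    have hdist := hsep x hx y (Finset.mem_erase.1 hy).2 hne
    have h1 : 1 ≤ N₁ * dist x y := by
      rw [div_le_iff₀ hN₁0] at hdist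
      linarith
    have h2 : B / 2 * (1 + N₁ * dist x y) ≤ 1 + N * dist x y := by
      have h3 : B * N₁ * dist x y ≤ N * dist x y := by gcongr
      nlinarith
    have h3 : (1 + N * dist x y) ^ (-(S : ℝ)) ≤
        2 ^ (S : ℝ) * B ^ (-(S : ℝ)) * (1 + N₁ * dist x y) ^ (-(S : ℝ)) := by
      refine (Real.rpow_le_rpow_of_nonpos (by positivity) h2 (by linarith)).trans (le_of_eq ?_)
      rw [Real.mul_rpow (by positivity) (by positivity), Real.div_rpow hB0.le (by norm_num),
        Real.rpow_neg (x := 2) (by norm_num), div_inv_eq_mul]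
      ring
    refine (hloc x y).trans ?_
    unfold locWeight
    calc A * D * (N ^ α * (1 + N * dist x y) ^ (-(S : ℝ)))
        ≤ A * D * (N ^ α * (2 ^ (S : ℝ) * B ^ (-(S : ℝ)) *
          (1 + N₁ * dist x y) ^ (-(S : ℝ)))) := by gcongr
      _ = A' * (N₁ ^ α * (1 + N₁ * dist x y) ^ (-(S : ℝ))) := by
          rw [hA', Real.rpow_neg hN₁0.le]
          field_simp
  have hrow : ∀ x, ∫⁻ y, ENNReal.ofReal (A' * locWeight α S N₁ x y) ∂ν ≤
      ENNReal.ofReal (d / 2 * D * N ^ α) := by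
    intro x
    refine (lintegral_const_mul_locWeight_le hA'0.le x
      (hcen C N₁ hN₁ hsep N₁ le_rfl x)).trans (ENNReal.ofReal_le_ofReal ?_)
    have e : A' * (K * N₁ ^ α) = A * 2 ^ (S : ℝ) * K * B ^ (-(S : ℝ)) * (D * N ^ α) := by
      rw [hA', Real.rpow_neg hN₁0.le]
      field_simp
    rw [e]
    have := mul_le_mul_of_nonneg_right hB (by positivity : 0 ≤ D * N ^ α)
    linarith
  have hoffn : eLpNorm off p ν ≤
      ENNReal.ofReal (d / 2 * D * N ^ α) * eLpNorm (fun y => (a y : ℂ)) p ν := by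
    have h1 := eLpNorm_le_of_schur (μ := ν) (ν := ν) (measurable_locWeight α S A' hN₁0) hrow
      (fun y => by simpa only [locWeight_comm] using hrow y) hp
      (aestronglyMeasurable_centerMeasure C fun y => (a y : ℂ)) (f := off) (fun x => by
        rw [hν, lintegral_centerMeasure]
        by_cases hx : x ∈ C
        · simp only [hoff, if_pos hx]
          refine (enorm_sum_le _ _).trans ?_
          refine (Finset.sum_le_sum fun y hy => ?_).trans
            (Finset.sum_le_sum_of_subset (Finset.erase_subset x C))
          rw [enorm_mul, mul_comm]
          gcongr
          rw [← ofReal_norm, Complex.norm_real]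
          exact ENNReal.ofReal_le_ofReal (hoffk x hx y hy)
        · simp [hoff, hx])
    refine h1.trans (mul_le_mul_left (le_of_eq ?_) _)
    have hθ := toReal_inv_mem_Icc hp
    rw [← ENNReal.rpow_add_of_nonneg _ _ (by linarith [hθ.2]) hθ.1, sub_add_cancel,
      ENNReal.rpow_one]
  set v : X → ℂ := fun x => ∑ y ∈ C, (a y : ℂ) * (multKernel φ H x y : ℂ) with hv
  have hq : 0 < d * D * N ^ α := by positivity
  have hmain : ENNReal.ofReal (d * D * N ^ α) * eLpNorm (fun y => (a y : ℂ)) p ν ≤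
      eLpNorm v p ν + ENNReal.ofReal (d / 2 * D * N ^ α) * eLpNorm (fun y => (a y : ℂ)) p ν := by
    have h1 : ENNReal.ofReal (d * D * N ^ α) * eLpNorm (fun y => (a y : ℂ)) p ν =
        eLpNorm (fun y => ((d * D * N ^ α : ℝ) : ℂ) * (a y : ℂ)) p ν := by
      have := eLpNorm_const_smul ((d * D * N ^ α : ℝ) : ℂ) (fun y => (a y : ℂ)) p ν
      rw [← ofReal_norm, Complex.norm_real, Real.norm_of_nonneg hq.le] at this
      rw [← this]
      rfl
    rw [h1]
    have h2 : eLpNorm (fun y => ((d * D * N ^ α : ℝ) : ℂ) * (a y : ℂ)) p ν ≤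
        eLpNorm (fun x => v x - off x) p ν := by
      refine eLpNorm_mono_ae (ae_centerMeasure C fun x hx => ?_)
      have e : v x - off x = (a x : ℂ) * (multKernel φ H x x : ℂ) := by
        simp only [hv, hoff, if_pos hx]
        rw [← Finset.add_sum_erase C _ hx, add_sub_cancel_right]
      rw [e, norm_mul, norm_mul, mul_comm, Complex.norm_real (multKernel φ H x x),
        Complex.norm_real (d * D * N ^ α), Real.norm_of_nonneg hq.le]
      gcongr
      exact (hdiag x).trans (le_abs_self _)
    refine h2.trans ((eLpNorm_sub_le (aestronglyMeasurable_centerMeasure C v)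
      (aestronglyMeasurable_centerMeasure C off) hp).trans ?_)
    gcongr
  have hfin := eLpNorm_centerMeasure_ne_top C (fun y => (a y : ℂ)) p
  -- absorb the off-diagonal part, which is legitimate because the norm is finite
  have hhalf : ENNReal.ofReal (d / 2 * D * N ^ α) * eLpNorm (fun y => (a y : ℂ)) p ν ≤
      eLpNorm v p ν := by
    have e : ENNReal.ofReal (d * D * N ^ α) =
        ENNReal.ofReal (d / 2 * D * N ^ α) + ENNReal.ofReal (d / 2 * D * N ^ α) := by
      rw [← ENNReal.ofReal_add (by positivity) (by positivity)]
      congr 1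
      ring
    rw [e, add_mul] at hmain
    exact (ENNReal.add_le_add_iff_right
      (ENNReal.mul_ne_top ENNReal.ofReal_ne_top hfin)).1 hmain
  calc eLpNorm (fun y => (a y : ℂ)) p ν
      = ENNReal.ofReal (2 / (d * D * N ^ α)) *
        (ENNReal.ofReal (d / 2 * D * N ^ α) * eLpNorm (fun y => (a y : ℂ)) p ν) := by
        rw [← mul_assoc, ← ENNReal.ofReal_mul (by positivity)]
        have : 2 / (d * D * N ^ α) * (d / 2 * D * N ^ α) = 1 := by field_simp
        rw [this, ENNReal.ofReal_one, one_mul]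
    _ ≤ _ := by gcongr

end IsHeatSystem

/-! ### Eignets -/

/-- The admissible systems on a Riemannian manifold, with the lower bound, are heat systems. -/
lemma IsAdmissibleSystem.isHeatSystem {n : ℕ} [ChartedSpace (EuclideanSpace ℝ (Fin n)) X]
    [Bundle.RiemannianBundle (fun x : X => TangentSpace (𝓡 n) x)] {A : ℝ}
    (h : IsAdmissibleSystem (n := n) μ φ ℓ α A) (hlow : HeatLowerBound φ ℓ α) :
    IsHeatSystem μ φ ℓ α :=
  ⟨h.alpha_pos, h.continuous_phi, h.orthonormal, h.phi_zero, h.ell_zero, h.ell_mono,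
    h.ell_tendsto, h.ball_measure, h.heat_summable, h.heat_upper, hlow⟩

lemma integrable_eignet {b : ℝ → ℝ} {G : X → X → ℝ} (hG : HasFormalExpansion μ φ ℓ b G)
    (C : Finset X) (a : X → ℝ) :
    Integrable (fun x => ((∑ y ∈ C, a y * G x y : ℝ) : ℂ)) μ := by
  have h1 : Integrable (fun x => ∑ y ∈ C, a y * G x y) μ :=
    integrable_finsetSum _ fun y _ => (hG y).1.const_mul (a y)
  exact h1.ofReal

/-- The coefficient `b(ℓ_j) ∑_y a_y φ_j(y)` of the eignet `∑_y a_y G(·, y)`. -/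
noncomputable def eignetCoeff (φ : ℕ → X → ℝ) (ℓ : ℕ → ℝ) (b : ℝ → ℝ) (C : Finset X) (a : X → ℝ)
    (j : ℕ) : ℝ := b (ℓ j) * ∑ y ∈ C, a y * φ j y

namespace IsHeatSystem

variable [CompactSpace X] [BorelSpace X] [IsProbabilityMeasure μ]

lemma coeff_eignet (h : IsHeatSystem μ φ ℓ α) {b : ℝ → ℝ} {G : X → X → ℝ}
    (hG : HasFormalExpansion μ φ ℓ b G) (C : Finset X) (a : X → ℝ) (j : ℕ) :
    coeff μ φ (fun x => ((∑ y ∈ C, a y * G x y : ℝ) : ℂ)) j = (eignetCoeff φ ℓ b C a j : ℝ) := by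
  unfold coeff eignetCoeff
  have e : ∀ x, ((∑ y ∈ C, a y * G x y : ℝ) : ℂ) * (φ j x : ℂ) =
      ((∑ y ∈ C, a y * (G x y * φ j x) : ℝ) : ℂ) := by
    intro x
    rw [← Complex.ofReal_mul, Finset.sum_mul]
    congr 1
    exact Finset.sum_congr rfl fun y _ => by ring
  simp only [e]
  rw [integral_complex_ofReal, integral_finsetSum]
  · congr 1
    rw [Finset.mul_sum]
    refine Finset.sum_congr rfl fun y _ => ?_
    rw [integral_const_mul, (hG y).2 j]
    ring
  · intro y _
    refine Integrable.const_mul ?_ _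
    obtain ⟨M, hM⟩ := h.exists_phi_bound j
    exact (hG y).1.mul_bdd (c := M) (h.continuous_phi j).aestronglyMeasurable
      (ae_of_all _ fun x => by simpa using hM x)

/-- The synthesis of coefficients `a` with the kernel of `H`, in terms of the `φ_j`. -/
lemma sum_multKernel_eq (h : IsHeatSystem μ φ ℓ α) {L : ℝ} {H : ℕ → ℝ} (hH : BandLimited ℓ L H)
    (C : Finset X) (a : X → ℝ) :
    (fun x => ∑ y ∈ C, (a y : ℂ) * (multKernel φ H x y : ℂ)) =
      fun x => ∑ j ∈ h.band L, ((H j * ∑ y ∈ C, a y * φ j y : ℝ) : ℂ) * (φ j x : ℂ) := by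
  funext x
  simp only [h.multKernel_eq_sum hH]
  push_cast
  simp only [Finset.mul_sum, Finset.sum_mul]
  rw [Finset.sum_comm]
  exact Finset.sum_congr rfl fun j _ => Finset.sum_congr rfl fun y _ => by ring

/-- The part of `(Δ*)^s Ψ` at frequencies above `2^k`, for an eignet `Ψ` with coefficients `a` at
`1/N₁`-separated centers and `2^k ≥ N₁`. -/
theorem exists_eignet_highPass (h : IsHeatSystem μ φ ℓ α) {S : ℕ} (hS : α < S) {β : ℝ}
    {b : ℝ → ℝ} (hb : IsMask S β b) {p : ℝ≥0∞} (hp : 1 ≤ p) {s : ℝ}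
    (hs : s - β + α * (1 - (p⁻¹).toReal) < 0) :
    ∃ T > 0, ∀ (C : Finset X) (N₁ : ℝ), 1 ≤ N₁ → IsSeparatedBy C (1 / N₁) → ∀ k : ℕ,
      N₁ ≤ 2 ^ k → ∀ a : X → ℝ, ∃ g ∈ closureLp μ φ ℓ p,
        eLpNorm g p μ ≤ ENNReal.ofReal (T * ((2 : ℝ) ^ (s - β + α * (1 - (p⁻¹).toReal))) ^ k) *
          eLpNorm (fun y => (a y : ℂ)) p (centerMeasure C) ∧
        ∀ j, coeff μ φ g j = ((1 - lowPass ℓ (2 ^ k) j : ℝ) : ℂ) *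
          (((1 + ℓ j) ^ s : ℝ) * (eignetCoeff φ ℓ b C a j : ℝ)) := by
  obtain ⟨-, -, F, hF, hbF, ⟨c, hFc⟩, -⟩ := hb
  obtain ⟨C₀, hC₀, hloc⟩ := h.exists_bandPass_localization hF hFc (s - β)
  obtain ⟨K, hK, hsyn⟩ := h.exists_eLpNorm_sum_multKernel_le hS
  set θ := (p⁻¹).toReal
  set e := s - β + α * (1 - θ) with he
  have hq0 : (0 : ℝ) < 2 ^ e := by positivity
  have hq1 : (2 : ℝ) ^ e < 1 := Real.rpow_lt_one_of_one_lt_of_neg one_lt_two hs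
  set q : ℝ := 2 ^ e with hq
  refine ⟨C₀ * K * q * (1 - q)⁻¹, mul_pos (by positivity) (inv_pos.2 (by linarith)),
    fun C N₁ hN₁ hsep k hk a => ?_⟩
  set H : ℕ → ℕ → ℝ := fun i j => bandPass ℓ (k + i) j * ((1 + ℓ j) ^ (s - β) * F (Real.log (ℓ j)))
    with hH
  have hbl : ∀ i, BandLimited ℓ (2 * 2 ^ (k + i + 1)) (H i) := fun i =>
    bandLimited_bandPass (k + i) _
  -- `F` describes the mask at positive frequencies only; at the others both sides vanish
  have hHb : ∀ i j, H i j = bandPass ℓ (k + i) j * ((1 + ℓ j) ^ s * b (ℓ j)) := by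
    intro i j
    rcases (h.ell_nonneg j).eq_or_lt with h0 | h0
    · simp only [hH, bandPass_eq_zero h0.symm, zero_mul]
    · simp only [hH]
      rw [hbF _ h0, ← mul_assoc ((1 + ℓ j) ^ s), ← Real.rpow_add (by linarith), sub_eq_add_neg]
  have hsum : HasSum (fun i : ℕ => C₀ * K * q ^ (k + 1) * q ^ i)
      (C₀ * K * q ^ (k + 1) * (1 - q)⁻¹) :=
    (hasSum_geometric_of_lt_one hq0.le hq1).mul_left _
  have hpoly : ∀ i, ∃ L, (fun x => ∑ y ∈ C, (a y : ℂ) * (multKernel φ (H i) x y : ℂ)) ∈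
      diffusionPoly φ ℓ L := by
    intro i
    refine ⟨2 * 2 ^ (k + i + 1), ?_⟩
    rw [h.sum_multKernel_eq (hbl i)]
    have e : (fun x => ∑ j ∈ h.band (2 * 2 ^ (k + i + 1)),
        ((H i j * ∑ y ∈ C, a y * φ j y : ℝ) : ℂ) * (φ j x : ℂ)) =
        ∑ j ∈ h.band (2 * 2 ^ (k + i + 1)), ((H i j * ∑ y ∈ C, a y * φ j y : ℝ) : ℂ) •
          fun x => (φ j x : ℂ) := by
      funext x
      simp
    rw [e]
    exact Submodule.sum_mem _ fun j hj => Submodule.smul_mem _ _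
      (Submodule.subset_span ⟨j, h.mem_band.1 hj, rfl⟩)
  obtain ⟨g, hg, hgn, hgc⟩ := h.exists_sum_mem_closureLp hp hpoly
    (B := ENNReal.ofReal (C₀ * K * q * (1 - q)⁻¹ * q ^ k) *
      eLpNorm (fun y => (a y : ℂ)) p (centerMeasure C))
    (by
      calc _ ≤ ∑' i : ℕ, ENNReal.ofReal (C₀ * K * q ^ (k + 1) * q ^ i) *
            eLpNorm (fun y => (a y : ℂ)) p (centerMeasure C) := by
            refine ENNReal.tsum_le_tsum fun i => ?_
            have hNi : N₁ ≤ 2 ^ (k + i + 1) :=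
              hk.trans (pow_le_pow_right₀ one_le_two (by omega))
            refine (hsyn p hp C N₁ hN₁ hsep (H i) (C₀ * ((2 : ℝ) ^ (k + i + 1)) ^ (s - β))
              (2 ^ (k + i + 1)) hNi (by positivity) (fun x y => hloc (k + i) x y) a).trans
              (le_of_eq ?_)
            congr 2
            have e1 : ((2 : ℝ) ^ (k + i + 1)) ^ (s - β) * ((2 : ℝ) ^ (k + i + 1)) ^ (α * (1 - θ)) =
                q ^ (k + i + 1) := by
              rw [← Real.rpow_add (by positivity), ← he, hq, ← Real.rpow_natCast,
                ← Real.rpow_natCast, ← Real.rpow_mul (by norm_num), ← Real.rpow_mul (by norm_num),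
                mul_comm]
            calc C₀ * ((2 : ℝ) ^ (k + i + 1)) ^ (s - β) * K *
                  ((2 : ℝ) ^ (k + i + 1)) ^ (α * (1 - θ))
                = C₀ * K * (((2 : ℝ) ^ (k + i + 1)) ^ (s - β) *
                  ((2 : ℝ) ^ (k + i + 1)) ^ (α * (1 - θ))) := by ring
              _ = C₀ * K * q ^ (k + i + 1) := by rw [e1]
              _ = _ := by ring
        _ = _ := by
            rw [ENNReal.tsum_mul_right, ← ENNReal.ofReal_tsum_of_nonneg
              (fun i => by positivity) hsum.summable, hsum.tsum_eq]
            congr 2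
            ring)
    (ENNReal.mul_ne_top ENNReal.ofReal_ne_top (eLpNorm_centerMeasure_ne_top C _ p))
  refine ⟨g, hg, hgn, fun j => (hgc j).unique ?_⟩
  have h1 := hasSum_bandPass (h.ell_nonneg j) k
    ((((1 + ℓ j) ^ s : ℝ) : ℂ) * (eignetCoeff φ ℓ b C a j : ℝ))
  refine h1.congr_fun fun i => ?_
  rw [h.sum_multKernel_eq (hbl i), h.coeff_finsetSum_phi]
  have e : bandPass ℓ (k + i) j * ((1 + ℓ j) ^ s * eignetCoeff φ ℓ b C a j) =
      H i j * ∑ y ∈ C, a y * φ j y := by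
    rw [hHb]
    unfold eignetCoeff
    ring
  split_ifs with hj
  · rw [← e]
    push_cast
    ring
  · have h0 := h.bandLimited_apply (hbl i) hj
    rw [h0, zero_mul] at e
    rw [← Complex.ofReal_mul, ← Complex.ofReal_mul, e, Complex.ofReal_zero]

/-- Eignets and their derivatives `(Δ*)^s Ψ` of order `s < β - α/p'` lie in `X^p`. -/
lemma exists_deltaStar_eignet (h : IsHeatSystem μ φ ℓ α) {S : ℕ} (hS : α < S) {β : ℝ}
    {b : ℝ → ℝ} (hb : IsMask S β b) {G : X → X → ℝ} (hG : HasFormalExpansion μ φ ℓ b G)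
    {p : ℝ≥0∞} (hp : 1 ≤ p) {s : ℝ} (hs : s - β + α * (1 - (p⁻¹).toReal) < 0)
    {C : Finset X} {N₁ : ℝ} (hN₁ : 1 ≤ N₁) (hsep : IsSeparatedBy C (1 / N₁)) (a : X → ℝ) :
    ∃ g ∈ closureLp μ φ ℓ p,
      IsDeltaStar μ φ ℓ s (fun x => ((∑ y ∈ C, a y * G x y : ℝ) : ℂ)) g := by
  obtain ⟨T, -, hT⟩ := h.exists_eignet_highPass hS hb hp hs
  obtain ⟨k, hk⟩ := pow_unbounded_of_one_lt N₁ (one_lt_two (α := ℝ))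
  obtain ⟨g, hg, -, hgc⟩ := hT C N₁ hN₁ hsep k hk.le a
  have hbl : BandLimited ℓ (2 * 2 ^ k) fun j => lowPass ℓ (2 ^ k) j * (1 + ℓ j) ^ s :=
    (bandLimited_lowPass (by positivity)).mul_right _
  have hP := h.multOp_mem_diffusionPoly hbl (fun x => ((∑ y ∈ C, a y * G x y : ℝ) : ℂ)) (μ := μ)
  have hmem := h.add_mem_closureLp hg hP
  refine ⟨_, hmem, hmem.1.integrable hp, fun j => ?_⟩
  rw [h.coeff_add (hg.1.integrable hp) ((h.memLp_of_mem_diffusionPoly hP p).integrable hp),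
    hgc, h.coeff_multOp hbl, h.coeff_eignet hG]
  push_cast
  ring

lemma eignet_mem_closureLp (h : IsHeatSystem μ φ ℓ α) {S : ℕ} (hS : α < S) {β : ℝ}
    {b : ℝ → ℝ} (hb : IsMask S β b) {G : X → X → ℝ} (hG : HasFormalExpansion μ φ ℓ b G)
    {p : ℝ≥0∞} (hp : 1 ≤ p) (hβ : α * (1 - (p⁻¹).toReal) < β)
    {C : Finset X} {N₁ : ℝ} (hN₁ : 1 ≤ N₁) (hsep : IsSeparatedBy C (1 / N₁)) (a : X → ℝ) :
    (fun x => ((∑ y ∈ C, a y * G x y : ℝ) : ℂ)) ∈ closureLp μ φ ℓ p := by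
  obtain ⟨g, hg, hgi, hgc⟩ := h.exists_deltaStar_eignet hS hb hG hp (s := 0) (by linarith) hN₁
    hsep a
  refine mem_closureLp_of_ae_eq (h.ae_eq_of_coeff_eq hgi (integrable_eignet hG C a) fun j => ?_) hg
  rw [hgc, Real.rpow_zero, Complex.ofReal_one, one_mul]

/-- Smoothness of order `r` implies smoothness of every lower order `γ`. -/
lemma exists_deltaStar_of_le (h : IsHeatSystem μ φ ℓ α) {p : ℝ≥0∞} (hp : 1 ≤ p) {γ r : ℝ}
    (hγr : γ ≤ r) {f u : X → ℂ} (hu : u ∈ closureLp μ φ ℓ p) (hfu : IsDeltaStar μ φ ℓ r f u) :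
    ∃ g ∈ closureLp μ φ ℓ p, IsDeltaStar μ φ ℓ γ f g := by
  obtain ⟨C, -, hC⟩ := h.exists_highPass (s := r - γ) (by linarith)
  obtain ⟨g, hg, -, hgc⟩ := hC p hp 0 u hu
  have hbl : BandLimited ℓ (2 * 2 ^ 0) fun j => lowPass ℓ (2 ^ 0) j * (1 + ℓ j) ^ (-(r - γ)) :=
    (bandLimited_lowPass (by positivity)).mul_right _
  have hP := h.multOp_mem_diffusionPoly hbl u (μ := μ)
  have hmem := h.add_mem_closureLp hg hP
  refine ⟨_, hmem, hmem.1.integrable hp, fun j => ?_⟩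
  have hpos : 0 < 1 + ℓ j := by linarith [h.ell_nonneg j]
  have e : (1 + ℓ j) ^ γ = (1 + ℓ j) ^ (-(r - γ)) * (1 + ℓ j) ^ r := by
    rw [← Real.rpow_add hpos]
    congr 1
    ring
  rw [h.coeff_add (hg.1.integrable hp) ((h.memLp_of_mem_diffusionPoly hP p).integrable hp),
    hgc, h.coeff_multOp hbl, hfu.2, e]
  push_cast
  ring

/-- The coefficients of an eignet `Ψ` are controlled by the distance of `Ψ` to any `f` and by the
smoothness of `f`: a band of frequencies well above `1 / q` sees `f` only through
`N^(-r) ‖(Δ*)^r f‖`, and `Ψ` through a diagonally dominant matrix. -/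
theorem exists_eLpNorm_eignet_coefficients_le (h : IsHeatSystem μ φ ℓ α) {S : ℕ} (hS : α < S)
    {β : ℝ} (hβ : 0 ≤ β) {b : ℝ → ℝ} (hb : IsMask S β b) {G : X → X → ℝ}
    (hG : HasFormalExpansion μ φ ℓ b G) {p : ℝ≥0∞} (hp : 1 ≤ p) (r : ℝ) :
    ∃ B ≥ 1, ∃ Q > 0, ∀ (C : Finset X) (N₁ : ℝ), 1 ≤ N₁ → IsSeparatedBy C (1 / N₁) →
      ∀ N : ℝ, B * N₁ ≤ N → ∀ f u : X → ℂ, Integrable f μ → IsDeltaStar μ φ ℓ r f u →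
      ∀ a : X → ℝ, eLpNorm (fun y => (a y : ℂ)) p (centerMeasure C) ≤
        ENNReal.ofReal (Q * N ^ (β - α * (1 - (p⁻¹).toReal))) *
          (eLpNorm (fun x => f x - ((∑ y ∈ C, a y * G x y : ℝ) : ℂ)) p μ +
            ENNReal.ofReal (N ^ (-r)) * eLpNorm u p μ) := by
  obtain ⟨-, -, F, hF, hbF, ⟨c, hFc⟩, ⟨c₁, hc₁, hFlow⟩⟩ := hb
  obtain ⟨δ, hδ, hδ2, w, hw, hw0, hwz, d₀, hd₀, B₀, hB₀, hdiag⟩ := h.exists_band_lower_bound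
  obtain ⟨A, hA, hlocb⟩ := h.exists_band_localization hF hFc (-β) hδ hδ2 hw hwz
  have hF1 : ∀ k ≤ S, ∀ x, |iteratedDeriv k (fun _ : ℝ => (1 : ℝ)) x| ≤ 1 := by
    intro k _ x
    rw [iteratedDeriv_const]
    split_ifs <;> simp
  obtain ⟨A₁, hA₁, hloc1⟩ := h.exists_band_localization (S := S) contDiff_const hF1 0 hδ hδ2 hw hwz
  obtain ⟨A₂, hA₂, hloc2⟩ :=
    h.exists_band_localization (S := S) contDiff_const hF1 (-r) hδ hδ2 hw hwz
  simp only [mul_one, Real.rpow_zero] at hloc1 hloc2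
  set d : ℝ := c₁ * (1 + δ⁻¹) ^ (-β) * d₀ with hd
  have hd0 : 0 < d := by positivity
  obtain ⟨B₁, hB₁, hstab⟩ := h.exists_eLpNorm_coefficients_le hS hd0 hA
  obtain ⟨K, hK, hsamp⟩ := h.exists_eLpNorm_centerMeasure_multOp_le hS
  refine ⟨max B₀ B₁, hB₀.trans (le_max_left _ _), 2 / d * ((A₁ + A₂) * K), by positivity,
    fun C N₁ hN₁ hsep N hN f u hf hfu a => ?_⟩
  have hNB₁ : B₁ * N₁ ≤ N := le_trans (by gcongr; exact le_max_right _ _) hN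
  have hNB₀ : B₀ ≤ N := by
    refine le_trans ?_ hN
    have h1 : B₀ ≤ max B₀ B₁ := le_max_left _ _
    nlinarith
  have hN1N : N₁ ≤ N := by nlinarith
  have hN1 : 1 ≤ N := hN₁.trans hN1N
  have hN0 : 0 < N := by linarith
  set W : ℕ → ℝ := fun j => w (heatMult ℓ N j) with hW
  have hWb : BandLimited ℓ (δ⁻¹ * N) W := bandLimited_of_cutoff hN0 hδ hwz
  set H : ℕ → ℝ := fun j => W j * ((1 + ℓ j) ^ (-β) * F (Real.log (ℓ j))) with hH
  have hHb : BandLimited ℓ (δ⁻¹ * N) H := hWb.mul_right _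
  have hHW : ∀ j, H j = W j * b (ℓ j) := by
    intro j
    rcases (h.ell_nonneg j).eq_or_lt with h0 | h0
    · have : W j = 0 := by
        have h1 : heatMult ℓ N j = 1 := by simp [heatMult, ← h0]
        simp only [hW, h1]
        exact hwz 1 (by simp) fun hmem => by linarith [hmem.2]
      simp only [hH, this, zero_mul]
    · simp only [hH]
      rw [hbF _ h0]
  have hHlow : ∀ j, c₁ * (1 + δ⁻¹) ^ (-β) * N ^ (-β) * W j ≤ H j := by
    intro j
    by_cases hj : j ∈ h.band (δ⁻¹ * N)
    · have hle := h.mem_band.1 hj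
      have h1 : 1 + ℓ j ≤ (1 + δ⁻¹) * N := by linarith
      have hpos : 0 < 1 + ℓ j := by linarith [h.ell_nonneg j]
      have h2 : (1 + δ⁻¹) ^ (-β) * N ^ (-β) ≤ (1 + ℓ j) ^ (-β) := by
        rw [← Real.mul_rpow (by positivity) hN0.le]
        exact Real.rpow_le_rpow_of_nonpos hpos h1 (by linarith)
      have h3 : c₁ * ((1 + δ⁻¹) ^ (-β) * N ^ (-β)) ≤
          (1 + ℓ j) ^ (-β) * F (Real.log (ℓ j)) := by
        rw [mul_comm c₁]
        exact mul_le_mul h2 (hFlow _) hc₁.le (by positivity)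
      have := mul_le_mul_of_nonneg_left h3 (hw0 (heatMult ℓ N j))
      simp only [hH, hW]
      linarith
    · rw [h.bandLimited_apply hWb hj, h.bandLimited_apply hHb hj, mul_zero]
  have hdiagH : ∀ x, d * N ^ (-β) * N ^ α ≤ multKernel φ H x x := by
    intro x
    have h1 : c₁ * (1 + δ⁻¹) ^ (-β) * N ^ (-β) * multKernel φ W x x ≤ multKernel φ H x x := by
      rw [h.multKernel_eq_sum hWb, h.multKernel_eq_sum hHb, Finset.mul_sum]
      refine Finset.sum_le_sum fun j _ => ?_
      have := mul_le_mul_of_nonneg_right (hHlow j) (mul_self_nonneg (φ j x))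
      linarith
    refine le_trans ?_ h1
    have h2 := mul_le_mul_of_nonneg_left (hdiag N hNB₀ x)
      (by positivity : 0 ≤ c₁ * (1 + δ⁻¹) ^ (-β) * N ^ (-β))
    refine le_trans (le_of_eq ?_) h2
    rw [hd]
    ring
  have h1 := hstab p hp C N₁ hN₁ hsep N hNB₁ H (N ^ (-β)) (by positivity) hdiagH
    (fun x y => hlocb N hN1 x y) a
  set Ψ : X → ℂ := fun x => ((∑ y ∈ C, a y * G x y : ℝ) : ℂ) with hΨ
  have hΨi : Integrable Ψ μ := integrable_eignet hG C a
  set W' : ℕ → ℝ := fun j => W j * (1 + ℓ j) ^ (-r) with hW'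
  have hW'b : BandLimited ℓ (δ⁻¹ * N) W' := hWb.mul_right _
  -- the band of `Ψ` is the band of `f`, written in terms of `u`, minus the band of `f - Ψ`
  have e1 : (fun x => ∑ y ∈ C, (a y : ℂ) * (multKernel φ H x y : ℂ)) =
      fun x => multOp μ φ W' u x - multOp μ φ W (fun x => f x - Ψ x) x := by
    rw [h.sum_multKernel_eq hHb, h.multOp_eq_sum hW'b, h.multOp_eq_sum hWb]
    funext x
    rw [← Finset.sum_sub_distrib]
    refine Finset.sum_congr rfl fun j _ => ?_
    have hpos : 0 < 1 + ℓ j := by linarith [h.ell_nonneg j]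
    rw [← sub_mul, h.coeff_sub hf hΨi, h.coeff_eignet hG, hfu.2]
    congr 1
    have e2 : ((W' j : ℝ) : ℂ) * ((((1 + ℓ j) ^ r : ℝ) : ℂ) * coeff μ φ f j) =
        (W j : ℂ) * coeff μ φ f j := by
      rw [← mul_assoc, ← Complex.ofReal_mul]
      congr 2
      simp only [hW']
      rw [mul_assoc, ← Real.rpow_add hpos, neg_add_cancel, Real.rpow_zero, mul_one]
    rw [e2, hHW]
    unfold eignetCoeff
    push_cast
    ring
  have h2 := hsamp p hp C N₁ hN₁ hsep _ W A₁ N hWb hN1N hA₁.le (fun x y => hloc1 N hN1 x y)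
    (fun x => f x - Ψ x) (hf.sub hΨi)
  have h3 := hsamp p hp C N₁ hN₁ hsep _ W' (A₂ * N ^ (-r)) N hW'b hN1N (by positivity)
    (fun x y => hloc2 N hN1 x y) u hfu.1
  set θ := (p⁻¹).toReal with hθ
  rw [e1] at h1
  refine h1.trans ?_
  have h4 : eLpNorm (fun x => multOp μ φ W' u x - multOp μ φ W (fun x => f x - Ψ x) x) p
      (centerMeasure C) ≤ ENNReal.ofReal ((A₁ + A₂) * K * N ^ (α * θ)) *
        (eLpNorm (fun x => f x - Ψ x) p μ + ENNReal.ofReal (N ^ (-r)) * eLpNorm u p μ) := by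
    refine (eLpNorm_sub_le (aestronglyMeasurable_centerMeasure C _)
      (aestronglyMeasurable_centerMeasure C _) hp).trans ?_
    rw [add_comm, mul_add]
    refine add_le_add (h2.trans ?_) (h3.trans ?_)
    · gcongr
      linarith
    · rw [← mul_assoc, ← ENNReal.ofReal_mul (by positivity)]
      refine mul_le_mul_left (ENNReal.ofReal_le_ofReal ?_) _
      have : 0 ≤ A₁ * K * N ^ (α * θ) * N ^ (-r) := by positivity
      nlinarith
  refine (mul_le_mul_right h4 _).trans (le_of_eq ?_)
  rw [← mul_assoc, ← ENNReal.ofReal_mul (by positivity)]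
  congr 2
  have e3 : N ^ (β - α * (1 - θ)) * (N ^ (-β) * N ^ α) = N ^ (α * θ) := by
    rw [← Real.rpow_add hN0, ← Real.rpow_add hN0]
    congr 1
    ring
  rw [← e3]
  have hp1 : 0 < N ^ (-β) := by positivity
  have hp2 : 0 < N ^ α := by positivity
  field_simp

end IsHeatSystem

/-- The maximum with `1` makes the scale `max 1 κ₁⁻¹ * m` at least `1`. -/
lemma IsCenterSequence.isSeparatedBy {κ₁ κ₂ : ℝ} (hκ₁ : 0 < κ₁) {C : ℕ → Finset X}
    (hC : IsCenterSequence κ₁ κ₂ C) {m : ℕ} (hm : 1 ≤ m) :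
    IsSeparatedBy (C m) (1 / (max 1 κ₁⁻¹ * m)) := by
  have hm' : (0 : ℝ) < m := by exact_mod_cast hm
  intro x hx y hy hxy
  have h1 : (C m : Set X).infsep ≤ dist x y :=
    Set.infsep_le_dist_of_mem hx hy hxy
  refine le_trans ?_ ((hC.sep_lower m hm).trans h1)
  rw [div_le_div_iff₀ (by positivity) hm']
  have h2 : κ₁⁻¹ ≤ max 1 κ₁⁻¹ := le_max_right _ _
  have h3 : 1 ≤ κ₁ * max 1 κ₁⁻¹ := by
    calc (1 : ℝ) = κ₁ * κ₁⁻¹ := (mul_inv_cancel₀ hκ₁.ne').symm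
      _ ≤ _ := by gcongr
  nlinarith

namespace IsHeatSystem

variable [CompactSpace X] [BorelSpace X] [IsProbabilityMeasure μ]

/-- The error estimate for a single eignet `Ψ` with `1 / (κ M)`-separated centers. The difference
`(Δ*)^γ f - (Δ*)^γ Ψ` is split at a frequency `2^k` comparable to `M`: below it Bernstein's
inequality applies to `f - Ψ`, above it `f` is small by its smoothness and `Ψ` by the bound on
its coefficients. -/
theorem exists_eLpNorm_deltaStar_sub_le (h : IsHeatSystem μ φ ℓ α) {S : ℕ} (hS : α < S) {β : ℝ}
    {b : ℝ → ℝ} (hb : IsMask S β b) {G : X → X → ℝ} (hG : HasFormalExpansion μ φ ℓ b G)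
    {p : ℝ≥0∞} (hp : 1 ≤ p) {γ r : ℝ} (hγ : 0 < γ) (hγβ : γ < β - α * (1 - (p⁻¹).toReal))
    (hγr : γ ≤ r) {κ : ℝ} (hκ : 1 ≤ κ) {c : ℝ} (hc : 0 < c) :
    ∃ c' > 0, ∀ (C : Finset X) (M : ℝ), 1 ≤ M → IsSeparatedBy C (1 / (κ * M)) →
      ∀ f u : X → ℂ, f ∈ closureLp μ φ ℓ p → u ∈ closureLp μ φ ℓ p → IsDeltaStar μ φ ℓ r f u →
      ∀ a : X → ℝ, eLpNorm (fun x => f x - ((∑ y ∈ C, a y * G x y : ℝ) : ℂ)) p μ ≤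
          ENNReal.ofReal (c * M ^ (-r)) * eLpNorm u p μ →
      ∀ v w : X → ℂ, IsDeltaStar μ φ ℓ γ f v →
        IsDeltaStar μ φ ℓ γ (fun x => ((∑ y ∈ C, a y * G x y : ℝ) : ℂ)) w →
        eLpNorm (fun x => v x - w x) p μ ≤
          ENNReal.ofReal (c' * M ^ (γ - r)) * eLpNorm u p μ := by
  have hα := h.alpha_pos
  obtain ⟨hθ0, hθ1⟩ := toReal_inv_mem_Icc hp
  set θ := (p⁻¹).toReal with hθ
  have hβ : 0 ≤ β := by nlinarith
  obtain ⟨B, hB, Q, hQ, hcoef⟩ := h.exists_eLpNorm_eignet_coefficients_le hS hβ hb hG hp r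
  obtain ⟨T, hT, hhigh⟩ := h.exists_eignet_highPass hS hb hp (s := γ) (by linarith)
  obtain ⟨C₁, hC₁, hbern⟩ := h.exists_eLpNorm_lowPass_le hγ
  obtain ⟨C₂, hC₂, hsm⟩ := h.exists_highPass (s := r - γ) (by linarith)
  set W : ℝ := (2 * (B * κ)) ^ γ with hW
  have hW0 : 0 < W := by positivity
  refine ⟨C₁ * W * c + C₂ + T * Q * W * (c + 1), by positivity, ?_⟩
  intro C M hM hsep f u hf hu hfu a hfa v w hv hw
  have hM0 : 0 < M := by linarith
  have hBκ : 1 ≤ B * κ := one_le_mul_of_one_le_of_one_le hB hκ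
  have hκM : 1 ≤ κ * M := one_le_mul_of_one_le_of_one_le hκ hM
  -- the splitting frequency: the least power of two above `B * κ * M`
  obtain ⟨k, hk1, hk2⟩ : ∃ k : ℕ, B * (κ * M) ≤ 2 ^ k ∧ (2 : ℝ) ^ k ≤ 2 * (B * κ) * M := by
    obtain ⟨k, hk, hk'⟩ := exists_nat_pow_near (x := B * (κ * M))
      (one_le_mul_of_one_le_of_one_le hB hκM) (one_lt_two (α := ℝ))
    exact ⟨k + 1, hk'.le, by rw [pow_succ]; linarith⟩
  set N : ℝ := 2 ^ k with hN
  have hN0 : 0 < N := by positivity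
  have hMN : M ≤ N := by
    refine le_trans ?_ hk1
    rw [← mul_assoc]
    nlinarith
  have hNγ : N ^ γ ≤ W * M ^ γ := by
    rw [hW, ← Real.mul_rpow (by positivity) hM0.le]
    exact Real.rpow_le_rpow hN0.le hk2 hγ.le
  set Ψ : X → ℂ := fun x => ((∑ y ∈ C, a y * G x y : ℝ) : ℂ) with hΨ
  have hΨi : Integrable Ψ μ := integrable_eignet hG C a
  have hfi : Integrable f μ := hf.1.integrable hp
  set E := eLpNorm u p μ with hE
  have hbl : BandLimited ℓ (2 * N) fun j => lowPass ℓ N j * (1 + ℓ j) ^ γ :=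
    (bandLimited_lowPass hN0).mul_right _
  -- `g₁` is the low-frequency part of `(Δ*)^γ (f - Ψ)`, `g₂` and `g₃` are the high-frequency parts
  -- of `(Δ*)^γ f` and `(Δ*)^γ Ψ`
  set g₁ : X → ℂ := multOp μ φ (fun j => lowPass ℓ N j * (1 + ℓ j) ^ γ) (fun x => f x - Ψ x)
    with hg₁
  have hg₁L : MemLp g₁ p μ :=
    h.memLp_of_mem_diffusionPoly (h.multOp_mem_diffusionPoly hbl _) p
  obtain ⟨g₂, hg₂, hg₂n, hg₂c⟩ := hsm p hp k u hu
  obtain ⟨g₃, hg₃, hg₃n, hg₃c⟩ := hhigh C (κ * M) hκM hsep k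
    (le_trans (by nlinarith) hk1) a
  have hn₁ : eLpNorm g₁ p μ ≤ ENNReal.ofReal (C₁ * W * c * M ^ (γ - r)) * E := by
    refine (hbern p hp k _ (hfi.sub hΨi)).trans ((mul_le_mul_right hfa _).trans ?_)
    rw [← mul_assoc, ← ENNReal.ofReal_mul (by positivity)]
    refine mul_le_mul_left (ENNReal.ofReal_le_ofReal ?_) _
    have e : ((2 : ℝ) ^ γ) ^ k = N ^ γ := by
      rw [hN, ← Real.rpow_natCast, ← Real.rpow_natCast, ← Real.rpow_mul (by norm_num),
        ← Real.rpow_mul (by norm_num), mul_comm]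
    calc C₁ * ((2 : ℝ) ^ γ) ^ k * (c * M ^ (-r))
        ≤ C₁ * (W * M ^ γ) * (c * M ^ (-r)) := by
          rw [e]
          gcongr
      _ = C₁ * W * c * (M ^ γ * M ^ (-r)) := by ring
      _ = _ := by rw [← Real.rpow_add hM0, ← sub_eq_add_neg]
  have hn₂ : eLpNorm g₂ p μ ≤ ENNReal.ofReal (C₂ * M ^ (γ - r)) * E := by
    refine hg₂n.trans (mul_le_mul_left (ENNReal.ofReal_le_ofReal ?_) _)
    have e : ((2 : ℝ) ^ (-(r - γ))) ^ k = N ^ (γ - r) := by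
      rw [hN, ← Real.rpow_natCast, ← Real.rpow_natCast, ← Real.rpow_mul (by norm_num),
        ← Real.rpow_mul (by norm_num)]
      congr 1
      ring
    rw [e]
    exact mul_le_mul_of_nonneg_left (Real.rpow_le_rpow_of_nonpos hM0 hMN (by linarith)) hC₂.le
  have hn₃ : eLpNorm g₃ p μ ≤ ENNReal.ofReal (T * Q * W * (c + 1) * M ^ (γ - r)) * E := by
    have h1 := hcoef C (κ * M) hκM hsep N hk1 f u hfi hfu a
    have h2 : eLpNorm (fun x => f x - Ψ x) p μ + ENNReal.ofReal (N ^ (-r)) * E ≤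
        ENNReal.ofReal ((c + 1) * M ^ (-r)) * E := by
      have h3 : N ^ (-r) ≤ M ^ (-r) := Real.rpow_le_rpow_of_nonpos hM0 hMN (by linarith)
      calc _ ≤ ENNReal.ofReal (c * M ^ (-r)) * E + ENNReal.ofReal (M ^ (-r)) * E := by gcongr
        _ = _ := by
          rw [← add_mul, ← ENNReal.ofReal_add (by positivity) (by positivity)]
          congr 2
          ring
    refine hg₃n.trans ?_
    refine (mul_le_mul_right (h1.trans (mul_le_mul_right h2 _)) _).trans ?_
    rw [← mul_assoc, ← mul_assoc, ← ENNReal.ofReal_mul (by positivity),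
      ← ENNReal.ofReal_mul (by positivity)]
    refine mul_le_mul_left (ENNReal.ofReal_le_ofReal ?_) _
    have e : ((2 : ℝ) ^ (γ - β + α * (1 - θ))) ^ k * N ^ (β - α * (1 - θ)) = N ^ γ := by
      rw [hN, ← Real.rpow_natCast, ← Real.rpow_natCast, ← Real.rpow_mul (by norm_num),
        ← Real.rpow_mul (by norm_num), ← Real.rpow_add (by norm_num),
        ← Real.rpow_mul (by norm_num)]
      congr 1
      ring
    calc T * ((2 : ℝ) ^ (γ - β + α * (1 - θ))) ^ k * (Q * N ^ (β - α * (1 - θ))) *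
          ((c + 1) * M ^ (-r))
        = T * Q * (c + 1) * M ^ (-r) *
          (((2 : ℝ) ^ (γ - β + α * (1 - θ))) ^ k * N ^ (β - α * (1 - θ))) := by ring
      _ ≤ T * Q * (c + 1) * M ^ (-r) * (W * M ^ γ) := by
          rw [e]
          gcongr
      _ = T * Q * W * (c + 1) * (M ^ γ * M ^ (-r)) := by ring
      _ = _ := by rw [← Real.rpow_add hM0, ← sub_eq_add_neg]
  -- the pieces add up, since the coefficients agree
  have hae : (fun x => v x - w x) =ᵐ[μ] fun x => g₁ x + g₂ x - g₃ x := by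
    have hi₁ := hg₁L.integrable hp
    have hi₂ := hg₂.1.integrable hp
    have hi₃ := hg₃.1.integrable hp
    refine h.ae_eq_of_coeff_eq (hv.1.sub hw.1) ((hi₁.add hi₂).sub hi₃) fun j => ?_
    have hpos : 0 < 1 + ℓ j := by linarith [h.ell_nonneg j]
    have e : (1 + ℓ j) ^ γ = (1 + ℓ j) ^ (-(r - γ)) * (1 + ℓ j) ^ r := by
      rw [← Real.rpow_add hpos]
      congr 1
      ring
    rw [h.coeff_sub hv.1 hw.1, h.coeff_sub (f := fun x => g₁ x + g₂ x) (hi₁.add hi₂) hi₃,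
      h.coeff_add hi₁ hi₂, hg₂c, hg₃c, hg₁, h.coeff_multOp hbl, h.coeff_sub hfi hΨi, h.coeff_eignet hG, hv.2,
      hw.2, h.coeff_eignet hG, hfu.2, e]
    push_cast
    ring
  rw [eLpNorm_congr_ae hae]
  have hsum : eLpNorm (fun x => g₁ x + g₂ x - g₃ x) p μ ≤
      eLpNorm g₁ p μ + eLpNorm g₂ p μ + eLpNorm g₃ p μ :=
    (eLpNorm_sub_le (hg₁L.1.add hg₂.1.1) hg₃.1.1 hp).trans
      (add_le_add_left (eLpNorm_add_le hg₁L.1 hg₂.1.1 hp) _)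
  refine (hsum.trans (add_le_add (add_le_add hn₁ hn₂) hn₃)).trans (le_of_eq ?_)
  rw [← add_mul, ← add_mul, ← ENNReal.ofReal_add (by positivity) (by positivity),
    ← ENNReal.ofReal_add (by positivity) (by positivity)]
  congr 2
  ring

end IsHeatSystem

end Eignet

open Eignet
/-- Simultaneous approximation by eignets. The number `α / p'` is `α * (1 - 1 / p)`. -/
theorem theorem3p5 {n : ℕ} {X : Type*} [MetricSpace X] [CompactSpace X] [ConnectedSpace X]
    [ChartedSpace (EuclideanSpace ℝ (Fin n)) X] [IsManifold (𝓡 n) ∞ X]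
    [Bundle.RiemannianBundle (fun x : X => TangentSpace (𝓡 n) x)]
    [IsContMDiffRiemannianBundle (𝓡 n) ∞ (EuclideanSpace ℝ (Fin n))
      (fun x : X => TangentSpace (𝓡 n) x)]
    [IsRiemannianManifold (𝓡 n) X]
    [MeasurableSpace X] [BorelSpace X] (μ : Measure X) [IsProbabilityMeasure μ]
    (φ : ℕ → X → ℝ) (ℓ : ℕ → ℝ) (α A : ℝ)
    (hsys : IsAdmissibleSystem (n := n) μ φ ℓ α A)
    (hlow : HeatLowerBound φ ℓ α)
    (S : ℕ) (hS : α < S) (β : ℝ) (b : ℝ → ℝ) (hb : IsMask S β b)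
    (G : X → X → ℝ) (hG : HasFormalExpansion μ φ ℓ b G)
    (p : ℝ≥0∞) (hp : 1 ≤ p) (γ r : ℝ) (hγ : 0 < γ)
    (hγβ : γ < β - α * (1 - (p⁻¹).toReal)) (hγr : γ ≤ r) (hrβ : r < β)
    (κ₁ κ₂ c : ℝ) (hκ₁ : 0 < κ₁) (hκ₂ : 0 < κ₂) (hc : 0 < c) :
    ∃ c' : ℝ, 0 < c' ∧
      ∀ C : ℕ → Finset X, IsCenterSequence κ₁ κ₂ C →
      ∀ f Drf : X → ℂ, f ∈ closureLp μ φ ℓ p → Drf ∈ closureLp μ φ ℓ p →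
        IsDeltaStar μ φ ℓ r f Drf →
        f ∈ smoothClass μ φ ℓ p γ ∧
        ∀ m : ℕ, 1 ≤ m → ∀ Ψ ∈ eignets G (C m),
          (fun x => (Ψ x : ℂ)) ∈ smoothClass μ φ ℓ p γ ∧
          (eLpNorm (fun x => f x - (Ψ x : ℂ)) p μ ≤
              ENNReal.ofReal (c * (m : ℝ) ^ (-r)) * eLpNorm Drf p μ →
            ∀ Dγf DγΨ : X → ℂ, IsDeltaStar μ φ ℓ γ f Dγf →
              IsDeltaStar μ φ ℓ γ (fun x => (Ψ x : ℂ)) DγΨ →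
              eLpNorm (fun x => Dγf x - DγΨ x) p μ ≤
                ENNReal.ofReal (c' * (m : ℝ) ^ (γ - r)) * eLpNorm Drf p μ) := by
  have h := hsys.isHeatSystem hlow
  have hα := h.alpha_pos
  obtain ⟨c', hc', hmain⟩ := h.exists_eLpNorm_deltaStar_sub_le hS hb hG hp hγ hγβ hγr
    (le_max_left 1 κ₁⁻¹) hc
  refine ⟨c', hc', fun C hC f Drf hf hDrf hfu =>
    ⟨⟨hf, h.exists_deltaStar_of_le hp hγr hDrf hfu⟩, fun m hm Ψ hΨ => ?_⟩⟩
  obtain ⟨a, rfl⟩ := hΨ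
  have hm1 : (1 : ℝ) ≤ m := by exact_mod_cast hm
  have hsep := hC.isSeparatedBy hκ₁ hm
  have hN₁ : 1 ≤ max 1 κ₁⁻¹ * (m : ℝ) :=
    one_le_mul_of_one_le_of_one_le (le_max_left _ _) hm1
  exact ⟨⟨h.eignet_mem_closureLp hS hb hG hp (by linarith) hN₁ hsep a,
    h.exists_deltaStar_eignet hS hb hG hp (by linarith) hN₁ hsep a⟩,
    fun hle v w hv hw => hmain (C m) m hm1 hsep f Drf hf hDrf hfu a hle v w hv hw⟩
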